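/- Let $M,B\ge 1$ be integers and $N=MB$. Clients $i\in[N]$ have availability probabilities $p_i>0$ with $\sum_i p_i=1$, and a minimum separation $0\le R<M-1$ is fixed. In every round $t=0,1,\dots$ an ordered batch $X_t$ of $B$ distinct clients is sampled. The first $R$ batches have an arbitrary joint law on pairwise disjoint batches. For $t\ge R$, given the whole past, $X_t$ is disjoint from $X_{t-1},\dots,X_{t-R}$, and each batch $J$ disjoint from these is drawn with probability proportional to $\sum_{e\in J}p_e$. The window $Y_t=(X_t,\dots,X_{t-R+1})$ is a first-order Markov chain on the windows of $R$ pairwise disjoint ordered batches; let $P$ be its transition matrix, $\zeta$ its stationary distribution, $\tau_{mix}=\inf\{l\ge 1:\max_y\|P^l(y,\cdot)-\zeta\|_{TV}\le 1/4\}$ (for $R=0$ there is a single window and $\tau_{mix}=1$), $\pi_R^i$ the probability that client $i$ is the first entry of the next batch when the window has law $\zeta$, and $\pi_{\min}=\min_i\pi_R^i$. Let $f_1,\dots,f_N:\mathbb R^d\to\mathbb R$ be differentiable, and $F=\frac1N\sum_i f_i$. Assume, with $G>0$ and $L\ge 0$: (bounded heterogeneity) $\|\nabla f_i(x)-\nabla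 F(x)\|^2\le G^2$ for all $x$ and $i$; ($L$-smoothness) $\|\nabla f_i(x)-\nabla f_i(y)\|\le L\|x-y\|$ for all $x,y$ and $i$; and that $F$ is bounded below with $F(x_0)-\inf F\le\Delta$, where $x_0$ is the initial point. No bound on the gradients is assumed. Debiased FedAvg with $K\ge 1$ local steps and step size $\alpha$ is defined as follows. In round $t$, let $S_t$ be the set of clients in $X_t$. For $i\in S_t$ let $t_i$ be the number of rounds among $0,\dots,t$ in which $i$ has participated, $\lambda_t^i=\frac{t_i}{(t+1)B}$ and $\nu_t^i=\frac1{\lambda_t^iN}$. Client $i\in S_t$ starts at $x_{t,0}^i=x_t$ and computes $x_{t,k+1}^i=x_{t,k}^i-\alpha\nu_t^i\nabla f_i(x_{t,k}^i)$ for $0\le k<K$. The server sets $x_{t+1}=\frac1B\sum_{i\in S_t}x_{t,K}^i$. For $T\ge 1$ the output $\tilde x_T$ is drawn uniformly from $x_0,\dots,x_{T-1}$, independently of the sampled batches. Then there is an absolute integer $k\ge 0$ such that for all $0<c_1\le c_2$ there are constants $c^\dagger,C>0$, depending only on $M,B,\pi_{\min},L,G,\Delta,c_1,c_2$, for which the following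 holds. Whenever $$T>c^\dagger\,\tau_{mix}\log\tau_{mix}\qquad\text{and}\qquad \frac{c_1}{\tau_{mix}K\sqrt T}\le\alpha\le\frac{c_2}{\tau_{mix}K\sqrt T},$$ we have $$\mathbb E\|\nabla F(\tilde x_T)\|^2\le C\,\frac{\tau_{mix}(\log T)^k}{\sqrt T}+\frac CT .$$ -/

import Mathlib

open MeasureTheory ProbabilityTheory

noncomputable section

namespace DebiasedFedAvg

/-! ### Client participation with a minimum separation -/

/-- An ordered batch of `B` distinct clients among `N` clients. -/
abbrev Batch (N B : ℕ) : Type := Fin B ↪ Fin N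

/-- The space of batches is finite; it carries the discrete sigma-algebra. -/
instance instMeasurableSpaceBatch (N B : ℕ) : MeasurableSpace (Batch N B) := ⊤

/-- The set of clients in an ordered batch. -/
def clients {N B : ℕ} (J : Batch N B) : Finset (Fin N) := Finset.univ.map J

/-- `p_J = ∑_{e ∈ J} p_e`. -/
def batchWeight {N B : ℕ} (p : Fin N → ℝ) (J : Batch N B) : ℝ := ∑ e, p (J e)

/-- `J` uses no client that occurs in the window `w` of the last `R` batches. -/
def Available {N B R : ℕ} (w : Fin R → Batch N B) (J : Batch N B) : Prop :=
  ∀ k, Disjoint (clients (w k)) (clients J)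

open Classical in
/-- Probability that the next batch is `J` when the last `R` batches are `w 0` (the most recent),
`w 1`, ..., `w (R - 1)`: proportional to `p_J` among the available batches, and zero otherwise. -/
def stepProb {N B R : ℕ} (p : Fin N → ℝ) (w : Fin R → Batch N B) (J : Batch N B) : ℝ :=
  if Available w J then
    batchWeight p J / ∑ J' : Batch N B, if Available w J' then batchWeight p J' else 0
  else 0

/-- The states of the augmented first-order chain: windows of `R` pairwise disjoint batches,
the most recent one first. -/
abbrev Window (N B R : ℕ) : Type :=
  {w : Fin R → Batch N B // ∀ j k, j ≠ k → Disjoint (clients (w j)) (clients (w k))}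

instance instFintypeWindow (N B R : ℕ) : Fintype (Window N B R) := Fintype.ofFinite _

instance instDecidableEqWindow (N B R : ℕ) : DecidableEq (Window N B R) := Classical.decEq _

/-- Put the new batch `J` in front of the window `w` and drop the oldest batch. -/
def shift {N B R : ℕ} (J : Batch N B) (w : Fin R → Batch N B) : Fin R → Batch N B :=
  fun k => (Fin.cons J w : Fin (R + 1) → Batch N B) k.castSucc

open Classical in
/-- The transition matrix `P_R` of the augmented chain. (If `R = 0`, the only state is the empty
window and the matrix is `(1)`.) -/
def transitionMatrix (N B R : ℕ) (p : Fin N → ℝ) :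
    Matrix (Window N B R) (Window N B R) ℝ :=
  fun w w' => ∑ J : Batch N B, if w'.1 = shift J w.1 then stepProb p w.1 J else 0

/-- `ζ` is a stationary distribution of the transition matrix `P`. -/
def IsStationary {S : Type*} [Fintype S] (P : Matrix S S ℝ) (ζ : S → ℝ) : Prop :=
  (∀ s, 0 ≤ ζ s) ∧ ∑ s, ζ s = 1 ∧ ∀ s', ∑ s, ζ s * P s s' = ζ s'

open Classical in
/-- The stationary distribution of a finite chain (`0` if there is none; it is used only for
chains that have exactly one). -/
def stationary {S : Type*} [Fintype S] (P : Matrix S S ℝ) : S → ℝ :=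
  if h : ∃ ζ, IsStationary P ζ then h.choose else 0

/-- Total variation distance of two mass functions on a finite set. -/
def tvDist {S : Type*} [Fintype S] (a b : S → ℝ) : ℝ := (1 / 2) * ∑ s, |a s - b s|

/-- `t_mix(ε) = inf {l ≥ 1 | max_s ‖P^l(s, ·) - ζ‖_TV ≤ ε}`, with `ζ` stationary. -/
def mixingTime {S : Type*} [Fintype S] [DecidableEq S] (P : Matrix S S ℝ) (ε : ℝ) : ℕ :=
  sInf {l : ℕ | 1 ≤ l ∧ ∀ s, tvDist ((P ^ l) s) (stationary P) ≤ ε}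

/-- `τ_mix = t_mix(1/4)` of the augmented participation chain. -/
def tauMix (N B R : ℕ) (p : Fin N → ℝ) : ℕ := mixingTime (transitionMatrix N B R p) (1 / 4)

open Classical in
/-- `π_R^i`: stationary probability that client `i` is the first entry of the sampled batch. -/
def clientStationary (N B R : ℕ) [NeZero B] (p : Fin N → ℝ) (i : Fin N) : ℝ :=
  ∑ w : Window N B R, stationary (transitionMatrix N B R p) w *
    ∑ J : Batch N B, if J 0 = i then stepProb p w.1 J else 0

/-- `X t` is the ordered batch sampled in round `t`: the first `R` batches have an arbitrary joint
law on pairwise disjoint batches, and from round `R` on the batch is drawn, given the whole past,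
with the probabilities `stepProb` determined by the last `R` batches. -/
structure IsParticipationProcess {Ω : Type*} [MeasurableSpace Ω] {N B : ℕ} (μ : Measure Ω)
    (R : ℕ) (p : Fin N → ℝ) (X : ℕ → Ω → Batch N B) : Prop where
  measurable : ∀ t, Measurable (X t)
  initial : ∀ᵐ ω ∂μ, ∀ s t, s < t → t < R → Disjoint (clients (X s ω)) (clients (X t ω))
  step : ∀ t, R ≤ t → ∀ J : ℕ → Batch N B,
    μ.real {ω | ∀ s ≤ t, X s ω = J s} =
      μ.real {ω | ∀ s < t, X s ω = J s} * stepProb p (fun k : Fin R => J (t - 1 - k)) (J t)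

/-! ### The algorithm, along one realization `S` of the sampled batches -/

/-- The counter `t_i` after its update in round `t`: the number of rounds among `0, ..., t` in
which client `i` has participated. -/
def participationCount {N B : ℕ} (S : ℕ → Batch N B) (t : ℕ) (i : Fin N) : ℕ :=
  ((Finset.range (t + 1)).filter fun s => i ∈ clients (S s)).card

/-- `λ_t^i = t_i / ((t + 1) B)`. -/
def lam {N B : ℕ} (S : ℕ → Batch N B) (t : ℕ) (i : Fin N) : ℝ :=
  (participationCount S t i : ℝ) / (((t : ℝ) + 1) * (B : ℝ))

/-- `ν_t^i = 1 / (λ_t^i N)`; it is used only for clients that participate in round `t`. -/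
def nu {N B : ℕ} (S : ℕ → Batch N B) (t : ℕ) (i : Fin N) : ℝ := 1 / (lam S t i * (N : ℝ))

/-- The local model after `k` gradient steps of size `s` on `g`, started at `x`. -/
def localModel {d : ℕ} (g : EuclideanSpace ℝ (Fin d) → ℝ) (s : ℝ)
    (x : EuclideanSpace ℝ (Fin d)) : ℕ → EuclideanSpace ℝ (Fin d)
  | 0 => x
  | k + 1 => localModel g s x k - s • gradient g (localModel g s x k)

/-- The server model `x_t` of debiased FedAvg with step size `α` and `K` local steps. -/
def serverModel {N B d : ℕ} (f : Fin N → EuclideanSpace ℝ (Fin d) → ℝ) (α : ℝ) (K : ℕ)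
    (x₀ : EuclideanSpace ℝ (Fin d)) (S : ℕ → Batch N B) : ℕ → EuclideanSpace ℝ (Fin d)
  | 0 => x₀
  | t + 1 => (1 / (B : ℝ)) •
      ∑ i ∈ clients (S t), localModel (f i) (α * nu S t i) (serverModel f α K x₀ S t) K

/-- The global objective `F = (1/N) ∑ f_i`. -/
def globalObj {N d : ℕ} (f : Fin N → EuclideanSpace ℝ (Fin d) → ℝ)
    (x : EuclideanSpace ℝ (Fin d)) : ℝ := (1 / (N : ℝ)) * ∑ i, f i x

end DebiasedFedAvg

end

open DebiasedFedAvg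

/-! Mixing. Since (R + 1)B < N there is always a spare client, so any window can be turned into any
other by changing one client at a time. A power of the transition matrix is therefore positive, τ =
τ_mix is a genuine mixing time and every π^i is positive. After a lag of τm rounds, the conditional
probability that client i participates is within 2^{-m} of β_i = Bπ^i. The choice m = ⌊log₂ T⌋ + 1
makes this error at most 1/T. The later probabilistic estimates use only this property, recorded in
`IsMixingExpectation`.

Descent. The point x_r depends on the batches before round r only, so the batch of round r + l, with
l of order τ log T, is nearly decoupled from it. If ν^i is replaced by its limit B/(Nβ_i), the mean
update of that round is nearly -αK∇F(x_r): the debiasing weights cancel the sampling bias. Two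
errors remain. The drift over l rounds has relative size z of order αKLl. The error of ν^i has
second moment O(l/r), by concentration of the participation counts (`tail_le`, `second_moment_le`).
Telescoping and dividing by αKT leaves terms of order 1/(αKT), z, 1/T and l log T / T.

Unbounded gradients. Drift is measured against U = ‖∇F(x_r)‖ + G by Grönwall arguments, so every
error is a small multiple of U² or a mixed term, and its ‖∇F‖² part is absorbed by the descent
(`accurate_descent`). The event of inaccurate counts needs a bound valid on every path: the factors
ν of one client sum like a harmonic series, whence `sum_nuSum_le`, and the optimality gap after t
rounds is at most exponential in αKLBt(1 + log t) (`gapBound`). As αK is of order 1/(τ√T), this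
exponent is of order t log T/(τ√T), whereas inaccurate counts have probability exp(-c r/(τ log T)).
The probability wins once log²T is small against √T. In a burn-in of order τ log²T rounds the gap
stays bounded once log³T is small against √T. Neither threshold involves τ, so the finitely many
smaller T are covered by the term C/T. -/

namespace DebiasedFedAvg

/-! ### Oscillation contraction and mixing of finite Markov chains -/

section FiniteChain

variable {S : Type*} [Fintype S]

/-- Two measures of equal mass integrate a function almost equally if its oscillation is small. -/
theorem abs_sum_sub_sum_le_of_osc [Nonempty S] {a b g : S → ℝ} {c o : ℝ} (hab : ∑ s, a s = ∑ s, b s)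
    (htv : ∑ s, |a s - b s| ≤ 2 * c) (hg : ∀ s s', |g s - g s'| ≤ o) :
    |∑ s, a s * g s - ∑ s, b s * g s| ≤ c * o := by
  obtain ⟨M, hM⟩ := Finite.exists_max g
  obtain ⟨m, hm⟩ := Finite.exists_min g
  have ho := hg M m
  -- Centring g at the middle of its range leaves a sup norm of o / 2, which compensates the 2 in
  -- `htv`.
  set mid := (g M + g m) / 2
  have hmid : ∀ s, |g s - mid| ≤ o / 2 := by
    intro s
    have h1 := hM s
    have h2 := hm s
    have h3 := (abs_le.1 ho).2
    rw [abs_le]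
    constructor <;> simp only [mid] <;> linarith
  have key : ∑ s, a s * g s - ∑ s, b s * g s = ∑ s, (a s - b s) * (g s - mid) := by
    have : ∑ s, (a s - b s) * (g s - mid)
        = (∑ s, a s * g s - ∑ s, b s * g s) - (∑ s, a s - ∑ s, b s) * mid := by
      rw [← Finset.sum_sub_distrib, ← Finset.sum_sub_distrib, Finset.sum_mul,
        ← Finset.sum_sub_distrib]
      exact Finset.sum_congr rfl fun s _ => by ring
    rw [this, hab]; ring
  have ho0 : 0 ≤ o := (abs_nonneg _).trans ho
  calc |∑ s, a s * g s - ∑ s, b s * g s| ≤ ∑ s, |a s - b s| * (o / 2) := by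
        rw [key]
        refine (Finset.abs_sum_le_sum_abs _ _).trans (Finset.sum_le_sum fun s _ => ?_)
        rw [abs_mul]
        exact mul_le_mul_of_nonneg_left (hmid s) (abs_nonneg _)
    _ = (∑ s, |a s - b s|) * (o / 2) := by rw [Finset.sum_mul]
    _ ≤ 2 * c * (o / 2) := mul_le_mul_of_nonneg_right htv (by positivity)
    _ = c * o := by ring

variable [DecidableEq S]

open Matrix

/-- Constants are right null vectors of P - 1, so there is a left null vector v ≠ 0. Then |v| ≤ |v|P
entrywise with equal total mass, which forces equality; |v| is normalized. -/
theorem exists_isStationary [Nonempty S] {P : Matrix S S ℝ} (hP : P ∈ rowStochastic ℝ S) :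
    ∃ ζ, IsStationary P ζ := by
  have hdet : (P - 1).det = 0 := by
    rw [← Matrix.exists_mulVec_eq_zero_iff]
    refine ⟨fun _ => 1, fun h => one_ne_zero (congrFun h (Classical.arbitrary S)), ?_⟩
    ext s
    have := congrFun (mem_rowStochastic.1 hP).2 s
    simp only [Matrix.sub_mulVec, Matrix.one_mulVec, Pi.sub_apply, Pi.zero_apply]
    exact sub_eq_zero.2 this
  obtain ⟨v, hv0, hv⟩ := Matrix.exists_vecMul_eq_zero_iff.2 hdet
  have hv' : ∀ s', ∑ s, v s * P s s' = v s' := by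
    intro s'
    have := congrFun hv s'
    simp only [Matrix.vecMul_sub, Matrix.vecMul_one, Pi.sub_apply, Pi.zero_apply] at this
    exact sub_eq_zero.1 this
  have hle : ∀ s', |v s'| ≤ ∑ s, |v s| * P s s' := by
    intro s'
    rw [← hv' s']
    refine (Finset.abs_sum_le_sum_abs _ _).trans (Finset.sum_le_sum fun s _ => ?_)
    rw [abs_mul, abs_of_nonneg ((mem_rowStochastic_iff_sum.1 hP).1 s s')]
  have hsum : ∑ s', |v s'| = ∑ s', ∑ s, |v s| * P s s' := by
    rw [Finset.sum_comm]
    simp only [← Finset.mul_sum, (mem_rowStochastic_iff_sum.1 hP).2, mul_one]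
  have heq : ∀ s', |v s'| = ∑ s, |v s| * P s s' := fun s' =>
    (Finset.sum_eq_sum_iff_of_le fun s _ => hle s).1 hsum s' (Finset.mem_univ _)
  have hpos : 0 < ∑ s, |v s| := by
    obtain ⟨s, hs⟩ := Function.ne_iff.1 hv0
    exact Finset.sum_pos' (fun _ _ => abs_nonneg _) ⟨s, Finset.mem_univ _, abs_pos.2 hs⟩
  refine ⟨fun s => |v s| / ∑ s, |v s|, fun s => by positivity, ?_, fun s' => ?_⟩
  · rw [← Finset.sum_div, div_self hpos.ne']
  · simp only [div_mul_eq_mul_div]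
    rw [← Finset.sum_div, ← heq]

theorem IsStationary.pow {P : Matrix S S ℝ} {ζ : S → ℝ} (h : IsStationary P ζ) (n : ℕ) :
    ∀ s', ∑ s, ζ s * (P ^ n) s s' = ζ s' := by
  induction n with
  | zero => intro s'; simp [Matrix.one_apply]
  | succ n ih =>
    intro s'
    simp only [pow_succ, Matrix.mul_apply, Finset.mul_sum]
    rw [Finset.sum_comm]
    simp only [← mul_assoc, ← Finset.sum_mul, ih]
    exact h.2.2 s'

theorem IsStationary.sum_mulVec {P : Matrix S S ℝ} {ζ : S → ℝ} (h : IsStationary P ζ) (n : ℕ)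
    (g : S → ℝ) : ∑ s, ζ s * ((P ^ n).mulVec g) s = ∑ s, ζ s * g s := by
  simp only [Matrix.mulVec, dotProduct, Finset.mul_sum]
  rw [Finset.sum_comm]
  simp only [← mul_assoc, ← Finset.sum_mul, h.pow n]

/-- Dobrushin's contraction: c bounds the total variation distance between any two rows. -/
theorem osc_mulVec_le {P : Matrix S S ℝ} (hP : P ∈ rowStochastic ℝ S) {g : S → ℝ} {c o : ℝ}
    (htv : ∀ s s', ∑ x, |P s x - P s' x| ≤ 2 * c) (hg : ∀ s s', |g s - g s'| ≤ o) (s s' : S) :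
    |P.mulVec g s - P.mulVec g s'| ≤ c * o :=
  have : Nonempty S := ⟨s⟩
  abs_sum_sub_sum_le_of_osc (by rw [(mem_rowStochastic_iff_sum.1 hP).2, (mem_rowStochastic_iff_sum.1 hP).2]) (htv s s') hg

theorem osc_mulVec_le_self {P : Matrix S S ℝ} (hP : P ∈ rowStochastic ℝ S) {g : S → ℝ} {o : ℝ}
    (hg : ∀ s s', |g s - g s'| ≤ o) (s s' : S) :
    |P.mulVec g s - P.mulVec g s'| ≤ o := by
  have := osc_mulVec_le hP (c := 1) (fun s s' => ?_) hg s s'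
  · simpa using this
  calc ∑ x, |P s x - P s' x| ≤ ∑ x, (P s x + P s' x) := Finset.sum_le_sum fun x _ => by
        have h1 := (mem_rowStochastic_iff_sum.1 hP).1 s x
        have h2 := (mem_rowStochastic_iff_sum.1 hP).1 s' x
        rw [abs_le]; constructor <;> linarith
    _ = 2 * 1 := by rw [Finset.sum_add_distrib, (mem_rowStochastic_iff_sum.1 hP).2, (mem_rowStochastic_iff_sum.1 hP).2]; norm_num

theorem osc_pow_mulVec_le {P : Matrix S S ℝ} (hP : P ∈ rowStochastic ℝ S) {g : S → ℝ} {c o : ℝ}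
    (htv : ∀ s s', ∑ x, |P s x - P s' x| ≤ 2 * c)
    (hg : ∀ s s', |g s - g s'| ≤ o) (k : ℕ) (s s' : S) :
    |(P ^ k).mulVec g s - (P ^ k).mulVec g s'| ≤ c ^ k * o := by
  induction k generalizing s s' with
  | zero => simpa using hg s s'
  | succ k ih =>
    rw [pow_succ', ← Matrix.mulVec_mulVec, pow_succ', mul_assoc]
    exact osc_mulVec_le hP htv ih s s'

/-- By invariance the stationary mean of g is a ζ-average of values of P^n g, so the oscillation of
P^n g controls its distance to that mean. -/
theorem IsStationary.abs_sub_le {P : Matrix S S ℝ} {ζ : S → ℝ} (h : IsStationary P ζ)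
    {g : S → ℝ} {o : ℝ} (n : ℕ)
    (hg : ∀ s s', |(P ^ n).mulVec g s - (P ^ n).mulVec g s'| ≤ o) (s : S) :
    |(P ^ n).mulVec g s - ∑ x, ζ x * g x| ≤ o := by
  have : (P ^ n).mulVec g s - ∑ x, ζ x * g x
      = ∑ x, ζ x * ((P ^ n).mulVec g s - (P ^ n).mulVec g x) := by
    simp only [mul_sub, Finset.sum_sub_distrib]
    rw [h.sum_mulVec, ← Finset.sum_mul, h.2.1, one_mul]
  rw [this]
  calc _ ≤ ∑ x, ζ x * o := (Finset.abs_sum_le_sum_abs _ _).trans (Finset.sum_le_sum fun x _ => by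
        rw [abs_mul, abs_of_nonneg (h.1 x)]
        exact mul_le_mul_of_nonneg_left (hg s x) (h.1 x))
    _ = o := by rw [← Finset.sum_mul, h.2.1, one_mul]

/-- A chain that can reach a fixed state from everywhere in the same number of steps mixes. -/
theorem exists_tvDist_le {P : Matrix S S ℝ} (hP : P ∈ rowStochastic ℝ S) {ζ : S → ℝ}
    (hζ : IsStationary P ζ) {n : ℕ} (hn : 1 ≤ n) {x₀ : S} (hx : ∀ s, 0 < (P ^ n) s x₀) {ε : ℝ}
    (hε : 0 < ε) : ∃ l, 1 ≤ l ∧ ∀ s, tvDist ((P ^ l) s) ζ ≤ ε := by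
  have : Nonempty S := ⟨x₀⟩
  obtain ⟨y, hy⟩ := Finite.exists_min fun s => (P ^ n) s x₀
  -- Doeblin's minorization: every row of P^n gives mass at least η to x₀, so two rows are at total
  -- variation distance at most 1 - η.
  set η := (P ^ n) y x₀
  have hη : 0 < η := hx y
  have hQ := pow_mem hP n
  have hη1 : η ≤ 1 := by
    rw [← (mem_rowStochastic_iff_sum.1 hQ).2 y]
    exact Finset.single_le_sum (fun x _ => (mem_rowStochastic_iff_sum.1 hQ).1 y x) (Finset.mem_univ x₀)
  have htv : ∀ s s', ∑ x, |(P ^ n) s x - (P ^ n) s' x| ≤ 2 * (1 - η) := by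
    intro s s'
    have hb : ∀ s x, (0 : ℝ) ≤ (P ^ n) s x - (if x = x₀ then η else 0) := by
      intro s x
      split_ifs with h
      · subst h; exact sub_nonneg.2 (hy s)
      · simpa using (mem_rowStochastic_iff_sum.1 hQ).1 s x
    calc ∑ x, |(P ^ n) s x - (P ^ n) s' x|
        ≤ ∑ x, (((P ^ n) s x - (if x = x₀ then η else 0)) +
            ((P ^ n) s' x - (if x = x₀ then η else 0))) := Finset.sum_le_sum fun x _ => by
          have h1 := hb s x
          have h2 := hb s' x
          rw [abs_le]; constructor <;> linarith
      _ = 2 * (1 - η) := by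
          simp only [Finset.sum_add_distrib, Finset.sum_sub_distrib, (mem_rowStochastic_iff_sum.1 hQ).2,
            Finset.sum_ite_eq', Finset.mem_univ, if_true]
          ring
  have hdec : Filter.Tendsto (fun k : ℕ => (1 / 2) * (Fintype.card S : ℝ) * ((1 - η) ^ k * 1))
      Filter.atTop (nhds ((1 / 2) * (Fintype.card S : ℝ) * (0 * 1))) :=
    ((tendsto_pow_atTop_nhds_zero_of_lt_one (by linarith) (by linarith)).mul_const 1).const_mul _
  have hev := (hdec.eventually (gt_mem_nhds (show _ < ε by simpa using hε))).and
    (Filter.eventually_ge_atTop 1)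
  obtain ⟨k, hk, hk1⟩ := hev.exists
  refine ⟨n * k, one_le_mul hn hk1 |>.trans le_rfl, fun s => ?_⟩
  unfold tvDist
  have hbound : ∀ x, |(P ^ (n * k)) s x - ζ x| ≤ (1 - η) ^ k * 1 := by
    intro x
    have hg : ∀ s s', |(Pi.single x 1 : S → ℝ) s - (Pi.single x 1 : S → ℝ) s'| ≤ 1 := by
      intro s s'
      simp only [Pi.single_apply]
      split_ifs <;> norm_num
    have := hζ.abs_sub_le (n * k) (g := Pi.single x 1) (o := (1 - η) ^ k * 1) (fun s s' => by
      rw [pow_mul]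
      exact osc_pow_mulVec_le hQ htv hg k s s') s
    simpa [Pi.single_apply] using this
  calc (1 / 2) * ∑ x, |(P ^ (n * k)) s x - ζ x|
      ≤ (1 / 2) * ∑ _x : S, ((1 - η) ^ k * 1) := by
        gcongr with x
        exact hbound x
    _ = (1 / 2) * (Fintype.card S : ℝ) * ((1 - η) ^ k * 1) := by simp; ring
    _ ≤ ε := hk.le

/-- Geometric decay of the bias after `m` mixing times. -/
theorem abs_pow_mulVec_sub_le {P : Matrix S S ℝ} (hP : P ∈ rowStochastic ℝ S) {ζ : S → ℝ}
    (hζ : IsStationary P ζ) {τ : ℕ} (hτ : ∀ s, tvDist ((P ^ τ) s) ζ ≤ 1 / 4) {g : S → ℝ}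
    {o : ℝ} (hg : ∀ s s', |g s - g s'| ≤ o) {m k : ℕ} (hk : τ * m ≤ k) (s : S) :
    |(P ^ k).mulVec g s - ∑ x, ζ x * g x| ≤ (1 / 2) ^ m * o := by
  refine hζ.abs_sub_le k (fun s s' => ?_) s
  obtain ⟨j, rfl⟩ := Nat.exists_eq_add_of_le' hk
  rw [pow_add, ← Matrix.mulVec_mulVec]
  refine osc_mulVec_le_self (pow_mem hP j) (fun s s' => ?_) s s'
  rw [pow_mul]
  -- Two rows within 1/4 of ζ are within 1/2 of each other, so every mixing time halves the
  -- oscillation.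
  refine osc_pow_mulVec_le (pow_mem hP τ) (c := 1 / 2) (fun s s' => ?_) hg m s s'
  have h1 := hτ s
  have h2 := hτ s'
  unfold tvDist at h1 h2
  calc ∑ x, |(P ^ τ) s x - (P ^ τ) s' x|
      ≤ ∑ x, (|(P ^ τ) s x - ζ x| + |(P ^ τ) s' x - ζ x|) := Finset.sum_le_sum fun x _ => by
        rw [abs_sub_comm ((P ^ τ) s' x)]; exact abs_sub_le _ _ _
    _ ≤ 2 * (1 / 2) := by rw [Finset.sum_add_distrib]; linarith

end FiniteChain

end DebiasedFedAvg

namespace DebiasedFedAvg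

open Matrix

/-! ### The batch kernel and the window chain -/

section Batches

variable {N B R : ℕ} {p : Fin N → ℝ}

theorem mem_clients {J : Batch N B} {i : Fin N} : i ∈ clients J ↔ ∃ e, J e = i := by
  simp [clients]

theorem card_clients (J : Batch N B) : (clients J).card = B := by simp [clients]

theorem disjoint_clients {J J' : Batch N B} :
    Disjoint (clients J) (clients J') ↔ ∀ e e', J e ≠ J' e' := by
  rw [Finset.disjoint_left]
  simp only [mem_clients]
  constructor
  · rintro h e e' he
    exact h ⟨e, rfl⟩ ⟨e', he.symm⟩
  · rintro h _ ⟨e, rfl⟩ ⟨e', he⟩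
    exact h e e' he.symm

theorem batchWeight_pos [NeZero B] (hp : ∀ i, 0 < p i) (J : Batch N B) : 0 < batchWeight p J :=
  Finset.sum_pos (fun _ _ => hp _) Finset.univ_nonempty

/-- Some batch avoids the window. -/
theorem exists_available (h : (R + 1) * B ≤ N) (w : Fin R → Batch N B) :
    ∃ J, Available w J := by
  classical
  set U : Finset (Fin N) := Finset.univ.biUnion fun k => clients (w k)
  have hU : U.card ≤ R * B := by
    refine Finset.card_biUnion_le.trans ?_
    simp [card_clients]
  have hUc : B ≤ Uᶜ.card := by
    rw [Finset.card_compl, Fintype.card_fin]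
    have : (R + 1) * B = R * B + B := by ring
    omega
  obtain ⟨s, hs, hsB⟩ := Finset.exists_subset_card_eq hUc
  refine ⟨(s.orderEmbOfFin hsB).toEmbedding, fun k => ?_⟩
  rw [Finset.disjoint_left]
  intro i hi hi'
  obtain ⟨e, he⟩ := mem_clients.1 hi'
  have h1 : i ∈ s := by
    rw [← he]
    exact Finset.orderEmbOfFin_mem s hsB e
  have h2 := Finset.mem_compl.1 (hs h1)
  exact h2 (Finset.mem_biUnion.2 ⟨k, Finset.mem_univ _, hi⟩)

open Classical in
theorem normalizer_pos [NeZero B] (hp : ∀ i, 0 < p i) {w : Fin R → Batch N B} {J : Batch N B}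
    (hJ : Available w J) :
    0 < ∑ J' : Batch N B, if Available w J' then batchWeight p J' else 0 := by
  refine Finset.sum_pos' (fun J' _ => ?_) ⟨J, Finset.mem_univ _, ?_⟩
  · split_ifs
    · exact (batchWeight_pos hp J').le
    · exact le_rfl
  · rw [if_pos hJ]
    exact batchWeight_pos hp J

theorem stepProb_pos [NeZero B] (hp : ∀ i, 0 < p i) {w : Fin R → Batch N B} {J : Batch N B}
    (hJ : Available w J) : 0 < stepProb p w J := by
  unfold stepProb
  rw [if_pos hJ]
  exact div_pos (batchWeight_pos hp J) (normalizer_pos hp hJ)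

theorem stepProb_eq_zero {w : Fin R → Batch N B} {J : Batch N B}
    (hJ : ¬ Available w J) : stepProb p w J = 0 := if_neg hJ

theorem stepProb_nonneg [NeZero B] (hp : ∀ i, 0 < p i) (w : Fin R → Batch N B) (J : Batch N B) :
    0 ≤ stepProb p w J := by
  by_cases hJ : Available w J
  · exact (stepProb_pos hp hJ).le
  · rw [stepProb_eq_zero hJ]

theorem sum_stepProb [NeZero B] (hp : ∀ i, 0 < p i) (h : (R + 1) * B ≤ N)
    (w : Fin R → Batch N B) : ∑ J, stepProb p w J = 1 := by
  classical
  obtain ⟨J, hJ⟩ := exists_available h w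
  have hpos := normalizer_pos hp hJ
  have : ∀ J', stepProb p w J' = (if Available w J' then batchWeight p J' else 0) /
      ∑ J' : Batch N B, if Available w J' then batchWeight p J' else 0 := by
    intro J'
    unfold stepProb
    split_ifs
    · congr!
    · simp
  rw [Finset.sum_congr rfl fun J' _ => this J', ← Finset.sum_div, div_self hpos.ne']

open Classical in
/-- All entries of the next batch have the same law. -/
theorem sum_stepProb_entry (w : Fin R → Batch N B) (e e' : Fin B) (i : Fin N) :
    (∑ J, if J e = i then stepProb p w J else 0) = ∑ J, if J e' = i then stepProb p w J else 0 := by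
  -- Exchanging the positions e and e' changes neither the set of clients nor the weight.
  let φ : Batch N B ≃ Batch N B :=
    { toFun := fun J => (Equiv.swap e e').toEmbedding.trans J
      invFun := fun J => (Equiv.swap e e').toEmbedding.trans J
      left_inv := fun J => by ext x; simp
      right_inv := fun J => by ext x; simp }
  have hcl : ∀ J, clients (φ J) = clients J := by
    intro J
    ext i
    simp only [mem_clients]
    constructor
    · rintro ⟨a, rfl⟩; exact ⟨Equiv.swap e e' a, rfl⟩
    · rintro ⟨a, rfl⟩; exact ⟨Equiv.swap e e' a, by simp [φ]⟩
  have hw : ∀ J, batchWeight p (φ J) = batchWeight p J := fun J =>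
    Equiv.sum_comp (Equiv.swap e e') fun a => p (J a)
  have hs : ∀ J, stepProb p w (φ J) = stepProb p w J := by
    intro J
    unfold stepProb Available
    rw [hcl, hw]
  refine Fintype.sum_equiv φ _ _ fun J => ?_
  rw [hs]
  simp [φ]

open Classical in
/-- Conditional probability that client `i` is in the next batch. -/
noncomputable def inclusionProb (p : Fin N → ℝ) (i : Fin N) (w : Fin R → Batch N B) : ℝ :=
  ∑ J : Batch N B, stepProb p w J * if i ∈ clients J then 1 else 0

-- The entries of a batch are distinct, so membership is the sum of the entry indicators, and all
-- entries are equally distributed. This is the source of β_i = Bπ^i.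
open Classical in
theorem inclusionProb_eq [NeZero B] (i : Fin N) (w : Fin R → Batch N B) :
    inclusionProb p i w = B * ∑ J, if J 0 = i then stepProb p w J else 0 := by
  have h1 : ∀ J : Batch N B, stepProb p w J * (if i ∈ clients J then 1 else 0) =
      ∑ e, if J e = i then stepProb p w J else 0 := by
    intro J
    by_cases h : i ∈ clients J
    · obtain ⟨e, rfl⟩ := mem_clients.1 h
      simp [h]
    · rw [if_neg h, mul_zero, Finset.sum_eq_zero]
      intro e _
      rw [if_neg]
      exact fun he => h (mem_clients.2 ⟨e, he⟩)
  unfold inclusionProb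
  rw [Finset.sum_congr rfl fun J _ => h1 J, Finset.sum_comm,
    Finset.sum_congr rfl fun e _ => sum_stepProb_entry w e 0 i]
  simp

theorem inclusionProb_nonneg [NeZero B] (hp : ∀ i, 0 < p i) (i : Fin N) (w : Fin R → Batch N B) :
    0 ≤ inclusionProb p i w :=
  Finset.sum_nonneg fun J _ => mul_nonneg (stepProb_nonneg hp w J) (by split_ifs <;> norm_num)

theorem inclusionProb_le_one [NeZero B] (hp : ∀ i, 0 < p i) (h : (R + 1) * B ≤ N) (i : Fin N)
    (w : Fin R → Batch N B) : inclusionProb p i w ≤ 1 := by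
  rw [← sum_stepProb hp h w]
  refine Finset.sum_le_sum fun J _ => mul_le_of_le_one_right (stepProb_nonneg hp w J) ?_
  split_ifs <;> norm_num

theorem shift_mem {w : Window N B R} {J : Batch N B} (hJ : Available w.1 J) :
    ∀ j k, j ≠ k → Disjoint (clients (shift J w.1 j)) (clients (shift J w.1 k)) := by
  have key : ∀ j k : Fin (R + 1), j ≠ k →
      Disjoint (clients ((Fin.cons J w.1 : Fin (R + 1) → Batch N B) j))
        (clients ((Fin.cons J w.1 : Fin (R + 1) → Batch N B) k)) := by
    intro j k hjk
    induction j using Fin.cases with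
    | zero =>
      induction k using Fin.cases with
      | zero => exact absurd rfl hjk
      | succ k => simpa using (hJ k).symm
    | succ j =>
      induction k using Fin.cases with
      | zero => simpa using hJ j
      | succ k => simpa using w.2 j k fun h => hjk (by rw [h])
  intro j k hjk
  exact key _ _ fun h => hjk (Fin.castSucc_injective _ h)

open Classical in
/-- The transition operator on functions of windows. -/
noncomputable def windowOp (p : Fin N → ℝ) (g : (Fin R → Batch N B) → ℝ) (w : Fin R → Batch N B) : ℝ :=
  ∑ J : Batch N B, stepProb p w J * g (shift J w)

/-- `windowOp` acts on arbitrary tuples of batches, which spares disjointness proofs along paths. It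
agrees with the matrix on true windows because unavailable batches have weight zero. -/
theorem transitionMatrix_mulVec (g : (Fin R → Batch N B) → ℝ) :
    (transitionMatrix N B R p) *ᵥ (fun w => g w.1) = fun w => windowOp p g w.1 := by
  classical
  funext w
  simp only [Matrix.mulVec, dotProduct, transitionMatrix, windowOp, Finset.sum_mul]
  rw [Finset.sum_comm]
  refine Finset.sum_congr rfl fun J _ => ?_
  by_cases hJ : Available w.1 J
  · rw [Finset.sum_eq_single ⟨shift J w.1, shift_mem hJ⟩]
    · simp
    · intro w' _ hw'
      rw [if_neg, zero_mul]
      exact fun h => hw' (Subtype.ext h)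
    · simp
  · simp [stepProb_eq_zero hJ]

theorem transitionMatrix_pow_mulVec (g : (Fin R → Batch N B) → ℝ) (n : ℕ) :
    (transitionMatrix N B R p ^ n) *ᵥ (fun w => g w.1) = fun w => (windowOp p)^[n] g w.1 := by
  induction n generalizing g with
  | zero => simp
  | succ n ih =>
    rw [pow_succ, ← Matrix.mulVec_mulVec, transitionMatrix_mulVec, ih, Function.iterate_succ_apply]

theorem transitionMatrix_mem_rowStochastic [NeZero B] (hp : ∀ i, 0 < p i) (h : (R + 1) * B ≤ N) :
    transitionMatrix N B R p ∈ rowStochastic ℝ (Window N B R) := by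
  classical
  refine mem_rowStochastic.2 ⟨fun w w' => Finset.sum_nonneg fun J _ => ?_, ?_⟩
  · split_ifs
    · exact stepProb_nonneg hp _ _
    · exact le_rfl
  · have := transitionMatrix_mulVec (p := p) (fun _ : Fin R → Batch N B => (1 : ℝ))
    refine this.trans ?_
    funext w
    simp [windowOp, sum_stepProb hp h]

theorem transitionMatrix_pos [NeZero B] (hp : ∀ i, 0 < p i) {w w' : Window N B R} {J : Batch N B}
    (hJ : Available w.1 J) (hw' : w'.1 = shift J w.1) : 0 < transitionMatrix N B R p w w' := by
  classical
  refine Finset.sum_pos' (fun J _ => ?_) ⟨J, Finset.mem_univ _, ?_⟩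
  · split_ifs
    · exact stepProb_nonneg hp _ _
    · exact le_rfl
  · rw [if_pos hw']
    exact stepProb_pos hp hJ

/-- The last `R` batches before round `t`, the most recent one first. -/
def lastWindow (R : ℕ) (S : ℕ → Batch N B) (t : ℕ) : Fin R → Batch N B := fun k => S (t - 1 - k)

/-- Batches at distance at most `R` are disjoint up to round `H`. -/
def Separated (R H : ℕ) (S : ℕ → Batch N B) : Prop :=
  ∀ s t, s < t → t ≤ s + R → t ≤ H → Disjoint (clients (S s)) (clients (S t))

theorem Separated.lastWindow_mem {H : ℕ} {S : ℕ → Batch N B} (hS : Separated R H S) {t : ℕ}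
    (ht : R ≤ t) (htH : t ≤ H + 1) :
    ∀ j k, j ≠ k → Disjoint (clients (lastWindow R S t j)) (clients (lastWindow R S t k)) := by
  intro j k hjk
  have hne : (j : ℕ) ≠ k := fun h => hjk (Fin.ext h)
  have hj := j.2
  have hk := k.2
  rcases lt_or_gt_of_ne hne with h | h
  · exact (hS _ _ (by omega) (by omega) (by omega)).symm
  · exact hS _ _ (by omega) (by omega) (by omega)

theorem Separated.available {H : ℕ} {S : ℕ → Batch N B} (hS : Separated R H S) {t : ℕ}
    (ht : R ≤ t) (htH : t ≤ H) : Available (lastWindow R S t) (S t) := fun k => by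
  have hk := k.2
  exact hS _ _ (by omega) (by omega) htH

theorem lastWindow_succ (S : ℕ → Batch N B) {t : ℕ} :
    lastWindow R S (t + 1) = shift (S t) (lastWindow R S t) := by
  funext k
  unfold lastWindow shift
  obtain ⟨k, hk⟩ := k
  cases k with
  | zero => simp
  | succ k =>
    have : (Fin.castSucc ⟨k + 1, hk⟩ : Fin (R + 1)) = Fin.succ ⟨k, by omega⟩ := rfl
    rw [this, Fin.cons_succ]
    congr 1
    simp only
    omega

/-- Reduces reachability to exhibiting one separated sequence of batches: each of its steps has
positive probability. -/
theorem pow_pos_of_separated [NeZero B] (hp : ∀ i, 0 < p i) (h : (R + 1) * B ≤ N) {H : ℕ}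
    {S : ℕ → Batch N B} (hS : Separated R H S) {u : ℕ} (hu : R ≤ u) (n : ℕ) (hn : u + n ≤ H + 1) :
    0 < (transitionMatrix N B R p ^ n)
      ⟨lastWindow R S u, hS.lastWindow_mem hu (by omega)⟩
      ⟨lastWindow R S (u + n), hS.lastWindow_mem (by omega) hn⟩ := by
  induction n with
  | zero => simp
  | succ n ih =>
    have hP := transitionMatrix_mem_rowStochastic (R := R) hp h
    rw [pow_succ, Matrix.mul_apply]
    refine Finset.sum_pos' (fun w _ => mul_nonneg ((pow_mem hP n).1 _ _) (hP.1 _ _))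
      ⟨⟨lastWindow R S (u + n), hS.lastWindow_mem (by omega) (by omega)⟩, Finset.mem_univ _,
        mul_pos (ih (by omega)) ?_⟩
    exact transitionMatrix_pos hp (hS.available (by omega) (by omega)) (lastWindow_succ S)

end Batches

end DebiasedFedAvg

namespace DebiasedFedAvg

open Matrix

/-! ### Primitivity of the window chain and positivity of its stationary law -/

section Reachability

theorem exists_embedding_update {A V : Type*} [DecidableEq A] (σ : A ↪ V) (a : A) {u : V}
    (hu : ∀ b, σ b ≠ u) : ∃ ρ : A ↪ V, ρ a = u ∧ ∀ b, b ≠ a → ρ b = σ b := by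
  refine ⟨⟨Function.update σ a u, ?_⟩, Function.update_self .., fun b hb =>
    Function.update_of_ne hb ..⟩
  intro x y hxy
  by_cases hx : x = a <;> by_cases hy : y = a
  · rw [hx, hy]
  · subst hx; simp only [Function.update_self, Function.update_of_ne hy] at hxy
    exact absurd hxy.symm (hu y)
  · subst hy; simp only [Function.update_self, Function.update_of_ne hx] at hxy
    exact absurd hxy (hu x)
  · simp only [Function.update_of_ne hx, Function.update_of_ne hy] at hxy
    exact σ.injective hxy

/-- If there is a spare value, two changes of one value each suffice to bring an injection closer
to another one. -/
theorem exists_updates_mismatch_lt {A V : Type*} [Fintype A] [DecidableEq A] [Fintype V]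
    [DecidableEq V] (hAV : Fintype.card A < Fintype.card V) (σ σ' : A ↪ V) (hne : σ ≠ σ') :
    ∃ ρ₁ ρ : A ↪ V, (∃ a, ∀ b, b ≠ a → ρ₁ b = σ b) ∧ (∃ a, ∀ b, b ≠ a → ρ b = ρ₁ b) ∧
      (Finset.univ.filter fun b => ρ b ≠ σ' b).card < (Finset.univ.filter fun b => σ b ≠ σ' b).card := by
  obtain ⟨a, ha⟩ : ∃ a, σ a ≠ σ' a := by
    by_contra! h
    exact hne (DFunLike.ext _ _ h)
  by_cases hfree : ∀ b, σ b ≠ σ' a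
  · obtain ⟨ρ, hρa, hρ⟩ := exists_embedding_update σ a hfree
    refine ⟨σ, ρ, ⟨a, fun _ _ => rfl⟩, ⟨a, hρ⟩, Finset.card_lt_card ?_⟩
    refine (Finset.ssubset_iff_of_subset fun b hb => ?_).2 ⟨a, by simp [ha], by simp [hρa]⟩
    simp only [Finset.mem_filter, Finset.mem_univ, true_and] at hb ⊢
    by_cases hba : b = a
    · rw [hba]; exact ha
    · rwa [hρ b hba] at hb
  · push Not at hfree
    obtain ⟨a', ha'⟩ := hfree
    have haa' : a' ≠ a := fun h => ha (by rw [← ha', h])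
    obtain ⟨u, hu⟩ : ∃ u, ∀ b, σ b ≠ u := by
      by_contra! h
      exact absurd (Fintype.card_le_of_surjective σ h) (by omega)
    -- The occupant a' of the wanted value first moves to the spare value u. It was already a
    -- mismatch, since σ' is injective, so no agreement is lost.
    obtain ⟨ρ₁, hρ₁a, hρ₁⟩ := exists_embedding_update σ a' hu
    have hfree' : ∀ b, ρ₁ b ≠ σ' a := by
      intro b
      by_cases hb : b = a'
      · rw [hb, hρ₁a, ← ha']; exact (hu a').symm
      · rw [hρ₁ b hb, ← ha']
        exact fun h => hb (σ.injective h)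
    obtain ⟨ρ, hρa, hρ⟩ := exists_embedding_update ρ₁ a hfree'
    refine ⟨ρ₁, ρ, ⟨a', hρ₁⟩, ⟨a, hρ⟩, Finset.card_lt_card ?_⟩
    refine (Finset.ssubset_iff_of_subset fun b hb => ?_).2 ⟨a, by simp [ha], by simp [hρa]⟩
    simp only [Finset.mem_filter, Finset.mem_univ, true_and] at hb ⊢
    by_cases hba : b = a
    · rw [hba]; exact ha
    · rw [hρ b hba] at hb
      by_cases hba' : b = a'
      · rw [hba', ha']
        exact fun h => haa' (σ'.injective h).symm
      · rwa [hρ₁ b hba'] at hb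

variable {N B R : ℕ} {p : Fin N → ℝ}

/-- The batch at position `s` (cyclically) of a configuration of `R + 1` disjoint batches. -/
def configBatch (σ : Fin (R + 1) × Fin B ↪ Fin N) (s : ℕ) : Batch N B :=
  ⟨fun e => σ (Fin.ofNat (R + 1) s, e), fun e e' h => by simpa using σ.injective h⟩

/-- This is the condition under which the periodic batch sequence of σ may switch to that of ρ
without violating the separation. -/
theorem ne_of_update {A V : Type*} {σ ρ : A ↪ V} (h : ∃ a, ∀ b, b ≠ a → ρ b = σ b) {x y : A}
    (hxy : x ≠ y) : σ x ≠ ρ y := by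
  obtain ⟨a, ha⟩ := h
  intro he
  by_cases hy : y = a
  · rw [← ha x (fun h => hxy (h.trans hy.symm))] at he
    exact hxy (ρ.injective he)
  · rw [ha _ hy] at he
    exact hxy (σ.injective he)

theorem disjoint_configBatch {σ σ' : Fin (R + 1) × Fin B ↪ Fin N}
    (h : ∀ x y, x ≠ y → σ x ≠ σ' y) {s t : ℕ} (hst : s % (R + 1) ≠ t % (R + 1)) :
    Disjoint (clients (configBatch σ s)) (clients (configBatch σ' t)) := by
  rw [disjoint_clients]
  intro e e'
  refine h _ _ fun h => hst ?_
  have := congrArg (fun x : Fin (R + 1) × Fin B => (x.1 : ℕ)) h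
  simpa [Fin.ofNat] using this

theorem mod_ne_mod {R s t : ℕ} (hst : s < t) (htR : t ≤ s + R) : s % (R + 1) ≠ t % (R + 1) := by
  intro h
  have h1 : (R + 1) ∣ t - s := (Nat.modEq_iff_dvd' hst.le).1 h
  have := Nat.le_of_dvd (by omega) h1
  omega

theorem separated_configBatch (σ : Fin (R + 1) × Fin B ↪ Fin N) (H : ℕ) :
    Separated R H (configBatch σ) := fun _ _ hst htR _ =>
  disjoint_configBatch (fun _ _ hxy => σ.injective.ne hxy) (mod_ne_mod hst htR)

/-- The window of the last `R` batches of a configuration. -/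
def configWindow (σ : Fin (R + 1) × Fin B ↪ Fin N) : Window N B R :=
  ⟨lastWindow R (configBatch σ) (R + 1),
    (separated_configBatch σ (R + 1)).lastWindow_mem (by omega) (by omega)⟩

/-- The witness runs once through the positions of σ and then through those of σ'. Batches at
distance at most R sit at different positions modulo R + 1, so `h` separates them across the switch.
-/
theorem pow_configWindow_pos [NeZero B] (hp : ∀ i, 0 < p i) (hN : (R + 1) * B ≤ N)
    {σ σ' : Fin (R + 1) × Fin B ↪ Fin N} (h : ∀ x y, x ≠ y → σ x ≠ σ' y) :
    0 < (transitionMatrix N B R p ^ (R + 1)) (configWindow σ) (configWindow σ') := by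
  set S : ℕ → Batch N B := fun s => if s ≤ R then configBatch σ s else configBatch σ' (s - (R + 1))
    with hS
  have hsep : Separated R (2 * R + 1) S := by
    intro s t hst htR htH
    have hmod := mod_ne_mod hst htR
    simp only [hS]
    split_ifs with h1 h2 h2
    · exact separated_configBatch σ t s t hst htR le_rfl
    · refine disjoint_configBatch h ?_
      rwa [← Nat.mod_eq_sub_mod (by omega)]
    · omega
    · exact separated_configBatch σ' t _ _ (by omega) (by omega) (by omega)
  have h1 := pow_pos_of_separated (p := p) hp hN hsep (u := R + 1) (by omega) (R + 1) (by omega)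
  have e1 : (configWindow σ).1 = lastWindow R S (R + 1) := by
    funext k
    have := k.2
    simp only [configWindow, lastWindow, hS]
    rw [if_pos (by omega)]
  have e2 : (configWindow σ').1 = lastWindow R S (R + 1 + (R + 1)) := by
    funext k
    have := k.2
    simp only [configWindow, lastWindow, hS]
    rw [if_neg (by omega)]
    congr 1
    omega
  convert h1 using 2
  · exact Subtype.ext e1
  · exact Subtype.ext e2

theorem pow_mul_pos {S : Type*} [Fintype S] [DecidableEq S] {P : Matrix S S ℝ}
    (hP : P ∈ rowStochastic ℝ S) {m n : ℕ} {x y z : S} (h1 : 0 < (P ^ m) x y)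
    (h2 : 0 < (P ^ n) y z) : 0 < (P ^ (m + n)) x z := by
  rw [pow_add, Matrix.mul_apply]
  exact Finset.sum_pos' (fun w _ => mul_nonneg ((pow_mem hP m).1 _ _) ((pow_mem hP n).1 _ _))
    ⟨y, Finset.mem_univ _, mul_pos h1 h2⟩

/-- Induction on the mismatches: one repair costs two changes of one client, hence two periods of R
+ 1 rounds. -/
theorem pow_configWindow_pos_of_mismatch_le [NeZero B] (hp : ∀ i, 0 < p i)
    (hN : (R + 1) * B < N) (k : ℕ) (σ σ' : Fin (R + 1) × Fin B ↪ Fin N)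
    (hk : (Finset.univ.filter fun b => σ b ≠ σ' b).card ≤ k) :
    0 < (transitionMatrix N B R p ^ ((R + 1 + (R + 1)) * k)) (configWindow σ)
      (configWindow σ') := by
  have hP := transitionMatrix_mem_rowStochastic (R := R) hp hN.le
  induction k generalizing σ with
  | zero =>
    have : σ = σ' := by
      refine DFunLike.ext _ _ fun a => ?_
      by_contra ha
      have := Finset.card_pos.2 ⟨a, (Finset.mem_filter (p := fun b => σ b ≠ σ' b)).2
        ⟨Finset.mem_univ _, ha⟩⟩
      omega
    simp [this]
  | succ k ih =>
    obtain ⟨ρ₁, ρ, h1, h2, h3⟩ : ∃ ρ₁ ρ : Fin (R + 1) × Fin B ↪ Fin N,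
        (∀ x y, x ≠ y → σ x ≠ ρ₁ y) ∧ (∀ x y, x ≠ y → ρ₁ x ≠ ρ y) ∧
        (Finset.univ.filter fun b => ρ b ≠ σ' b).card ≤ k := by
      by_cases hσ : σ = σ'
      -- At the target, two more periods are spent without change, so that the number of rounds
      -- depends on k alone.
      · refine ⟨σ, σ, fun x y hxy => σ.injective.ne hxy, fun x y hxy => σ.injective.ne hxy, ?_⟩
        simp [hσ]
      · obtain ⟨ρ₁, ρ, h1, h2, h3⟩ := exists_updates_mismatch_lt
          (by simpa using hN) σ σ' hσ
        exact ⟨ρ₁, ρ, fun x y => ne_of_update h1, fun x y => ne_of_update h2, by omega⟩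
    rw [mul_add, mul_one, add_comm]
    exact pow_mul_pos hP (pow_mul_pos hP (pow_configWindow_pos hp hN.le h1)
      (pow_configWindow_pos hp hN.le h2)) (ih ρ h3)

/-- A configuration has one batch more than a window: an available batch fills position 0. The
reversal is due to windows listing the most recent batch first. -/
theorem exists_configWindow_eq [NeZero B] (hN : (R + 1) * B ≤ N) (w : Window N B R) :
    ∃ σ : Fin (R + 1) × Fin B ↪ Fin N, configWindow σ = w := by
  obtain ⟨J, hJ⟩ := exists_available hN w.1
  set v : Fin (R + 1) → Batch N B := Fin.cons J fun k => w.1 k.rev with hv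
  have hdis : ∀ a b, a ≠ b → Disjoint (clients (v a)) (clients (v b)) := by
    intro a b hab
    induction a using Fin.cases with
    | zero =>
      induction b using Fin.cases with
      | zero => exact absurd rfl hab
      | succ b => simpa [hv] using (hJ b.rev).symm
    | succ a =>
      induction b using Fin.cases with
      | zero => simpa [hv] using hJ a.rev
      | succ b =>
        simp only [hv, Fin.cons_succ]
        exact w.2 _ _ fun h => hab (by rw [Fin.rev_injective h])
  refine ⟨⟨fun x => v x.1 x.2, ?_⟩, ?_⟩
  · rintro ⟨a, e⟩ ⟨b, e'⟩ h
    by_cases hab : a = b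
    · subst hab
      simp only [(v a).injective.eq_iff] at h
      rw [h]
    · exact absurd h ((disjoint_clients.1 (hdis a b hab)) e e')
  · refine Subtype.ext (funext fun k => ?_)
    have hk := k.2
    refine DFunLike.ext _ _ fun e => ?_
    have : (Fin.ofNat (R + 1) (R + 1 - 1 - (k : ℕ)) : Fin (R + 1)) = k.rev.succ := by
      ext
      simp only [Fin.val_ofNat, Fin.val_succ, Fin.val_rev]
      rw [Nat.mod_eq_of_lt (by omega)]
      omega
    change v (Fin.ofNat (R + 1) (R + 1 - 1 - (k : ℕ))) e = w.1 k e
    rw [this, hv, Fin.cons_succ, Fin.rev_rev]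

/-- Any two windows are joined by trajectories of a common length. -/
theorem exists_pow_pos [NeZero B] (hp : ∀ i, 0 < p i) (hN : (R + 1) * B < N) :
    ∃ n, 1 ≤ n ∧ ∀ w w', 0 < (transitionMatrix N B R p ^ n) w w' := by
  -- There are (R + 1)B positions, so this many repairs suffice for every pair. A common exponent
  -- gives irreducibility and aperiodicity at once.
  refine ⟨(R + 1 + (R + 1)) * ((R + 1) * B), ?_, fun w w' => ?_⟩
  · have := NeZero.pos B
    exact Nat.mul_pos (by omega) (Nat.mul_pos (by omega) this)
  · obtain ⟨σ, rfl⟩ := exists_configWindow_eq hN.le w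
    obtain ⟨σ', rfl⟩ := exists_configWindow_eq hN.le w'
    refine pow_configWindow_pos_of_mismatch_le hp hN _ σ σ' ?_
    refine (Finset.card_le_univ _).trans ?_
    simp

theorem nonempty_window (hN : (R + 1) * B ≤ N) : Nonempty (Window N B R) := by
  obtain ⟨σ⟩ := Function.Embedding.nonempty_of_card_le (α := Fin (R + 1) × Fin B) (β := Fin N)
    (by simpa using hN)
  exact ⟨configWindow σ⟩

theorem isStationary_stationary [NeZero B] (hp : ∀ i, 0 < p i) (hN : (R + 1) * B ≤ N) :
    IsStationary (transitionMatrix N B R p) (stationary (transitionMatrix N B R p)) := by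
  have := nonempty_window (R := R) hN
  have h := exists_isStationary (transitionMatrix_mem_rowStochastic (R := R) hp hN)
  rw [stationary, dif_pos h]
  exact h.choose_spec

/-- The set defining the infimum is nonempty by Doeblin's argument, so the infimum is attained and
is not the default value 0. -/
theorem tauMix_spec [NeZero B] (hp : ∀ i, 0 < p i) (hN : (R + 1) * B < N) :
    1 ≤ tauMix N B R p ∧ ∀ s, tvDist ((transitionMatrix N B R p ^ tauMix N B R p) s)
      (stationary (transitionMatrix N B R p)) ≤ 1 / 4 := by
  obtain ⟨n, hn, h⟩ := exists_pow_pos (R := R) hp hN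
  obtain ⟨w₀⟩ := nonempty_window (R := R) hN.le
  exact Nat.sInf_mem (s := {l : ℕ | 1 ≤ l ∧ ∀ s, tvDist ((transitionMatrix N B R p ^ l) s)
    (stationary (transitionMatrix N B R p)) ≤ 1 / 4})
    (exists_tvDist_le (transitionMatrix_mem_rowStochastic hp hN.le)
    (isStationary_stationary hp hN.le) hn (fun s => h s w₀) (by norm_num))

theorem stationary_pos [NeZero B] (hp : ∀ i, 0 < p i) (hN : (R + 1) * B < N) (w : Window N B R) :
    0 < stationary (transitionMatrix N B R p) w := by
  obtain ⟨n, hn, h⟩ := exists_pow_pos (R := R) hp hN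
  have hζ := isStationary_stationary (R := R) hp hN.le
  have h1 : 0 < ∑ s, stationary (transitionMatrix N B R p) s := by rw [hζ.2.1]; exact one_pos
  obtain ⟨w', -, hw'⟩ := Finset.exists_lt_of_sum_lt (s := Finset.univ) (f := fun _ => (0 : ℝ))
    (by simpa using h1)
  rw [← hζ.pow n w]
  exact Finset.sum_pos' (fun s _ => mul_nonneg (hζ.1 s) (h s w).le)
    ⟨w', Finset.mem_univ _, mul_pos hw' (h w' w)⟩

/-- Every client participates with positive stationary probability. -/
theorem clientStationary_pos [NeZero B] (hp : ∀ i, 0 < p i) (hN : (R + 1) * B < N) (i : Fin N) :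
    0 < clientStationary N B R p i := by
  classical
  obtain ⟨σ₀⟩ := Function.Embedding.nonempty_of_card_le (α := Fin (R + 1) × Fin B) (β := Fin N)
    (by simpa using hN.le)
  -- After relabelling, client i is the first entry at position 0, and the batch at that position
  -- may follow the window of the positions 1, ..., R.
  set σ := σ₀.trans (Equiv.swap (σ₀ (0, 0)) i).toEmbedding with hσ
  have hσi : σ (0, 0) = i := by simp [hσ]
  have hav : Available (configWindow σ).1 (configBatch σ 0) := by
    have := (separated_configBatch σ (R + 1)).available (t := R + 1) (by omega) le_rfl
    have hcyc : configBatch σ (R + 1) = configBatch σ 0 := by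
      refine DFunLike.ext _ _ fun e => ?_
      change σ _ = σ _
      congr 2
      ext
      simp
    rwa [hcyc] at this
  unfold clientStationary
  refine Finset.sum_pos' (fun w _ => mul_nonneg (stationary_pos hp hN w).le
    (Finset.sum_nonneg fun J _ => ?_)) ⟨configWindow σ, Finset.mem_univ _,
      mul_pos (stationary_pos hp hN _) (Finset.sum_pos' (fun J _ => ?_)
        ⟨configBatch σ 0, Finset.mem_univ _, ?_⟩)⟩
  · split_ifs
    · exact stepProb_nonneg hp _ _
    · exact le_rfl
  · split_ifs
    · exact stepProb_nonneg hp _ _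
    · exact le_rfl
  · rw [if_pos]
    · exact stepProb_pos hp hav
    · exact hσi

theorem sum_stationary_mul_inclusionProb [NeZero B] (i : Fin N) :
    ∑ w : Window N B R, stationary (transitionMatrix N B R p) w * inclusionProb p i w.1 =
      B * clientStationary N B R p i := by
  simp only [inclusionProb_eq, clientStationary, Finset.mul_sum]
  refine Finset.sum_congr rfl fun w _ => Finset.sum_congr rfl fun J _ => ?_
  ring

theorem mul_clientStationary_le_one [NeZero B] (hp : ∀ i, 0 < p i) (hN : (R + 1) * B ≤ N)
    (i : Fin N) : B * clientStationary N B R p i ≤ 1 := by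
  have hζ := isStationary_stationary (R := R) hp hN
  rw [← sum_stationary_mul_inclusionProb, ← hζ.2.1]
  exact Finset.sum_le_sum fun w _ =>
    mul_le_of_le_one_right (hζ.1 w) (inclusionProb_le_one hp hN i w.1)

/-- After `m` mixing times, client `i` participates with almost its stationary probability. -/
theorem abs_iterate_inclusionProb_sub_le [NeZero B] (hp : ∀ i, 0 < p i) (hN : (R + 1) * B < N)
    (i : Fin N) {m k : ℕ} (hk : tauMix N B R p * m ≤ k) (w : Window N B R) :
    |(windowOp p)^[k] (inclusionProb p i) w.1 - B * clientStationary N B R p i| ≤ (1 / 2) ^ m := by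
  have h := abs_pow_mulVec_sub_le (transitionMatrix_mem_rowStochastic (R := R) hp hN.le)
    (isStationary_stationary hp hN.le) (tauMix_spec hp hN).2
    (g := fun w => inclusionProb p i w.1) (o := 1) (fun s s' => ?_) hk w
  · rwa [transitionMatrix_pow_mulVec, sum_stationary_mul_inclusionProb, mul_one] at h
  · have h1 := inclusionProb_nonneg hp i s.1
    have h2 := inclusionProb_nonneg hp i s'.1
    have h3 := inclusionProb_le_one hp hN.le i s.1
    have h4 := inclusionProb_le_one hp hN.le i s'.1
    rw [abs_le]; constructor <;> linarith

end Reachability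

end DebiasedFedAvg

namespace DebiasedFedAvg

/-! ### Path expectations as positive linear functionals, and their mixing property -/

section Expectation

variable {N B R : ℕ} {p : Fin N → ℝ}

instance instDiscreteMeasurableSpaceBatch : DiscreteMeasurableSpace (Batch N B) := ⟨fun _ => trivial⟩

/-- Expectation functionals of the participation process up to round `H`. -/
structure IsParticipationExpectation (R H : ℕ) (p : Fin N → ℝ)
    (E : ((ℕ → Batch N B) → ℝ) →ₗ[ℝ] ℝ) : Prop where
  mono : ∀ Φ Ψ : (ℕ → Batch N B) → ℝ, (∀ S, Separated R H S → Φ S ≤ Ψ S) → E Φ ≤ E Ψ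
  one : E (fun _ => 1) = 1
  step : ∀ t, R ≤ t → t ≤ H → ∀ Φ : (ℕ → Batch N B) → Batch N B → ℝ,
    (∀ J, DependsOn (fun S => Φ S J) (Set.Iio t)) →
    E (fun S => Φ S (S t)) = E (fun S => ∑ J, stepProb p (lastWindow R S t) J * Φ S J)

theorem dependsOn_lastWindow {t : ℕ} (ht : R ≤ t) :
    DependsOn (fun S : ℕ → Batch N B => lastWindow R S t) (Set.Iio t) := by
  intro S S' h
  funext k
  have := k.2
  exact h _ (Set.mem_Iio.2 (by omega))

/-- Propagation of a function of the window through the transition operator. -/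
theorem IsParticipationExpectation.iterate {H : ℕ} {E : ((ℕ → Batch N B) → ℝ) →ₗ[ℝ] ℝ}
    (hE : IsParticipationExpectation R H p E) {Φ : (ℕ → Batch N B) → ℝ} {u : ℕ}
    (hΦ : DependsOn Φ (Set.Iio u)) (hu : R ≤ u) (k : ℕ) (hk : u + k ≤ H + 1)
    (g : (Fin R → Batch N B) → ℝ) :
    E (fun S => Φ S * g (lastWindow R S (u + k))) =
      E (fun S => Φ S * (windowOp p)^[k] g (lastWindow R S u)) := by
  induction k generalizing g with
  | zero => rfl
  | succ k ih =>
    have h1 := hE.step (u + k) (by omega) (by omega)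
      (fun S J => Φ S * g (shift J (lastWindow R S (u + k)))) (fun J S S' h => by
        have e1 : Φ S = Φ S' := hΦ fun s hs => h s (by simp only [Set.mem_Iio] at hs ⊢; omega)
        have e2 := dependsOn_lastWindow (R := R) (t := u + k) (by omega) h
        simp only at e2 ⊢
        rw [e1, e2])
    simp only [← lastWindow_succ] at h1
    rw [← add_assoc, h1, Function.iterate_succ_apply, ← ih (by omega)]
    congr 1
    funext S
    simp only [windowOp, Finset.mul_sum]
    exact Finset.sum_congr rfl fun J _ => by ring

open Classical in
/-- Indicator that client `i` participates in the batch. -/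
noncomputable def part (i : Fin N) (J : Batch N B) : ℝ := if i ∈ clients J then 1 else 0

/-- A normalized positive linear functional for which, after a lag `g`, every client participates
almost independently of the past. -/
structure IsMixingExpectation (u₀ g H : ℕ) (β : Fin N → ℝ) (δ : ℝ)
    (E : ((ℕ → Batch N B) → ℝ) →ₗ[ℝ] ℝ) : Prop where
  mono : ∀ Φ Ψ : (ℕ → Batch N B) → ℝ, (∀ S, Φ S ≤ Ψ S) → E Φ ≤ E Ψ
  one : E (fun _ => 1) = 1
  mix : ∀ (i : Fin N) (u s : ℕ) (Φ : (ℕ → Batch N B) → ℝ), u₀ ≤ u → u + g ≤ s → s ≤ H →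
    DependsOn Φ (Set.Iio u) →
    |E (fun S => Φ S * (part i (S s) - β i))| ≤ δ * E (fun S => |Φ S|)

/-- The `step` rule replaces the indicator by `inclusionProb`, and k further applications move it
back to the window at round u. There it is uniformly within 2^{-m} of β_i on separated paths, the
only ones that `mono` sees. -/
theorem IsParticipationExpectation.isMixingExpectation [NeZero B] {H : ℕ}
    {E : ((ℕ → Batch N B) → ℝ) →ₗ[ℝ] ℝ} (hE : IsParticipationExpectation R H p E)
    (hp : ∀ i, 0 < p i) (hN : (R + 1) * B < N) (m : ℕ) :
    IsMixingExpectation R (tauMix N B R p * m) H (fun i => B * clientStationary N B R p i)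
      ((1 / 2) ^ m) E where
  mono Φ Ψ h := hE.mono Φ Ψ fun S _ => h S
  one := hE.one
  mix i u s Φ hu hs hsH hΦ := by
    obtain ⟨k, rfl⟩ : ∃ k, s = u + k := ⟨s - u, by omega⟩
    set b : ℝ := B * clientStationary N B R p i
    have h1 : E (fun S => Φ S * part i (S (u + k))) =
        E (fun S => Φ S * (windowOp p)^[k] (inclusionProb p i) (lastWindow R S u)) := by
      have := hE.step (u + k) (by omega) hsH (fun S J => Φ S * part i J) (fun J S S' h => by
        have e1 : Φ S = Φ S' := hΦ fun s hs => h s (by simp only [Set.mem_Iio] at hs ⊢; omega)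
        simp only [e1])
      rw [this, ← hE.iterate hΦ hu k (by omega)]
      congr 1
      funext S
      simp only [inclusionProb, part, Finset.mul_sum]
      exact Finset.sum_congr rfl fun J _ => by ring
    have h2 : E (fun S => Φ S * (part i (S (u + k)) - b)) =
        E (fun S => Φ S *
          ((windowOp p)^[k] (inclusionProb p i) (lastWindow R S u) - b)) := by
      have e1 : (fun S : ℕ → Batch N B => Φ S * (part i (S (u + k)) - b)) =
          (fun S => Φ S * part i (S (u + k))) - b • Φ := by
        funext S; simp only [Pi.sub_apply, Pi.smul_apply, smul_eq_mul]; ring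
      have e2 : (fun S : ℕ → Batch N B => Φ S *
          ((windowOp p)^[k] (inclusionProb p i) (lastWindow R S u) - b)) =
          (fun S => Φ S * (windowOp p)^[k] (inclusionProb p i) (lastWindow R S u)) - b • Φ := by
        funext S; simp only [Pi.sub_apply, Pi.smul_apply, smul_eq_mul]; ring
      rw [e1, e2, map_sub, map_sub, h1]
    have h3 : (1 / 2 : ℝ) ^ m * E (fun S => |Φ S|) = E (fun S => (1 / 2 : ℝ) ^ m * |Φ S|) := by
      have : (fun S : ℕ → Batch N B => (1 / 2 : ℝ) ^ m * |Φ S|) =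
          ((1 / 2 : ℝ) ^ m) • fun S => |Φ S| := by funext S; rfl
      rw [this, map_smul, smul_eq_mul]
    have key : ∀ S, Separated R H S → |Φ S *
        ((windowOp p)^[k] (inclusionProb p i) (lastWindow R S u) - b)| ≤
          (1 / 2 : ℝ) ^ m * |Φ S| := by
      intro S hS
      rw [abs_mul, mul_comm]
      exact mul_le_mul_of_nonneg_right (abs_iterate_inclusionProb_sub_le hp hN i (by omega)
        ⟨lastWindow R S u, hS.lastWindow_mem hu (by omega)⟩) (abs_nonneg _)
    rw [h2, h3, abs_le]
    constructor
    · rw [neg_le, ← map_neg]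
      exact hE.mono _ _ fun S hS => (neg_le_abs _).trans (key S hS)
    · exact hE.mono _ _ fun S hS => (le_abs_self _).trans (key S hS)

variable {Ω : Type*} [MeasurableSpace Ω] {μ : Measure Ω}

/-- The trajectory frozen after round `H`. -/
def frozenPath (X : ℕ → Ω → Batch N B) (H : ℕ) (ω : Ω) : ℕ → Batch N B := fun s => X (min s H) ω

/-- A frozen path is determined by finitely many batches, so every function of it is integrable.
Hence `pathExpectation` is linear on all functions, with no measurability conditions. -/
theorem integrable_frozenPath [IsFiniteMeasure μ] {X : ℕ → Ω → Batch N B}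
    (hX : ∀ t, Measurable (X t)) (H : ℕ) (Φ : (ℕ → Batch N B) → ℝ) :
    Integrable (fun ω => Φ (frozenPath X H ω)) μ := by
  have hr : Measurable fun ω => (fun s : Fin (H + 1) => X s ω) :=
    measurable_pi_lambda _ fun s => hX s
  have h : Integrable (fun j : Fin (H + 1) → Batch N B =>
      Φ (fun s => j ⟨min s H, by omega⟩)) (μ.map fun ω => (fun s : Fin (H + 1) => X s ω)) :=
    Integrable.of_finite
  exact h.comp_measurable hr

/-- The expectation functional of a sampled process, frozen after round `H`. -/
noncomputable def pathExpectation (μ : Measure Ω) [IsFiniteMeasure μ] {X : ℕ → Ω → Batch N B}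
    (hX : ∀ t, Measurable (X t)) (H : ℕ) : ((ℕ → Batch N B) → ℝ) →ₗ[ℝ] ℝ where
  toFun Φ := ∫ ω, Φ (frozenPath X H ω) ∂μ
  map_add' Φ Ψ := integral_add (integrable_frozenPath hX H Φ) (integrable_frozenPath hX H Ψ)
  map_smul' c _ := integral_const_mul c _

theorem integral_prefix [IsFiniteMeasure μ] {X : ℕ → Ω → Batch N B} (hX : ∀ t, Measurable (X t))
    (t : ℕ) (G : (Fin t → Batch N B) → ℝ) :
    ∫ ω, G (fun s => X s ω) ∂μ = ∑ j, μ.real {ω | ∀ s : Fin t, X s ω = j s} * G j := by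
  have hr : Measurable fun ω => (fun s : Fin t => X s ω) := measurable_pi_lambda _ fun s => hX s
  rw [← integral_map (φ := fun ω => (fun s : Fin t => X s ω)) (f := G) hr.aemeasurable
    (measurable_of_finite G).aestronglyMeasurable, integral_fintype Integrable.of_finite]
  refine Finset.sum_congr rfl fun j _ => ?_
  rw [smul_eq_mul, measureReal_def, Measure.map_apply hr (MeasurableSet.singleton j),
    ← measureReal_def]
  congr 2
  ext ω
  simp [funext_iff]

theorem integral_prefix_prod [IsFiniteMeasure μ] {X : ℕ → Ω → Batch N B}
    (hX : ∀ t, Measurable (X t)) (t : ℕ) (G : (Fin t → Batch N B) → Batch N B → ℝ) :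
    ∫ ω, G (fun s => X s ω) (X t ω) ∂μ =
      ∑ j, ∑ J, μ.real {ω | (∀ s : Fin t, X s ω = j s) ∧ X t ω = J} * G j J := by
  have hr : Measurable fun ω => ((fun s : Fin t => X s ω), X t ω) :=
    (measurable_pi_lambda (fun ω (s : Fin t) => X s ω) fun s => hX s).prodMk (hX t)
  rw [← integral_map (φ := fun ω => ((fun s : Fin t => X s ω), X t ω))
    (f := fun x : (Fin t → Batch N B) × Batch N B => G x.1 x.2) hr.aemeasurable
    (measurable_of_finite _).aestronglyMeasurable, integral_fintype Integrable.of_finite,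
    Fintype.sum_prod_type]
  refine Finset.sum_congr rfl fun j _ => Finset.sum_congr rfl fun J _ => ?_
  rw [smul_eq_mul, measureReal_def, Measure.map_apply hr (MeasurableSet.singleton _),
    ← measureReal_def]
  congr 2
  ext ω
  simp [funext_iff, Prod.ext_iff]

/-- Both sides are finite sums over prefixes and next batches, and the conditional law of the
process matches them term by term. -/
theorem pathExpectation_step [IsProbabilityMeasure μ] {X : ℕ → Ω → Batch N B}
    (hX : IsParticipationProcess μ R p X) {H t : ℕ} (ht : R ≤ t) (htH : t ≤ H)
    (Φ : (ℕ → Batch N B) → Batch N B → ℝ) (hΦ : ∀ J, DependsOn (fun S => Φ S J) (Set.Iio t)) :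
    pathExpectation μ hX.measurable H (fun S => Φ S (S t)) =
      pathExpectation μ hX.measurable H
        (fun S => ∑ J, stepProb p (lastWindow R S t) J * Φ S J) := by
  -- The padding by J is irrelevant for Φ and for the window, which read rounds before t; at round t
  -- it is the batch that `hX.step` asks for.
  set ext : (Fin t → Batch N B) → Batch N B → ℕ → Batch N B :=
    fun j J s => if h : s < t then j ⟨s, h⟩ else J with hext
  have hfr : ∀ ω J, ∀ s ∈ Set.Iio t, frozenPath X H ω s = ext (fun s => X s ω) J s := by
    intro ω J s hs
    have hs' : s < t := hs
    simp only [frozenPath, hext, dif_pos hs']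
    rw [min_eq_left (by omega)]
  have hL : pathExpectation μ hX.measurable H (fun S => Φ S (S t)) =
      ∫ ω, (fun j J => Φ (ext j J) J) (fun s : Fin t => X s ω) (X t ω) ∂μ := by
    refine integral_congr_ae (Filter.Eventually.of_forall fun ω => ?_)
    have : frozenPath X H ω t = X t ω := by simp only [frozenPath, min_eq_left htH]
    simp only [this]
    exact hΦ (X t ω) (hfr ω (X t ω))
  have hRt : pathExpectation μ hX.measurable H
        (fun S => ∑ J, stepProb p (lastWindow R S t) J * Φ S J) =
      ∫ ω, (fun j => ∑ J, stepProb p (lastWindow R (ext j J) t) J * Φ (ext j J) J)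
        (fun s : Fin t => X s ω) ∂μ := by
    refine integral_congr_ae (Filter.Eventually.of_forall fun ω => ?_)
    simp only
    refine Finset.sum_congr rfl fun J _ => ?_
    have e1 : Φ (frozenPath X H ω) J = Φ (ext (fun s => X s ω) J) J := hΦ J (hfr ω J)
    have e2 := dependsOn_lastWindow (R := R) ht (hfr ω J)
    simp only at e2
    rw [e1, e2]
  rw [hL, hRt]
  refine (integral_prefix_prod (μ := μ) hX.measurable t fun j J => Φ (ext j J) J).trans
    (Eq.trans ?_ (integral_prefix (μ := μ) hX.measurable t fun j =>
      ∑ J, stepProb p (lastWindow R (ext j J) t) J * Φ (ext j J) J).symm)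
  refine Finset.sum_congr rfl fun j _ => ?_
  rw [Finset.mul_sum]
  refine Finset.sum_congr rfl fun J _ => ?_
  have hst := hX.step t ht (ext j J)
  have s1 : {ω | ∀ s ≤ t, X s ω = ext j J s} = {ω | (∀ s : Fin t, X s ω = j s) ∧ X t ω = J} := by
    ext ω
    simp only [Set.mem_ofPred_eq, hext]
    constructor
    · intro h
      refine ⟨fun s => ?_, ?_⟩
      · have := h s s.2.le
        rwa [dif_pos s.2] at this
      · have := h t le_rfl
        rwa [dif_neg (lt_irrefl t)] at this
    · rintro ⟨h1, h2⟩ s hs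
      split_ifs with h
      · exact h1 ⟨s, h⟩
      · obtain rfl : s = t := by omega
        exact h2
  have s2 : {ω | ∀ s < t, X s ω = ext j J s} = {ω | ∀ s : Fin t, X s ω = j s} := by
    ext ω
    simp only [Set.mem_ofPred_eq, hext]
    constructor
    · intro h s
      have := h s s.2
      rwa [dif_pos s.2] at this
    · intro h s hs
      rw [dif_pos hs]
      exact h ⟨s, hs⟩
  have s3 : ext j J t = J := by simp [hext]
  rw [s1, s2, s3] at hst
  rw [hst]
  exact mul_assoc _ _ _

/-- The indicator of drawing an unavailable batch has expectation zero, as `stepProb` vanishes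
there. The first R rounds are covered by `initial`. -/
theorem ae_separated_frozenPath [IsProbabilityMeasure μ] {X : ℕ → Ω → Batch N B}
    (hX : IsParticipationProcess μ R p X) (H : ℕ) :
    ∀ᵐ ω ∂μ, Separated R H (frozenPath X H ω) := by
  classical
  have hav : ∀ t, R ≤ t → t ≤ H →
      ∀ᵐ ω ∂μ, Available (lastWindow R (frozenPath X H ω) t) (frozenPath X H ω t) := by
    intro t ht htH
    set Φ : (ℕ → Batch N B) → Batch N B → ℝ :=
      fun S J => if Available (lastWindow R S t) J then 0 else 1 with hΦ
    have h1 := pathExpectation_step hX ht htH Φ (fun J S S' h => by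
      have e2 := dependsOn_lastWindow (R := R) ht h
      simp only [hΦ] at e2 ⊢
      rw [e2])
    have h2 : (fun S : ℕ → Batch N B => ∑ J, stepProb p (lastWindow R S t) J * Φ S J) = 0 := by
      funext S
      refine Finset.sum_eq_zero fun J _ => ?_
      by_cases hJ : Available (lastWindow R S t) J
      · simp [hΦ, hJ]
      · simp [stepProb_eq_zero hJ]
    rw [h2, map_zero] at h1
    have h3 := (integral_eq_zero_iff_of_nonneg (μ := μ)
      (f := fun ω => Φ (frozenPath X H ω) (frozenPath X H ω t))
      (fun ω => by simp only [hΦ, Pi.zero_apply]; split_ifs <;> norm_num)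
      (integrable_frozenPath hX.measurable H fun S => Φ S (S t))).1 h1
    filter_upwards [h3] with ω hω
    by_contra h
    simp [hΦ, h] at hω
  have hall : ∀ᵐ ω ∂μ, ∀ t, R ≤ t → t ≤ H →
      Available (lastWindow R (frozenPath X H ω) t) (frozenPath X H ω t) := by
    rw [ae_all_iff]; intro t
    by_cases h1 : R ≤ t
    · by_cases h2 : t ≤ H
      · filter_upwards [hav t h1 h2] with ω hω _ _ using hω
      · exact Filter.Eventually.of_forall fun ω _ h => absurd h h2
    · exact Filter.Eventually.of_forall fun ω h => absurd h h1
  filter_upwards [hall, hX.initial] with ω h1 h2 s t hst htR htH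
  by_cases ht : R ≤ t
  · have := h1 t ht htH ⟨t - 1 - s, by omega⟩
    have e : t - 1 - (t - 1 - s) = s := by omega
    simpa only [lastWindow, e] using this
  · have := h2 s t hst (by omega)
    simpa only [frozenPath, min_eq_left htH, min_eq_left (hst.le.trans htH)] using this

theorem isParticipationExpectation_pathExpectation [IsProbabilityMeasure μ]
    {X : ℕ → Ω → Batch N B} (hX : IsParticipationProcess μ R p X) (H : ℕ) :
    IsParticipationExpectation R H p (pathExpectation μ hX.measurable H) where
  mono Φ Ψ h := by
    refine integral_mono_ae (integrable_frozenPath hX.measurable H Φ)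
      (integrable_frozenPath hX.measurable H Ψ) ?_
    filter_upwards [ae_separated_frozenPath hX H] with ω hω using h _ hω
  one := by simp [pathExpectation]
  step t ht htH Φ hΦ := pathExpectation_step hX ht htH Φ hΦ

end Expectation

end DebiasedFedAvg

namespace DebiasedFedAvg

/-! ### Concentration of the participation counts -/

section Concentration

variable {N B : ℕ}

theorem expect_const_mul {T : Type*} (E : (T → ℝ) →ₗ[ℝ] ℝ) (c : ℝ) (Φ : T → ℝ) :
    E (fun S => c * Φ S) = c * E Φ := E.map_smul c Φ

theorem expect_add {T : Type*} (E : (T → ℝ) →ₗ[ℝ] ℝ) (Φ Ψ : T → ℝ) :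
    E (fun S => Φ S + Ψ S) = E Φ + E Ψ := E.map_add Φ Ψ

theorem expect_sub {T : Type*} (E : (T → ℝ) →ₗ[ℝ] ℝ) (Φ Ψ : T → ℝ) :
    E (fun S => Φ S - Ψ S) = E Φ - E Ψ := E.map_sub Φ Ψ

theorem expect_sum {T ι : Type*} (E : (T → ℝ) →ₗ[ℝ] ℝ) (s : Finset ι) (Φ : ι → T → ℝ) :
    E (fun S => ∑ i ∈ s, Φ i S) = ∑ i ∈ s, E (Φ i) := by
  rw [← map_sum]
  congr 1
  funext S
  simp

/-- Regroups by residue classes modulo l; consecutive rounds of a class are l apart, which leaves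
time to mix. -/
theorem sum_range_mul_eq (f : ℕ → ℝ) (n l : ℕ) :
    ∑ s ∈ Finset.range (n * l), f s = ∑ b ∈ Finset.range l, ∑ j ∈ Finset.range n, f (j * l + b) := by
  induction n with
  | zero => simp
  | succ n ih =>
    rw [add_mul, one_mul, Finset.sum_range_add, ih, ← Finset.sum_add_distrib]
    exact Finset.sum_congr rfl fun b _ => by rw [Finset.sum_range_succ]

theorem part_nonneg (i : Fin N) (J : Batch N B) : 0 ≤ part i J := by
  unfold part; split_ifs <;> norm_num

theorem part_le_one (i : Fin N) (J : Batch N B) : part i J ≤ 1 := by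
  unfold part; split_ifs <;> norm_num

/-- Deviation of the number of participations of client `i` before round `r` from its mean. -/
noncomputable def deviation (β : Fin N → ℝ) (r : ℕ) (i : Fin N) (S : ℕ → Batch N B) : ℝ :=
  ∑ s ∈ Finset.range r, (part i (S s) - β i)

theorem dependsOn_deviation (β : Fin N → ℝ) (r : ℕ) (i : Fin N) :
    DependsOn (fun S : ℕ → Batch N B => deviation β r i S) (Set.Iio r) := fun S S' h =>
  Finset.sum_congr rfl fun s hs => by rw [h s (Set.mem_Iio.2 (Finset.mem_range.1 hs))]

theorem abs_part_sub_le_one {β : Fin N → ℝ} (h0 : ∀ i, 0 ≤ β i) (h1 : ∀ i, β i ≤ 1) (i : Fin N)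
    (J : Batch N B) : |part i J - β i| ≤ 1 := by
  have := part_nonneg i J
  have := part_le_one i J
  have := h0 i
  have := h1 i
  rw [abs_le]; constructor <;> linarith

variable {u₀ g H : ℕ} {β : Fin N → ℝ} {δ : ℝ} {E : ((ℕ → Batch N B) → ℝ) →ₗ[ℝ] ℝ}

theorem IsMixingExpectation.nonneg (hE : IsMixingExpectation u₀ g H β δ E)
    {Φ : (ℕ → Batch N B) → ℝ} (h : ∀ S, 0 ≤ Φ S) : 0 ≤ E Φ := by
  rw [← map_zero E]
  exact hE.mono _ _ h

theorem IsMixingExpectation.le_const (hE : IsMixingExpectation u₀ g H β δ E)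
    {Φ : (ℕ → Batch N B) → ℝ} {c : ℝ} (h : ∀ S, Φ S ≤ c) : E Φ ≤ c := by
  have := hE.mono Φ (fun _ => c * 1) (fun S => by simpa using h S)
  rwa [expect_const_mul, hE.one, mul_one] at this

/-- Moment generating function along a residue class of rounds. -/
theorem IsMixingExpectation.mgf_residue_le (hE : IsMixingExpectation u₀ g H β δ E)
    (h0 : ∀ i, 0 ≤ β i) (h1 : ∀ i, β i ≤ 1) {l b : ℕ} (hgl : g + 1 ≤ l) (hul : u₀ ≤ l) (hb : b < l)
    {θ : ℝ} (hθ : |θ| ≤ 1) (i : Fin N) (n : ℕ) (hn : (n + 2) * l ≤ H) :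
    E (fun S => Real.exp (θ * ∑ j ∈ Finset.range n, (part i (S (2 * l + (j * l + b))) - β i))) ≤
      Real.exp (n * (|θ| * δ + θ ^ 2)) := by
  induction n with
  | zero => simp [hE.one]
  | succ n ih =>
    have hn' : (n + 2) * l + l ≤ H := by linarith [hn, add_mul (n + 2) 1 l]
    set Φ : (ℕ → Batch N B) → ℝ := fun S =>
      Real.exp (θ * ∑ j ∈ Finset.range n, (part i (S (2 * l + (j * l + b))) - β i)) with hΦ
    have hdep : DependsOn Φ (Set.Iio ((n + 1) * l + b + 1)) := by
      intro S S' h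
      simp only [hΦ]
      congr 2
      refine Finset.sum_congr rfl fun j hj => ?_
      have : (j + 1) * l ≤ n * l := Nat.mul_le_mul_right l (Finset.mem_range.1 hj)
      rw [h (2 * l + (j * l + b)) (Set.mem_Iio.2 (by nlinarith))]
    -- The previous round of the class is (n + 1)l + b, so l ≥ g + 1 provides the lag. The offset 2l
    -- of the class keeps the past beyond u₀ even for n = 0.
    have hmix := hE.mix i ((n + 1) * l + b + 1) (2 * l + (n * l + b)) Φ (by nlinarith) (by nlinarith)
      (by nlinarith) hdep
    have habs : (fun S => |Φ S|) = Φ := by funext S; exact abs_of_pos (Real.exp_pos _)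
    rw [habs] at hmix
    have hΦ0 : 0 ≤ E Φ := hE.nonneg fun S => (Real.exp_pos _).le
    -- From e^x ≤ 1 + x + x² for |x| ≤ 1; mixing makes the linear term nearly centred.
    have hpt : ∀ S, Real.exp (θ * ∑ j ∈ Finset.range (n + 1),
        (part i (S (2 * l + (j * l + b))) - β i)) ≤
        (1 + θ ^ 2) * Φ S + θ * (Φ S * (part i (S (2 * l + (n * l + b))) - β i)) := by
      intro S
      rw [Finset.sum_range_succ, mul_add, Real.exp_add]
      set Z := part i (S (2 * l + (n * l + b))) - β i
      have hZ : |Z| ≤ 1 := abs_part_sub_le_one h0 h1 i _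
      have hθZ : |θ * Z| ≤ 1 := by
        rw [abs_mul]; exact mul_le_one₀ hθ (abs_nonneg _) hZ
      have h2 := (abs_le.1 (Real.abs_exp_sub_one_sub_id_le hθZ)).2
      have h3 : (θ * Z) ^ 2 ≤ θ ^ 2 := by
        rw [mul_pow]
        exact mul_le_of_le_one_right (sq_nonneg _) (by rw [← sq_abs]; exact pow_le_one₀ (abs_nonneg _) hZ)
      have h4 : Real.exp (θ * Z) ≤ 1 + θ ^ 2 + θ * Z := by linarith
      calc _ ≤ Φ S * (1 + θ ^ 2 + θ * Z) := mul_le_mul_of_nonneg_left h4 (Real.exp_pos _).le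
        _ = _ := by ring
    calc _ ≤ (1 + θ ^ 2) * E Φ + θ * E (fun S => Φ S * (part i (S (2 * l + (n * l + b))) - β i)) := by
          have := hE.mono _ _ hpt
          rwa [expect_add, expect_const_mul, expect_const_mul] at this
      _ ≤ (1 + θ ^ 2) * E Φ + |θ| * (δ * E Φ) := by
          refine add_le_add le_rfl ((le_abs_self _).trans ?_)
          rw [abs_mul]
          exact mul_le_mul_of_nonneg_left hmix (abs_nonneg _)
      _ = (|θ| * δ + θ ^ 2 + 1) * E Φ := by ring
      _ ≤ Real.exp (|θ| * δ + θ ^ 2) * Real.exp (n * (|θ| * δ + θ ^ 2)) :=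
          mul_le_mul (Real.add_one_le_exp _) (ih (by linarith)) hΦ0 (Real.exp_pos _).le
      _ = _ := by rw [← Real.exp_add]; congr 1; push_cast; ring

/-- The exponent is the average over the l residue classes of θ times the class sums, so convexity
of exp reduces to a single class, without any independence between classes. -/
theorem IsMixingExpectation.mgf_le (hE : IsMixingExpectation u₀ g H β δ E)
    (h0 : ∀ i, 0 ≤ β i) (h1 : ∀ i, β i ≤ 1) {l : ℕ} (hgl : g + 1 ≤ l) (hul : u₀ ≤ l)
    {θ : ℝ} (hθ : |θ| ≤ 1) (i : Fin N) (n : ℕ) (hn : (n + 2) * l ≤ H) :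
    E (fun S => Real.exp (θ / l * ∑ s ∈ Finset.range (n * l), (part i (S (2 * l + s)) - β i))) ≤
      Real.exp (n * (|θ| * δ + θ ^ 2)) := by
  have hl : (0 : ℝ) < l := by exact_mod_cast (by omega : 0 < l)
  have hpt : ∀ S : ℕ → Batch N B,
      Real.exp (θ / l * ∑ s ∈ Finset.range (n * l), (part i (S (2 * l + s)) - β i)) ≤
      ∑ b ∈ Finset.range l, (1 / (l : ℝ)) * Real.exp (θ * ∑ j ∈ Finset.range n,
        (part i (S (2 * l + (j * l + b))) - β i)) := by
    intro S
    have := convexOn_exp.map_sum_le (t := Finset.range l) (w := fun _ => 1 / (l : ℝ))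
      (p := fun b => θ * ∑ j ∈ Finset.range n, (part i (S (2 * l + (j * l + b))) - β i))
      (fun _ _ => by positivity) (by simp [hl.ne']) (fun _ _ => Set.mem_univ _)
    simp only [smul_eq_mul] at this
    refine le_trans (le_of_eq ?_) this
    congr 1
    rw [sum_range_mul_eq (fun s => part i (S (2 * l + s)) - β i), Finset.mul_sum]
    exact Finset.sum_congr rfl fun b _ => by ring
  have h2 := hE.mono _ _ hpt
  rw [expect_sum] at h2
  refine h2.trans ?_
  calc _ ≤ ∑ b ∈ Finset.range l, (1 / (l : ℝ)) * Real.exp (n * (|θ| * δ + θ ^ 2)) := by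
        refine Finset.sum_le_sum fun b hb => ?_
        rw [expect_const_mul]
        exact mul_le_mul_of_nonneg_left
          (hE.mgf_residue_le h0 h1 hgl hul (Finset.mem_range.1 hb) hθ i n hn) (by positivity)
    _ = _ := by simp [hl.ne']

theorem abs_sum_range_part_le (h0 : ∀ i, 0 ≤ β i) (h1 : ∀ i, β i ≤ 1) (i : Fin N) (n a : ℕ)
    (S : ℕ → Batch N B) : |∑ s ∈ Finset.range n, (part i (S (a + s)) - β i)| ≤ n := by
  refine (Finset.abs_sum_le_sum_abs _ _).trans ?_
  calc _ ≤ ∑ s ∈ Finset.range n, (1 : ℝ) :=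
        Finset.sum_le_sum fun s _ => abs_part_sub_le_one h0 h1 i _
    _ = n := by simp

/-- The first 2l and the last q ≤ l rounds lie outside the complete blocks and contribute at most 1
each. -/
theorem abs_deviation_sub_le (h0 : ∀ i, 0 ≤ β i) (h1 : ∀ i, β i ≤ 1) (i : Fin N) {l n q : ℕ}
    (hq : q ≤ l) (S : ℕ → Batch N B) :
    |deviation β (2 * l + n * l + q) i S - ∑ s ∈ Finset.range (n * l), (part i (S (2 * l + s)) - β i)|
      ≤ 3 * l := by
  have e : deviation β (2 * l + n * l + q) i S =
      ∑ s ∈ Finset.range (2 * l), (part i (S (0 + s)) - β i)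
      + ∑ s ∈ Finset.range (n * l), (part i (S (2 * l + s)) - β i)
      + ∑ s ∈ Finset.range q, (part i (S (2 * l + n * l + s)) - β i) := by
    unfold deviation
    rw [Finset.sum_range_add, Finset.sum_range_add]
    simp
  have b1 := abs_le.1 (abs_sum_range_part_le h0 h1 i (2 * l) 0 S)
  have b2 := abs_le.1 (abs_sum_range_part_le h0 h1 i q (2 * l + n * l) S)
  have hq' : (q : ℝ) ≤ l := by exact_mod_cast hq
  push_cast at b1
  rw [e, abs_le]
  constructor <;> linarith [b1.1, b1.2, b2.1, b2.2]

theorem exists_eq_two_mul_add {r l : ℕ} (hl : 0 < l) (hr : 2 * l ≤ r) :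
    ∃ n q, q ≤ l ∧ r = 2 * l + n * l + q := by
  refine ⟨(r - 2 * l) / l, (r - 2 * l) % l, (Nat.mod_lt _ hl).le, ?_⟩
  have := Nat.div_add_mod (r - 2 * l) l
  rw [mul_comm] at this
  omega

open Classical in
/-- Exponential concentration of the participation counts. -/
theorem IsMixingExpectation.tail_le (hE : IsMixingExpectation u₀ g H β δ E)
    (h0 : ∀ i, 0 ≤ β i) (h1 : ∀ i, β i ≤ 1) {l : ℕ} (hgl : g + 1 ≤ l) (hul : u₀ ≤ l)
    {ε : ℝ} (hε : 0 < ε) (hε1 : ε ≤ 1) (hδ0 : 0 ≤ δ) (hδ : δ ≤ ε / 8) (i : Fin N) {r : ℕ}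
    (hr : 6 * (l : ℝ) ≤ ε * r) (hrH : r ≤ H) :
    E (fun S => if ε * r < |deviation β r i S| then 1 else 0) ≤
      2 * Real.exp (-(ε ^ 2 / 32) * (r / l)) := by
  have hl0 : 0 < l := by omega
  have hl : (0 : ℝ) < l := by exact_mod_cast hl0
  have h2l : 2 * l ≤ r := by
    have : (2 * l : ℝ) ≤ r := by nlinarith [(Nat.cast_nonneg r : (0 : ℝ) ≤ r)]
    exact_mod_cast this
  obtain ⟨n, q, hq, hrq⟩ := exists_eq_two_mul_add hl0 h2l
  set A : (ℕ → Batch N B) → ℝ := fun S =>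
    ∑ s ∈ Finset.range (n * l), (part i (S (2 * l + s)) - β i) with hA
  have hnl : (n : ℝ) ≤ r / l := by
    rw [le_div_iff₀ hl]
    exact_mod_cast (by omega : n * l ≤ r)
  have hnH : (n + 2) * l ≤ H := by nlinarith
  -- Chernoff's bound: boundary terms cost 3l ≤ εr/2, so |A| ≥ εr/2 remains. In units of r/l the
  -- exponent is -θε/2 + θδ + θ² ≤ -ε²/16 + ε²/64 + ε²/64 = -ε²/32.
  set θ := ε / 8 with hθ
  have hθ0 : 0 < θ := by positivity
  have hmgf : ∀ θ', |θ'| = θ → E (fun S => Real.exp (θ' / l * A S)) ≤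
      Real.exp (r / l * (θ * δ + θ ^ 2)) := by
    intro θ' hθ'
    refine (hE.mgf_le h0 h1 hgl hul (by rw [hθ']; linarith) i n hnH).trans ?_
    rw [hθ', ← sq_abs θ', hθ']
    exact Real.exp_le_exp.2 (mul_le_mul_of_nonneg_right hnl (by positivity))
  have hpt : ∀ S, (if ε * r < |deviation β r i S| then (1 : ℝ) else 0) ≤
      Real.exp (-(θ * ε / 2 * (r / l))) * (Real.exp (θ / l * A S) + Real.exp (-θ / l * A S)) := by
    intro S
    split_ifs with h
    · have hd := abs_deviation_sub_le h0 h1 i (n := n) hq S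
      rw [← hrq] at hd
      have hAS : ε * r / 2 ≤ |A S| := by
        have := abs_sub_abs_le_abs_sub (deviation β r i S) (A S)
        linarith
      have h3 : Real.exp (θ / l * |A S|) ≤ Real.exp (θ / l * A S) + Real.exp (-θ / l * A S) := by
        rcases abs_cases (A S) with ⟨h, -⟩ | ⟨h, -⟩ <;> rw [h]
        · linarith [Real.exp_pos (-θ / l * A S)]
        · have : θ / l * -A S = -θ / l * A S := by ring
          rw [this]
          linarith [Real.exp_pos (θ / l * A S)]
      calc (1 : ℝ) = Real.exp (-(θ * ε / 2 * (r / l))) * Real.exp (θ / l * (ε * r / 2)) := by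
            rw [← Real.exp_add, eq_comm, Real.exp_eq_one_iff]; ring
        _ ≤ Real.exp (-(θ * ε / 2 * (r / l))) * Real.exp (θ / l * |A S|) := by gcongr
        _ ≤ _ := by gcongr
    · positivity
  have h2 := hE.mono _ _ hpt
  rw [expect_const_mul, expect_add] at h2
  calc _ ≤ Real.exp (-(θ * ε / 2 * (r / l))) * (Real.exp (r / l * (θ * δ + θ ^ 2)) +
        Real.exp (r / l * (θ * δ + θ ^ 2))) := by
        refine h2.trans (mul_le_mul_of_nonneg_left (add_le_add (hmgf θ (abs_of_pos hθ0)) (hmgf (-θ) (by rw [abs_neg, abs_of_pos hθ0])))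
          (Real.exp_pos _).le)
    _ = 2 * Real.exp (-(θ * ε / 2 * (r / l)) + r / l * (θ * δ + θ ^ 2)) := by
        rw [Real.exp_add]; ring
    _ ≤ _ := by
        gcongr
        have hrl : 0 ≤ (r : ℝ) / l := by positivity
        have : -(θ * ε / 2) + (θ * δ + θ ^ 2) ≤ -(ε ^ 2 / 32) := by
          have : θ * δ ≤ θ * (ε / 8) := mul_le_mul_of_nonneg_left hδ hθ0.le
          rw [hθ] at this ⊢
          nlinarith
        nlinarith [mul_le_mul_of_nonneg_left this hrl]

/-- The exponential moment is taken at the fluctuation scale √(lr), where it is bounded, and x² ≤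
2(e^x + e^{-x}) converts it into a variance bound. -/
theorem IsMixingExpectation.second_moment_le (hE : IsMixingExpectation u₀ g H β δ E)
    (h0 : ∀ i, 0 ≤ β i) (h1 : ∀ i, β i ≤ 1) {l : ℕ} (hgl : g + 1 ≤ l) (hul : u₀ ≤ l)
    (hδ0 : 0 ≤ δ) (i : Fin N) {r : ℕ} (hδ : δ * r ≤ 1) (hr : 2 * l ≤ r) (hrH : r ≤ H) :
    E (fun S => deviation β r i S ^ 2) ≤ 100 * (l * r) := by
  have hl0 : 0 < l := by omega
  have hl : (0 : ℝ) < l := by exact_mod_cast hl0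
  have hl1 : (1 : ℝ) ≤ l := by exact_mod_cast hl0
  have hrl : 2 * (l : ℝ) ≤ r := by exact_mod_cast hr
  have hr0 : (0 : ℝ) < r := by linarith
  obtain ⟨n, q, hq, hrq⟩ := exists_eq_two_mul_add hl0 hr
  set A : (ℕ → Batch N B) → ℝ := fun S =>
    ∑ s ∈ Finset.range (n * l), (part i (S (2 * l + s)) - β i) with hA
  have hnl : (n : ℝ) ≤ r / l := by
    rw [le_div_iff₀ hl]
    exact_mod_cast (by omega : n * l ≤ r)
  have hnH : (n + 2) * l ≤ H := by nlinarith
  -- With this choice (θA/l)² = A²/(lr), and the exponent (r/l)(θδ + θ²) is at most 2 because δr ≤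
  -- 1.
  set θ := √(l / r) with hθ
  have hθ0 : 0 < θ := Real.sqrt_pos.2 (by positivity)
  have hθ2 : θ ^ 2 = l / r := Real.sq_sqrt (by positivity)
  have hθ1 : θ ≤ 1 := Real.sqrt_le_one.2 (by rw [div_le_one hr0]; linarith)
  have hexp : (r : ℝ) / l * (θ * δ + θ ^ 2) ≤ 2 := by
    have e1 : (r : ℝ) / l * θ ^ 2 = 1 := by rw [hθ2]; field_simp
    have e2 : (r : ℝ) / l * (θ * δ) ≤ 1 := by
      calc (r : ℝ) / l * (θ * δ) ≤ r / 1 * (1 * δ) := by gcongr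
        _ = δ * r := by ring
        _ ≤ 1 := hδ
    rw [mul_add]
    linarith
  have hmgf : ∀ θ', |θ'| = θ → E (fun S => Real.exp (θ' / l * A S)) ≤ 8 := by
    intro θ' hθ'
    refine (hE.mgf_le h0 h1 hgl hul (by rw [hθ']; linarith) i n hnH).trans ?_
    rw [hθ', ← sq_abs θ', hθ']
    calc Real.exp (n * (θ * δ + θ ^ 2)) ≤ Real.exp 2 := Real.exp_le_exp.2
          ((mul_le_mul_of_nonneg_right hnl (by positivity)).trans hexp)
      _ = Real.exp 1 ^ 2 := by rw [← Real.exp_nat_mul]; norm_num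
      _ ≤ 8 := by nlinarith [Real.exp_one_lt_d9, Real.exp_one_gt_d9]
  have hpt : ∀ S, deviation β r i S ^ 2 ≤
      4 * (l * r) * (Real.exp (θ / l * A S) + Real.exp (-θ / l * A S)) + 18 * l ^ 2 * 1 := by
    intro S
    have hd := abs_deviation_sub_le h0 h1 i (n := n) hq S
    rw [← hrq] at hd
    have h2 : deviation β r i S ^ 2 ≤ 2 * A S ^ 2 + 18 * l ^ 2 := by
      have : (deviation β r i S - A S) ^ 2 ≤ (3 * l) ^ 2 := by
        rw [← sq_abs]; exact pow_le_pow_left₀ (abs_nonneg _) hd 2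
      nlinarith [sq_nonneg (deviation β r i S - 2 * A S)]
    have h3 : ∀ x : ℝ, x ^ 2 ≤ 2 * (Real.exp x + Real.exp (-x)) := by
      intro x
      rcases le_total 0 x with hx | hx
      · have := Real.quadratic_le_exp_of_nonneg hx
        linarith [Real.exp_pos (-x)]
      · have := Real.quadratic_le_exp_of_nonneg (neg_nonneg.2 hx)
        rw [neg_sq] at this
        linarith [Real.exp_pos x]
    have h4 := h3 (θ / l * A S)
    have e1 : (θ / l * A S) ^ 2 = A S ^ 2 / (l * r) := by
      rw [mul_pow, div_pow, hθ2]; field_simp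
    have e2 : -θ / l * A S = -(θ / l * A S) := by ring
    rw [e1, div_le_iff₀ (by positivity)] at h4
    rw [e2]
    linarith
  have h2 := hE.mono _ _ hpt
  rw [expect_add, expect_const_mul, expect_const_mul, expect_add, hE.one] at h2
  have e1 := hmgf θ (abs_of_pos hθ0)
  have e2 := hmgf (-θ) (by rw [abs_neg, abs_of_pos hθ0])
  have hlr : (0 : ℝ) ≤ l * r := by positivity
  nlinarith [mul_le_mul_of_nonneg_left e1 hlr, mul_le_mul_of_nonneg_left e2 hlr]

end Concentration

end DebiasedFedAvg

namespace DebiasedFedAvg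

open scoped RealInnerProductSpace

/-! ### Functions with Lipschitz gradient -/

section Smooth

variable {V : Type*} [NormedAddCommGroup V] [InnerProductSpace ℝ V] [CompleteSpace V]

/-- Quadratic upper bound for a function with Lipschitz gradient. -/
theorem le_add_inner_gradient_add {F : V → ℝ} (hF : Differentiable ℝ F) {L : ℝ} (hL0 : 0 ≤ L)
    (hL : ∀ x y, ‖gradient F x - gradient F y‖ ≤ L * ‖x - y‖) (x y : V) :
    F y ≤ F x + ⟪gradient F x, y - x⟫ + L * ‖y - x‖ ^ 2 := by
  have hderiv : ∀ t : ℝ, HasDerivAt (fun t : ℝ => F (x + t • (y - x)))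
      ⟪gradient F (x + t • (y - x)), y - x⟫ t := by
    intro t
    have h1 := (hF (x + t • (y - x))).hasGradientAt.hasFDerivAt
    have h2 : HasDerivAt (fun t : ℝ => x + t • (y - x)) (y - x) t := by
      simpa using ((hasDerivAt_id t).smul_const (y - x)).const_add x
    exact h1.comp_hasDerivAt t h2
  -- The mean value theorem in place of an integral gives the constant L instead of L/2, which
  -- suffices.
  obtain ⟨c, hc, hcd⟩ := exists_hasDerivAt_eq_slope (fun t : ℝ => F (x + t • (y - x))) _
    (zero_lt_one) (fun t _ => (hderiv t).continuousAt.continuousWithinAt) (fun t _ => hderiv t)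
  simp only [one_smul, zero_smul, add_zero, add_sub_cancel, sub_zero, div_one] at hcd
  have h3 : ⟪gradient F (x + c • (y - x)) - gradient F x, y - x⟫ ≤ L * ‖y - x‖ ^ 2 := by
    refine (real_inner_le_norm _ _).trans ?_
    have h4 := hL (x + c • (y - x)) x
    rw [add_sub_cancel_left, norm_smul, Real.norm_of_nonneg hc.1.le] at h4
    have h5 : L * (c * ‖y - x‖) ≤ L * ‖y - x‖ := by
      refine mul_le_mul_of_nonneg_left ?_ hL0
      exact mul_le_of_le_one_left (norm_nonneg _) hc.2.le
    calc _ ≤ L * ‖y - x‖ * ‖y - x‖ := mul_le_mul_of_nonneg_right (h4.trans h5) (norm_nonneg _)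
      _ = _ := by ring
  rw [inner_sub_left] at h3
  linarith

/-- A gradient step of length 1/(2L) lowers F by at least ‖∇F‖²/(4L), but not below m. -/
theorem norm_gradient_sq_le {F : V → ℝ} (hF : Differentiable ℝ F) {L : ℝ} (hL0 : 0 < L)
    (hL : ∀ x y, ‖gradient F x - gradient F y‖ ≤ L * ‖x - y‖) {m : ℝ} (hm : ∀ y, m ≤ F y) (x : V) :
    ‖gradient F x‖ ^ 2 ≤ 4 * L * (F x - m) := by
  have h := le_add_inner_gradient_add hF hL0.le hL x (x - (1 / (2 * L)) • gradient F x)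
  have h1 := hm (x - (1 / (2 * L)) • gradient F x)
  have e : x - (1 / (2 * L)) • gradient F x - x = -((1 / (2 * L)) • gradient F x) := by abel
  rw [e, inner_neg_right, real_inner_smul_right, real_inner_self_eq_norm_sq, norm_neg, norm_smul,
    Real.norm_of_nonneg (by positivity), mul_pow] at h
  have e2 : L * ((1 / (2 * L)) ^ 2 * ‖gradient F x‖ ^ 2) = ‖gradient F x‖ ^ 2 / (4 * L) := by
    field_simp; ring
  have e3 : 1 / (2 * L) * ‖gradient F x‖ ^ 2 = 2 * (‖gradient F x‖ ^ 2 / (4 * L)) := by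
    field_simp; ring
  rw [e2, e3] at h
  have h2 : ‖gradient F x‖ ^ 2 / (4 * L) ≤ F x - m := by linarith
  rw [div_le_iff₀ (by positivity)] at h2
  linarith

end Smooth

/-! ### Drift, path-by-path growth and one-round descent -/

section Optimization

variable {N B d : ℕ}

/-- Smooth local objectives with bounded heterogeneity. -/
structure IsSmoothFamily (f : Fin N → EuclideanSpace ℝ (Fin d) → ℝ) (L G : ℝ) : Prop where
  -- No loss, as L may be replaced by L + 1; bounds on L‖x - y‖ thereby become bounds on ‖x - y‖.
  one_le : 1 ≤ L
  G_nonneg : 0 ≤ G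
  differentiable : ∀ i, Differentiable ℝ (f i)
  heterogeneity : ∀ i x, ‖gradient (f i) x - gradient (globalObj f) x‖ ≤ G
  smooth : ∀ i x y, ‖gradient (f i) x - gradient (f i) y‖ ≤ L * ‖x - y‖

variable {f : Fin N → EuclideanSpace ℝ (Fin d) → ℝ} {L G : ℝ}

theorem hasGradientAt_globalObj (hf : ∀ i, Differentiable ℝ (f i)) (x : EuclideanSpace ℝ (Fin d)) :
    HasGradientAt (globalObj f) ((1 / (N : ℝ)) • ∑ i, gradient (f i) x) x := by
  rw [hasGradientAt_iff_hasFDerivAt]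
  have h : HasFDerivAt (fun y => ∑ i, f i y) (∑ i, InnerProductSpace.toDual ℝ _ (gradient (f i) x)) x :=
    HasFDerivAt.fun_sum fun i _ => (hf i x).hasGradientAt.hasFDerivAt
  have := h.const_mul (1 / (N : ℝ))
  rw [map_smul, map_sum]
  exact this

theorem gradient_globalObj (hf : ∀ i, Differentiable ℝ (f i)) (x : EuclideanSpace ℝ (Fin d)) :
    gradient (globalObj f) x = (1 / (N : ℝ)) • ∑ i, gradient (f i) x :=
  (hasGradientAt_globalObj hf x).gradient

theorem differentiable_globalObj (hf : ∀ i, Differentiable ℝ (f i)) :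
    Differentiable ℝ (globalObj f) := fun x => (hasGradientAt_globalObj hf x).differentiableAt

theorem norm_gradient_globalObj_sub_le (hf : ∀ i, Differentiable ℝ (f i)) (hL0 : 0 ≤ L)
    (hL : ∀ i x y, ‖gradient (f i) x - gradient (f i) y‖ ≤ L * ‖x - y‖)
    (x y : EuclideanSpace ℝ (Fin d)) :
    ‖gradient (globalObj f) x - gradient (globalObj f) y‖ ≤ L * ‖x - y‖ := by
  rw [gradient_globalObj hf, gradient_globalObj hf, ← smul_sub, ← Finset.sum_sub_distrib, norm_smul,
    Real.norm_of_nonneg (by positivity)]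
  calc _ ≤ 1 / (N : ℝ) * ∑ _i : Fin N, L * ‖x - y‖ := by
        gcongr
        exact norm_sum_le_of_le _ fun i _ => hL i x y
    _ = (N / N : ℝ) * (L * ‖x - y‖) := by simp; ring
    _ ≤ 1 * (L * ‖x - y‖) := by
        gcongr
        exact div_self_le_one _
    _ = _ := one_mul _

namespace IsSmoothFamily

theorem L_pos (h : IsSmoothFamily f L G) : 0 < L := by linarith [h.one_le]

theorem smooth_globalObj (h : IsSmoothFamily f L G) (x y : EuclideanSpace ℝ (Fin d)) :
    ‖gradient (globalObj f) x - gradient (globalObj f) y‖ ≤ L * ‖x - y‖ :=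
  norm_gradient_globalObj_sub_le h.differentiable h.L_pos.le h.smooth x y

theorem norm_gradient_le (h : IsSmoothFamily f L G) (i : Fin N) (x : EuclideanSpace ℝ (Fin d)) :
    ‖gradient (f i) x‖ ≤ ‖gradient (globalObj f) x‖ + G := by
  have := norm_le_norm_add_norm_sub' (gradient (f i) x) (gradient (globalObj f) x)
  linarith [h.heterogeneity i x]

/-- ‖∇F‖ + G dominates all client gradients and is L-Lipschitz. It is the unit of every drift
estimate, replacing a gradient bound. -/
theorem bound_le (h : IsSmoothFamily f L G) (x y : EuclideanSpace ℝ (Fin d)) :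
    ‖gradient (globalObj f) y‖ + G ≤ ‖gradient (globalObj f) x‖ + G + L * ‖y - x‖ := by
  have := norm_le_norm_add_norm_sub' (gradient (globalObj f) y) (gradient (globalObj f) x)
  linarith [h.smooth_globalObj y x]

end IsSmoothFamily

theorem localModel_eq (g : EuclideanSpace ℝ (Fin d) → ℝ) (s : ℝ) (x : EuclideanSpace ℝ (Fin d))
    (k : ℕ) : localModel g s x k =
      x - s • ∑ j ∈ Finset.range k, gradient g (localModel g s x j) := by
  induction k with
  | zero => simp [localModel]
  | succ k ih =>
    rw [Finset.sum_range_succ, smul_add, ← sub_sub, ← ih]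
    rfl

/-- Drift of the local model. -/
theorem mul_norm_localModel_sub_le {g : EuclideanSpace ℝ (Fin d) → ℝ} {s U : ℝ} (hs : 0 ≤ s)
    (hL0 : 0 ≤ L) (hL : ∀ x y, ‖gradient g x - gradient g y‖ ≤ L * ‖x - y‖)
    {x : EuclideanSpace ℝ (Fin d)} (hU : ‖gradient g x‖ ≤ U) (k : ℕ) :
    L * ‖localModel g s x k - x‖ ≤ (Real.exp (k * s * L) - 1) * U := by
  have hU0 : 0 ≤ U := (norm_nonneg _).trans hU
  -- Discrete Grönwall: L‖x_k - x‖ + U grows at most by the factor 1 + sL per step.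
  have key : L * ‖localModel g s x k - x‖ ≤ ((1 + s * L) ^ k - 1) * U := by
    induction k with
    | zero => simp [localModel]
    | succ k ih =>
      set y := localModel g s x k
      have h1 : ‖gradient g y‖ ≤ U + L * ‖y - x‖ := by
        have := norm_le_norm_add_norm_sub' (gradient g y) (gradient g x)
        linarith [hL y x]
      have h2 : ‖localModel g s x (k + 1) - x‖ ≤ ‖y - x‖ + s * (U + L * ‖y - x‖) := by
        have e : localModel g s x (k + 1) - x = (y - x) - s • gradient g y := by
          simp only [localModel, y]; abel
        rw [e]
        refine (norm_sub_le _ _).trans ?_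
        rw [norm_smul, Real.norm_of_nonneg hs]
        gcongr
      have hsL : 0 ≤ s * L := mul_nonneg hs hL0
      calc _ ≤ L * (‖y - x‖ + s * (U + L * ‖y - x‖)) := mul_le_mul_of_nonneg_left h2 hL0
        _ = (1 + s * L) * (L * ‖y - x‖) + s * L * U := by ring
        _ ≤ (1 + s * L) * (((1 + s * L) ^ k - 1) * U) + s * L * U := by gcongr
        _ = _ := by ring
  refine key.trans (mul_le_mul_of_nonneg_right (sub_le_sub_right ?_ 1) hU0)
  have : (1 + s * L) ^ k ≤ Real.exp (s * L) ^ k := by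
    refine pow_le_pow_left₀ (by positivity) ?_ k
    linarith [Real.add_one_le_exp (s * L)]
  refine this.trans (le_of_eq ?_)
  rw [← Real.exp_nat_mul]
  congr 1; ring

theorem nu_nonneg (S : ℕ → Batch N B) (t : ℕ) (i : Fin N) : 0 ≤ nu S t i := by
  unfold nu lam; positivity

/-- Sum of the debiasing factors of the clients of round `t`. -/
noncomputable def nuSum (S : ℕ → Batch N B) (t : ℕ) : ℝ := ∑ i ∈ clients (S t), nu S t i

theorem nuSum_nonneg (S : ℕ → Batch N B) (t : ℕ) : 0 ≤ nuSum S t :=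
  Finset.sum_nonneg fun i _ => nu_nonneg S t i

theorem nu_le_nuSum (S : ℕ → Batch N B) (t : ℕ) {i : Fin N} (hi : i ∈ clients (S t)) :
    nu S t i ≤ nuSum S t :=
  Finset.single_le_sum (f := fun i => nu S t i) (fun i _ => nu_nonneg S t i) hi

variable {α : ℝ} {K : ℕ} {x₀ : EuclideanSpace ℝ (Fin d)}

theorem serverModel_succ_sub [NeZero B] (S : ℕ → Batch N B) (t : ℕ) :
    serverModel f α K x₀ S (t + 1) - serverModel f α K x₀ S t = (1 / (B : ℝ)) •
      ∑ i ∈ clients (S t), (localModel (f i) (α * nu S t i) (serverModel f α K x₀ S t) K -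
        serverModel f α K x₀ S t) := by
  have hB : (B : ℝ) ≠ 0 := Nat.cast_ne_zero.2 (NeZero.ne B)
  rw [Finset.sum_sub_distrib, smul_sub, Finset.sum_const, card_clients, ← Nat.cast_smul_eq_nsmul ℝ,
    smul_smul, one_div_mul_cancel hB, one_smul]
  rfl

theorem norm_average_le [NeZero B] {J : Batch N B} {v : Fin N → EuclideanSpace ℝ (Fin d)} {c : ℝ}
    (h : ∀ i ∈ clients J, ‖v i‖ ≤ c) : ‖(1 / (B : ℝ)) • ∑ i ∈ clients J, v i‖ ≤ c := by
  have hB : (0 : ℝ) < B := Nat.cast_pos.2 (NeZero.pos B)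
  rw [norm_smul, Real.norm_of_nonneg (by positivity)]
  calc _ ≤ 1 / (B : ℝ) * ∑ _i ∈ clients J, c := by
        gcongr
        exact norm_sum_le_of_le _ h
    _ = c := by
        rw [Finset.sum_const, card_clients, nsmul_eq_mul]
        field_simp

namespace IsSmoothFamily

theorem mul_norm_serverModel_succ_sub_le [NeZero B] (h : IsSmoothFamily f L G) (hα : 0 ≤ α)
    (S : ℕ → Batch N B) (t : ℕ) :
    L * ‖serverModel f α K x₀ S (t + 1) - serverModel f α K x₀ S t‖ ≤
      (Real.exp (α * K * L * nuSum S t) - 1) *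
        (‖gradient (globalObj f) (serverModel f α K x₀ S t)‖ + G) := by
  have hU : 0 ≤ ‖gradient (globalObj f) (serverModel f α K x₀ S t)‖ + G :=
    add_nonneg (norm_nonneg _) h.G_nonneg
  rw [serverModel_succ_sub, ← le_div_iff₀' h.L_pos]
  refine norm_average_le fun i hi => ?_
  rw [le_div_iff₀' h.L_pos]
  refine (mul_norm_localModel_sub_le (mul_nonneg hα (nu_nonneg S t i)) h.L_pos.le (h.smooth i)
    (h.norm_gradient_le i _) K).trans ?_
  refine mul_le_mul_of_nonneg_right (sub_le_sub_right (Real.exp_le_exp.2 ?_) 1) hU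
  have := nu_le_nuSum S t hi
  have hL := h.L_pos
  calc K * (α * nu S t i) * L = α * K * L * nu S t i := by ring
    _ ≤ _ := by gcongr

/-- Growth of the server model over `n` rounds. -/
theorem mul_norm_serverModel_sub_le [NeZero B] (h : IsSmoothFamily f L G) (hα : 0 ≤ α)
    (S : ℕ → Batch N B) (r n : ℕ) :
    L * ‖serverModel f α K x₀ S (r + n) - serverModel f α K x₀ S r‖ ≤
      (Real.exp (α * K * L * ∑ j ∈ Finset.range n, nuSum S (r + j)) - 1) *
        (‖gradient (globalObj f) (serverModel f α K x₀ S r)‖ + G) := by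
  induction n with
  | zero => simp
  | succ n ih =>
    set y := serverModel f α K x₀ S (r + n)
    set x := serverModel f α K x₀ S r
    have h1 := h.mul_norm_serverModel_succ_sub_le (K := K) (x₀ := x₀) hα S (r + n)
    have h2 := h.bound_le x y
    have h3 : L * ‖serverModel f α K x₀ S (r + (n + 1)) - x‖ ≤
        L * ‖serverModel f α K x₀ S (r + n + 1) - y‖ + L * ‖y - x‖ := by
      rw [← mul_add]
      refine mul_le_mul_of_nonneg_left ?_ h.L_pos.le
      exact norm_sub_le_norm_sub_add_norm_sub _ y x
    rw [Finset.sum_range_succ, mul_add (α * K * L), Real.exp_add]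
    set a := Real.exp (α * K * L * ∑ j ∈ Finset.range n, nuSum S (r + j))
    have hb : 1 ≤ Real.exp (α * K * L * nuSum S (r + n)) := by
      refine Real.one_le_exp ?_
      have := nuSum_nonneg S (r + n)
      have := h.L_pos
      positivity
    set b := Real.exp (α * K * L * nuSum S (r + n))
    -- The factors compose: (b - 1)(U + (a - 1)U) + (a - 1)U = (ab - 1)U.
    nlinarith [mul_le_mul_of_nonneg_left ih (sub_nonneg.2 hb),
      mul_le_mul_of_nonneg_left h2 (sub_nonneg.2 hb)]

end IsSmoothFamily

/-- Number of participations of client `i` before round `t`. -/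
def count (S : ℕ → Batch N B) (t : ℕ) (i : Fin N) : ℕ :=
  ((Finset.range t).filter fun s => i ∈ clients (S s)).card

theorem count_succ (S : ℕ → Batch N B) (t : ℕ) (i : Fin N) :
    count S (t + 1) i = count S t i + if i ∈ clients (S t) then 1 else 0 := by
  unfold count
  rw [Finset.range_add_one, Finset.filter_insert]
  split_ifs
  · rw [Finset.card_insert_of_notMem (by simp)]
  · rfl

theorem count_le (S : ℕ → Batch N B) (t : ℕ) (i : Fin N) : count S t i ≤ t :=
  (Finset.card_filter_le _ _).trans (by simp)

theorem nu_eq (S : ℕ → Batch N B) (t : ℕ) (i : Fin N) :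
    nu S t i = ((t : ℝ) + 1) * B / (N * count S (t + 1) i) := by
  unfold nu lam
  change 1 / ((count S (t + 1) i : ℝ) / _ * N) = _
  rw [div_mul_eq_mul_div, one_div_div, mul_comm (N : ℝ)]

/-- The j-th participation contributes 1/j. Large debiasing factors require small counts, which each
client has only a few times. -/
theorem sum_inv_count_eq_harmonic (S : ℕ → Batch N B) (t : ℕ) (i : Fin N) :
    (∑ s ∈ Finset.range t, if i ∈ clients (S s) then ((count S (s + 1) i : ℝ))⁻¹ else 0) =
      (harmonic (count S t i) : ℝ) := by
  induction t with
  | zero => simp [count]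
  | succ t ih =>
    rw [Finset.sum_range_succ, ih, count_succ]
    split_ifs with h
    · rw [harmonic_succ]; push_cast; rfl
    · simp

/-- The debiasing factors cannot be large in too many rounds. -/
theorem sum_nuSum_le (S : ℕ → Batch N B) (t : ℕ) :
    ∑ s ∈ Finset.range t, nuSum S s ≤ B * t * (1 + Real.log t) := by
  rcases Nat.eq_zero_or_pos t with rfl | ht
  · simp
  have hlog : 0 ≤ Real.log t := Real.log_natCast_nonneg t
  have h1 : ∀ s ∈ Finset.range t, nuSum S s ≤ ∑ i, (t * B / N : ℝ) *
      if i ∈ clients (S s) then ((count S (s + 1) i : ℝ))⁻¹ else 0 := by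
    intro s hs
    have hst : (s : ℝ) + 1 ≤ t := by exact_mod_cast Finset.mem_range.1 hs
    unfold nuSum
    rw [← Finset.sum_filter_add_sum_filter_not Finset.univ (fun i => i ∈ clients (S s))]
    refine le_add_of_le_of_nonneg ?_ (Finset.sum_nonneg fun i _ => ?_)
    · rw [Finset.filter_univ_mem]
      refine Finset.sum_le_sum fun i hi => ?_
      rw [if_pos hi, nu_eq, div_mul_eq_div_div, ← div_eq_mul_inv]
      gcongr
    · split_ifs <;> positivity
  refine (Finset.sum_le_sum h1).trans ?_
  rw [Finset.sum_comm]
  calc _ ≤ ∑ _i : Fin N, (t * B / N : ℝ) * (1 + Real.log t) := by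
        refine Finset.sum_le_sum fun i _ => ?_
        rw [← Finset.mul_sum, sum_inv_count_eq_harmonic]
        refine mul_le_mul_of_nonneg_left ?_ (by positivity)
        refine (harmonic_le_one_add_log _).trans (add_le_add le_rfl ?_)
        rcases Nat.eq_zero_or_pos (count S t i) with h | h
        · rw [h]; simpa using hlog
        · exact Real.log_le_log (by exact_mod_cast h) (by exact_mod_cast count_le S t i)
    _ = (N / N : ℝ) * (B * t * (1 + Real.log t)) := by simp; ring
    _ ≤ 1 * (B * t * (1 + Real.log t)) := by
        gcongr
        exact div_self_le_one _
    _ = _ := one_mul _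

namespace IsSmoothFamily

/-- Growth of the optimality gap, whatever the sampled batches. -/
theorem globalObj_serverModel_sub_le [NeZero B] (h : IsSmoothFamily f L G) (hα : 0 ≤ α)
    (S : ℕ → Batch N B) (t : ℕ) :
    globalObj f (serverModel f α K x₀ S t) - globalObj f x₀ ≤
      Real.exp (2 * (α * K * L * (B * t * (1 + Real.log t)))) *
        (‖gradient (globalObj f) x₀‖ + G) ^ 2 := by
  have h1 := h.mul_norm_serverModel_sub_le (K := K) (x₀ := x₀) hα S 0 t
  simp only [zero_add] at h1
  have hL := h.L_pos
  have hG := h.G_nonneg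
  set x := serverModel f α K x₀ S t
  change L * ‖x - x₀‖ ≤ _ * (‖gradient (globalObj f) x₀‖ + G) at h1
  set U := ‖gradient (globalObj f) x₀‖ + G
  have hU : 0 ≤ U := by positivity
  set e := Real.exp (α * K * L * (B * t * (1 + Real.log t)))
  have h2 : L * ‖x - x₀‖ ≤ (e - 1) * U := by
    refine h1.trans (mul_le_mul_of_nonneg_right (sub_le_sub_right (Real.exp_le_exp.2 ?_) 1) hU)
    exact mul_le_mul_of_nonneg_left (sum_nuSum_le S t) (by positivity)
  have h3 := le_add_inner_gradient_add (differentiable_globalObj h.differentiable) hL.le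
    h.smooth_globalObj x₀ x
  have h4 : ⟪gradient (globalObj f) x₀, x - x₀⟫ ≤ U * ‖x - x₀‖ :=
    (real_inner_le_norm _ _).trans (mul_le_mul_of_nonneg_right (by simp [U, hG]) (norm_nonneg _))
  have hn := norm_nonneg (x - x₀)
  have h5 : ‖x - x₀‖ ≤ (e - 1) * U := by nlinarith [h.one_le]
  have h6 : L * ‖x - x₀‖ ^ 2 ≤ ((e - 1) * U) ^ 2 := by nlinarith
  have he : 0 ≤ e - 1 := sub_nonneg.2 (Real.one_le_exp (by
    have := Real.log_natCast_nonneg t; positivity))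
  have h7 : U * ‖x - x₀‖ ≤ U * ((e - 1) * U) := mul_le_mul_of_nonneg_left h5 hU
  have e2 : Real.exp (2 * (α * K * L * (B * t * (1 + Real.log t)))) = e ^ 2 := by
    rw [← Real.exp_nat_mul]; norm_num
  rw [e2]
  -- Linear and quadratic terms add up to (e - 1) + (e - 1)² = e(e - 1) ≤ e², times U².
  nlinarith [mul_nonneg he (sq_nonneg U), sq_nonneg U]

/-- One round of descent, compared with the gradients `l` rounds earlier. -/
theorem globalObj_succ_le [NeZero B] (h : IsSmoothFamily f L G) (hα : 0 ≤ α)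
    {S : ℕ → Batch N B} {r l : ℕ} {νs η : ℝ} {νbar : Fin N → ℝ}
    (h1 : ∀ j ≤ l, ∀ i ∈ clients (S (r + j)), nu S (r + j) i ≤ νs)
    (h2 : ∀ i ∈ clients (S (r + l)), |nu S (r + l) i - νbar i| ≤ η)
    {z : ℝ} (hz : α * K * L * (B * νs * (l + 1)) = z) (hz1 : z ≤ 1) :
    globalObj f (serverModel f α K x₀ S (r + l + 1)) ≤
      globalObj f (serverModel f α K x₀ S (r + l))
      - α * K * (1 / B * ∑ i ∈ clients (S (r + l)), νbar i *
          ⟪gradient (globalObj f) (serverModel f α K x₀ S r),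
            gradient (f i) (serverModel f α K x₀ S r)⟫)
      + 17 * (α * K * νs * z) * (‖gradient (globalObj f) (serverModel f α K x₀ S r)‖ + G) ^ 2
      + α * K * η * (‖gradient (globalObj f) (serverModel f α K x₀ S r)‖ *
          (‖gradient (globalObj f) (serverModel f α K x₀ S r)‖ + G)) := by
  have hL := h.L_pos
  have hG := h.G_nonneg
  have hB1 : (1 : ℝ) ≤ B := by exact_mod_cast NeZero.pos B
  obtain ⟨i₀, hi₀⟩ : (clients (S (r + l))).Nonempty := by
    rw [← Finset.card_pos, card_clients]; exact NeZero.pos B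
  have hνs : 0 ≤ νs := (nu_nonneg S _ _).trans (h1 l le_rfl i₀ hi₀)
  have hη : 0 ≤ η := (abs_nonneg _).trans (h2 i₀ hi₀)
  have hz0 : 0 ≤ z := by rw [← hz]; positivity
  set x := serverModel f α K x₀ S r with hx
  set y := serverModel f α K x₀ S (r + l) with hy
  set a := gradient (globalObj f) x with ha
  set U := ‖a‖ + G with hU
  have hU0 : 0 ≤ U := by positivity
  have haU : ‖a‖ ≤ U := by simp [hU, hG]
  set A : ℝ := α * K * L * ∑ j ∈ Finset.range l, nuSum S (r + j) with hA
  have hsum : ∑ j ∈ Finset.range l, nuSum S (r + j) ≤ l * (B * νs) := by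
    calc _ ≤ ∑ j ∈ Finset.range l, (B * νs : ℝ) := by
          refine Finset.sum_le_sum fun j hj => ?_
          calc nuSum S (r + j) ≤ ∑ i ∈ clients (S (r + j)), νs :=
                Finset.sum_le_sum fun i hi => h1 j (Finset.mem_range.1 hj).le i hi
            _ = _ := by rw [Finset.sum_const, card_clients, nsmul_eq_mul]
      _ = _ := by simp
  have hyx : L * ‖y - x‖ ≤ (Real.exp A - 1) * U := h.mul_norm_serverModel_sub_le hα S r l
  have hexp : ∀ w, 0 ≤ w → w ≤ z → Real.exp w - 1 ≤ 2 * z := by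
    intro w hw0 hwz
    have := (abs_le.1 (Real.abs_exp_sub_one_le (x := w)
      (by rw [abs_of_nonneg hw0]; linarith))).2
    rw [abs_of_nonneg hw0] at this
    linarith
  have hA0 : 0 ≤ A := by
    have := Finset.sum_nonneg fun j (_ : j ∈ Finset.range l) => nuSum_nonneg S (r + j)
    positivity
  -- The factor l + 1 in z pays for the l rounds from r on and for the local steps of round r + l.
  have hAz : A + α * K * L * νs ≤ z := by
    rw [← hz, hA]
    have : ∑ j ∈ Finset.range l, nuSum S (r + j) + νs ≤ B * νs * (l + 1) := by nlinarith
    calc _ = α * K * L * (∑ j ∈ Finset.range l, nuSum S (r + j) + νs) := by ring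
      _ ≤ _ := mul_le_mul_of_nonneg_left this (by positivity)
  have hyx2 : L * ‖y - x‖ ≤ 2 * z * U := hyx.trans
    (mul_le_mul_of_nonneg_right (hexp A hA0 (by linarith [show 0 ≤ α * K * L * νs by positivity])) hU0)
  have hloc : ∀ i ∈ clients (S (r + l)), ∀ k ≤ K,
      L * ‖localModel (f i) (α * nu S (r + l) i) y k - x‖ ≤ 2 * z * U := by
    intro i hi k hk
    have hν0 := nu_nonneg S (r + l) i
    have b1 := mul_norm_localModel_sub_le (mul_nonneg hα hν0) hL.le (h.smooth i)
      (h.norm_gradient_le i y) k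
    have b2 := h.bound_le x y
    set yk := localModel (f i) (α * nu S (r + l) i) y k
    have hk' : (k : ℝ) ≤ K := by exact_mod_cast hk
    set D : ℝ := k * (α * nu S (r + l) i) * L with hD
    have hD0 : 0 ≤ D := by positivity
    have hDz : D ≤ α * K * L * νs := by
      rw [hD]
      calc (k : ℝ) * (α * nu S (r + l) i) * L ≤ K * (α * νs) * L := by
            gcongr
            exact h1 l le_rfl i hi
        _ = _ := by ring
    have hD1 : 0 ≤ Real.exp D - 1 := sub_nonneg.2 (Real.one_le_exp hD0)
    have b3 : L * ‖yk - x‖ ≤ L * ‖yk - y‖ + L * ‖y - x‖ := by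
      rw [← mul_add]
      exact mul_le_mul_of_nonneg_left (norm_sub_le_norm_sub_add_norm_sub _ y x) hL.le
    have b4 : L * ‖yk - x‖ ≤ (Real.exp (A + D) - 1) * U := by
      rw [Real.exp_add]
      nlinarith [mul_le_mul_of_nonneg_left hyx hD1, mul_le_mul_of_nonneg_left b2 hD1]
    exact b4.trans (mul_le_mul_of_nonneg_right (hexp _ (by linarith) (by linarith)) hU0)
  have hdxi : ∀ i, localModel (f i) (α * nu S (r + l) i) y K - y =
      -((α * nu S (r + l) i) • ∑ k ∈ Finset.range K,
        gradient (f i) (localModel (f i) (α * nu S (r + l) i) y k)) := by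
    intro i
    rw [localModel_eq]; abel
  have hgrad : ∀ i ∈ clients (S (r + l)), ∀ k ∈ Finset.range K,
      ‖gradient (f i) (localModel (f i) (α * nu S (r + l) i) y k) - gradient (f i) x‖ ≤
        2 * z * U := fun i hi k hk =>
    (h.smooth i _ _).trans (hloc i hi k (Finset.mem_range.1 hk).le)
  set dx := serverModel f α K x₀ S (r + l + 1) - y with hdx
  have hdxe := serverModel_succ_sub (f := f) (α := α) (K := K) (x₀ := x₀) S (r + l)
  have hdxn : ‖dx‖ ≤ 3 * (α * K * νs) * U := by
    rw [hdx, hy, hdxe]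
    refine norm_average_le fun i hi => ?_
    rw [← hy, hdxi, norm_neg, norm_smul, Real.norm_of_nonneg (mul_nonneg hα (nu_nonneg S _ _))]
    have : ‖∑ k ∈ Finset.range K,
        gradient (f i) (localModel (f i) (α * nu S (r + l) i) y k)‖ ≤ K * (3 * U) := by
      calc _ ≤ ∑ k ∈ Finset.range K, 3 * U := by
            refine norm_sum_le_of_le _ fun k hk => ?_
            have c1 := norm_le_norm_add_norm_sub'
              (gradient (f i) (localModel (f i) (α * nu S (r + l) i) y k)) (gradient (f i) x)
            have c2 := h.norm_gradient_le i x
            have c3 := hgrad i hi k hk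
            have c4 : z * U ≤ 1 * U := mul_le_mul_of_nonneg_right hz1 hU0
            linarith
        _ = _ := by simp
    calc _ ≤ α * νs * (K * (3 * U)) := by
          gcongr
          exact h1 l le_rfl i hi
      _ = _ := by ring
  set b := (1 / (B : ℝ)) • ∑ i ∈ clients (S (r + l)), νbar i • gradient (f i) x with hb
  -- Distance of the true update to the ideal one, which uses the gradients at x and the weights
  -- νbar: drift gives 2νs z, inexact weights give η.
  have hρ : ‖dx + (α * K) • b‖ ≤ α * K * (2 * νs * z + η) * U := by
    have e : dx + (α * K) • b = (1 / (B : ℝ)) • ∑ i ∈ clients (S (r + l)),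
        ((localModel (f i) (α * nu S (r + l) i) y K - y) +
          (α * K) • (νbar i • gradient (f i) x)) := by
      rw [hdx, hy, hdxe, hb, Finset.sum_add_distrib, smul_add, smul_comm, Finset.smul_sum (r := α * K)]
    rw [e]
    refine norm_average_le fun i hi => ?_
    have e2 : (localModel (f i) (α * nu S (r + l) i) y K - y) +
        (α * K) • (νbar i • gradient (f i) x) = -(α • ∑ k ∈ Finset.range K,
          (nu S (r + l) i • (gradient (f i) (localModel (f i) (α * nu S (r + l) i) y k) -
            gradient (f i) x) + (nu S (r + l) i - νbar i) • gradient (f i) x)) := by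
      rw [hdxi, Finset.sum_add_distrib, ← Finset.smul_sum, Finset.sum_sub_distrib, Finset.sum_const,
        Finset.sum_const, Finset.card_range, ← Nat.cast_smul_eq_nsmul ℝ K,
        ← Nat.cast_smul_eq_nsmul ℝ K]
      module
    rw [e2, norm_neg, norm_smul, Real.norm_of_nonneg hα]
    calc _ ≤ α * ∑ k ∈ Finset.range K, ((2 * νs * z + η) * U) := by
          refine mul_le_mul_of_nonneg_left (norm_sum_le_of_le _ fun k hk => ?_) hα
          refine (norm_add_le _ _).trans ?_
          rw [norm_smul, norm_smul, Real.norm_of_nonneg (nu_nonneg S _ _), Real.norm_eq_abs]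
          have c1 := mul_le_mul (h1 l le_rfl i hi) (hgrad i hi k hk) (norm_nonneg _) hνs
          have c2 := mul_le_mul (h2 i hi) (h.norm_gradient_le i x) (norm_nonneg _) hη
          linarith
      _ = _ := by simp; ring
  have hdesc := le_add_inner_gradient_add (differentiable_globalObj h.differentiable) hL.le
    h.smooth_globalObj y (serverModel f α K x₀ S (r + l + 1))
  rw [← hdx] at hdesc
  have t1 : ⟪gradient (globalObj f) y - a, dx⟫ ≤ 2 * z * U * (3 * (α * K * νs) * U) :=
    (real_inner_le_norm _ _).trans (mul_le_mul ((h.smooth_globalObj y x).trans hyx2) hdxn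
      (norm_nonneg _) (by positivity))
  have t2 : ⟪a, dx + (α * K) • b⟫ ≤ ‖a‖ * (α * K * (2 * νs * z + η) * U) :=
    (real_inner_le_norm _ _).trans (mul_le_mul_of_nonneg_left hρ (norm_nonneg _))
  rw [inner_sub_left] at t1
  rw [inner_add_right, real_inner_smul_right] at t2
  have t3 : ⟪a, b⟫ = 1 / B * ∑ i ∈ clients (S (r + l)), νbar i * ⟪a, gradient (f i) x⟫ := by
    rw [hb, real_inner_smul_right, inner_sum]
    simp only [real_inner_smul_right]
  rw [← t3]
  have hw : 0 ≤ α * K * νs * U := by positivity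
  have t4 : L * ‖dx‖ ^ 2 ≤ 9 * (α * K * νs * z) * U ^ 2 := by
    have c1 : L * (α * K * νs) ≤ z := by
      have : α * K * L * νs ≤ z := by linarith
      linarith
    calc L * ‖dx‖ ^ 2 ≤ L * (3 * (α * K * νs) * U) ^ 2 := by gcongr
      _ = 9 * (L * (α * K * νs)) * ((α * K * νs) * U ^ 2) := by ring
      _ ≤ 9 * z * ((α * K * νs) * U ^ 2) := by gcongr
      _ = _ := by ring
  have t5 : ‖a‖ * (α * K * (2 * νs * z) * U) ≤ U * (α * K * (2 * νs * z) * U) :=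
    mul_le_mul_of_nonneg_right haU (by positivity)
  -- 17 = 6 + 2 + 9, from `t1`, `t5` and `t4`.
  nlinarith

end IsSmoothFamily

end Optimization

end DebiasedFedAvg

namespace DebiasedFedAvg

open scoped RealInnerProductSpace

/-! ### Descent in expectation while the counts are accurate -/

section ExpectedDescent

variable {N B d : ℕ}

theorem deviation_eq (β : Fin N → ℝ) (r : ℕ) (i : Fin N) (S : ℕ → Batch N B) :
    deviation β r i S = count S r i - r * β i := by
  induction r with
  | zero => simp [deviation, count]
  | succ r ih =>
    have : deviation β (r + 1) i S = deviation β r i S + (part i (S r) - β i) := by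
      unfold deviation; rw [Finset.sum_range_succ]
    rw [this, ih, count_succ]
    unfold part
    push_cast
    split_ifs <;> ring

theorem abs_deviation_add_le {β : Fin N → ℝ} (h0 : ∀ i, 0 ≤ β i) (h1 : ∀ i, β i ≤ 1) (r n : ℕ)
    (i : Fin N) (S : ℕ → Batch N B) :
    |deviation β (r + n) i S| ≤ |deviation β r i S| + n := by
  have : deviation β (r + n) i S =
      deviation β r i S + ∑ s ∈ Finset.range n, (part i (S (r + s)) - β i) := by
    unfold deviation; rw [Finset.sum_range_add]
  rw [this]
  exact (abs_add_le _ _).trans (add_le_add le_rfl (abs_sum_range_part_le h0 h1 i n r S))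

/-- The debiasing factors are accurate shortly after a round with accurate counts. -/
theorem nu_bounds [NeZero B] {β : Fin N → ℝ} {bmin : ℝ} (hb : 0 < bmin) (hβ : ∀ i, bmin ≤ β i)
    (hβ1 : ∀ i, β i ≤ 1) {S : ℕ → Batch N B} {r l j : ℕ} {ε : ℝ} (hε : 4 * ε ≤ bmin)
    (hl : (l : ℝ) + 1 ≤ ε * r) (hj : j ≤ l) (hr : 0 < r) {i : Fin N}
    (hgood : |deviation β r i S| ≤ ε * r) :
    nu S (r + j) i ≤ 2 * B / (N * bmin) ∧
      |nu S (r + j) i - B / (N * β i)| ≤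
        2 * B / (N * bmin ^ 2) * ((|deviation β r i S| + (l + 1)) / r) := by
  have hN : (0 : ℝ) < N := Nat.cast_pos.2 (Fin.pos i)
  have hB : (0 : ℝ) < B := Nat.cast_pos.2 (NeZero.pos B)
  have hr' : (0 : ℝ) < r := Nat.cast_pos.2 hr
  have hjl : (j : ℝ) ≤ l := by exact_mod_cast hj
  have hj0 : (0 : ℝ) ≤ j := Nat.cast_nonneg j
  have hβi := hβ i
  have hβ0 : 0 < β i := by linarith
  have h0 : ∀ i, 0 ≤ β i := fun i => by linarith [hβ i]
  have hd := abs_deviation_add_le h0 hβ1 r (j + 1) i S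
  rw [deviation_eq β (r + (j + 1))] at hd
  rw [nu_eq, ← add_assoc] at *
  set c : ℝ := Nat.cast (count S (r + j + 1) i)
  set D := |deviation β r i S|
  set t : ℝ := (r : ℝ) + j + 1 with ht
  push_cast at hd
  rw [← add_assoc, ← ht] at hd
  have htr : (r : ℝ) ≤ t := by linarith
  have hd2 : |c - t * β i| ≤ D + (l + 1) := by linarith
  -- D and l + 1 are each at most εr, and 2εr ≤ bmin r/2. The count is thus at least half its mean,
  -- which bounds ν.
  have hd3 : |c - t * β i| ≤ t * β i / 2 := by
    have : 2 * ε * r ≤ t * β i / 2 := by nlinarith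
    linarith
  have hc : t * β i / 2 ≤ c := by linarith [(abs_le.1 hd3).1]
  have ht0 : 0 < t := by linarith
  have hc0 : 0 < c := lt_of_lt_of_le (by positivity) hc
  have e1 : (((r + j : ℕ) : ℝ) + 1) = t := by push_cast; rfl
  rw [e1]
  constructor
  · rw [div_le_div_iff₀ (by positivity) (by positivity)]
    have : t * bmin ≤ 2 * c := by nlinarith
    nlinarith [mul_pos hB hN, mul_le_mul_of_nonneg_left this (mul_pos hB hN).le]
  · have e2 : t * B / (N * c) - B / (N * β i) = -(B / N * ((c - t * β i) / (c * β i))) := by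
      field_simp; ring
    rw [e2, abs_neg, abs_mul, abs_div (c - t * β i), abs_of_pos (show (0 : ℝ) < B / N by positivity),
      abs_of_pos (show 0 < c * β i by positivity)]
    have h2 : r * bmin ^ 2 / 2 ≤ c * β i := by
      calc r * bmin ^ 2 / 2 = r * bmin / 2 * bmin := by ring
        _ ≤ t * β i / 2 * β i := by gcongr
        _ ≤ c * β i := by gcongr
    calc B / N * (|c - t * β i| / (c * β i)) ≤ B / N * ((D + l + 1) / (r * bmin ^ 2 / 2)) := by
          gcongr
          linarith
      _ = _ := by field_simp

variable {f : Fin N → EuclideanSpace ℝ (Fin d) → ℝ} {L G : ℝ}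
variable {α : ℝ} {K : ℕ} {x₀ : EuclideanSpace ℝ (Fin d)}

theorem dependsOn_serverModel (t : ℕ) :
    DependsOn (fun S : ℕ → Batch N B => serverModel f α K x₀ S t) (Set.Iio t) := by
  induction t with
  | zero => intro S S' _; rfl
  | succ t ih =>
    intro S S' h
    have e1 : serverModel f α K x₀ S t = serverModel f α K x₀ S' t :=
      ih fun s hs => h s (Set.mem_Iio.2 (Nat.lt_succ_of_lt hs))
    have e2 : S t = S' t := h t (Set.mem_Iio.2 (Nat.lt_succ_self t))
    have e3 : ∀ i, nu S t i = nu S' t i := by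
      intro i
      have : participationCount S t i = participationCount S' t i := by
        unfold participationCount
        congr 1
        refine Finset.filter_congr fun s hs => ?_
        rw [h s (Set.mem_Iio.2 (Finset.mem_range.1 hs))]
      unfold nu lam
      rw [this]
    simp only [serverModel, e1, e2, e3]

open Classical in
/-- Indicator that all participation counts before round `r` are accurate up to `ε r`. -/
noncomputable def accurate (β : Fin N → ℝ) (ε : ℝ) (r : ℕ) (S : ℕ → Batch N B) : ℝ :=
  if ∀ i, |deviation β r i S| ≤ ε * r then 1 else 0

theorem dependsOn_accurate (β : Fin N → ℝ) (ε : ℝ) (r : ℕ) :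
    DependsOn (fun S : ℕ → Batch N B => accurate β ε r S) (Set.Iio r) := fun S S' h => by
  have : ∀ i, deviation β r i S = deviation β r i S' := fun i => dependsOn_deviation β r i h
  simp only [accurate, this]

theorem accurate_nonneg (β : Fin N → ℝ) (ε : ℝ) (r : ℕ) (S : ℕ → Batch N B) :
    0 ≤ accurate β ε r S := by
  unfold accurate; split_ifs <;> norm_num

theorem accurate_le_one (β : Fin N → ℝ) (ε : ℝ) (r : ℕ) (S : ℕ → Batch N B) :
    accurate β ε r S ≤ 1 := by
  unfold accurate; split_ifs <;> norm_num

variable {u₀ g H : ℕ} {β : Fin N → ℝ} {δ : ℝ} {E : ((ℕ → Batch N B) → ℝ) →ₗ[ℝ] ℝ}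

theorem IsMixingExpectation.inaccurate_le (hE : IsMixingExpectation u₀ g H β δ E)
    (h0 : ∀ i, 0 ≤ β i) (h1 : ∀ i, β i ≤ 1) {l : ℕ} (hgl : g + 1 ≤ l) (hul : u₀ ≤ l)
    {ε : ℝ} (hε : 0 < ε) (hε1 : ε ≤ 1) (hδ0 : 0 ≤ δ) (hδ : δ ≤ ε / 8) {r : ℕ}
    (hr : 6 * (l : ℝ) ≤ ε * r) (hrH : r ≤ H) :
    E (fun S : ℕ → Batch N B => 1 - accurate β ε r S) ≤ 2 * N * Real.exp (-(ε ^ 2 / 32) * (r / l)) := by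
  classical
  have hpt : ∀ S : ℕ → Batch N B, 1 - accurate β ε r S ≤
      ∑ i, if ε * r < |deviation β r i S| then (1 : ℝ) else 0 := by
    intro S
    have hnn : ∀ i, (0 : ℝ) ≤ if ε * r < |deviation β r i S| then (1 : ℝ) else 0 := fun i => by
      split_ifs <;> norm_num
    unfold accurate
    split_ifs with h
    · rw [sub_self]
      exact Finset.sum_nonneg fun i _ => hnn i
    · push Not at h
      obtain ⟨i, hi⟩ := h
      rw [sub_zero]
      refine le_trans ?_ (Finset.single_le_sum (fun i _ => hnn i) (Finset.mem_univ i))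
      rw [if_pos hi]
  have h2 := hE.mono _ _ hpt
  rw [expect_sum] at h2
  refine h2.trans ((Finset.sum_le_sum fun i _ =>
    hE.tail_le h0 h1 hgl hul hε hε1 hδ0 hδ i hr hrH).trans (le_of_eq ?_))
  simp; ring

/-- The A² terms amount to at most A²/2, half of the available descent. Young's inequality on ηAG
makes the noise enter as η², so a second moment of the counts is enough. -/
theorem quadratic_remainder_le {A G w η : ℝ} (hw0 : 0 ≤ w)
    (hw1 : w ≤ 1 / 8) (hη1 : η ≤ 1 / 8) :
    w * (A + G) ^ 2 + η * (A * (A + G)) ≤ 1 / 2 * A ^ 2 + G ^ 2 * (2 * w + 2 * η ^ 2) := by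
  have c3 : (A + G) ^ 2 ≤ 2 * A ^ 2 + 2 * G ^ 2 := by nlinarith [sq_nonneg (A - G)]
  have c4 : w * (A + G) ^ 2 ≤ w * (2 * A ^ 2 + 2 * G ^ 2) := mul_le_mul_of_nonneg_left c3 hw0
  have c5 : w * A ^ 2 ≤ 1 / 8 * A ^ 2 := mul_le_mul_of_nonneg_right hw1 (sq_nonneg _)
  have c6 : η * A ^ 2 ≤ 1 / 8 * A ^ 2 := mul_le_mul_of_nonneg_right hη1 (sq_nonneg _)
  have c7 : η * (A * G) ≤ 1 / 8 * A ^ 2 + 2 * η ^ 2 * G ^ 2 := by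
    nlinarith [sq_nonneg (A - 4 * η * G)]
  linarith

set_option maxHeartbeats 1000000 in
/-- Descent in expectation, on the event that the counts were accurate `l` rounds ago. -/
theorem IsMixingExpectation.accurate_descent [NeZero B] (hE : IsMixingExpectation u₀ g H β δ E)
    (h : IsSmoothFamily f L G) (hα : 0 ≤ α) {bmin : ℝ} (hN : 0 < N) (hb : 0 < bmin)
    (hβ : ∀ i, bmin ≤ β i)
    (hβ1 : ∀ i, β i ≤ 1) {l : ℕ} (hgl : g + 1 ≤ l) (hul : u₀ ≤ l) (hδ0 : 0 ≤ δ) {ε : ℝ}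
    (hε : 4 * ε ≤ bmin) {νs κ z : ℝ} (hνs : νs = 2 * B / (N * bmin))
    (hκ : κ = 2 * B / (N * bmin ^ 2)) (hεκ : κ * ((N + 1) * ε) ≤ 1 / 8)
    (hz : α * K * L * (B * νs * (l + 1)) = z) (hz1 : z ≤ 1) (hzν : 17 * νs * z ≤ 1 / 16)
    (hδν : N * νs * δ ≤ 1 / 16) {r : ℕ} (hδr : δ * r ≤ 1) (hr : 2 * l ≤ r)
    (hlr : (l : ℝ) + 1 ≤ ε * r) (hrH : r + l ≤ H) :
    E (fun S => accurate β ε r S * globalObj f (serverModel f α K x₀ S (r + l + 1))) ≤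
      E (fun S => accurate β ε r S * globalObj f (serverModel f α K x₀ S (r + l)))
      - α * K / 2 * E (fun S => accurate β ε r S *
          ‖gradient (globalObj f) (serverModel f α K x₀ S r)‖ ^ 2)
      + α * K * G ^ 2 * (34 * νs * z + 2 * (N * νs * δ) + 416 * (κ * N) ^ 2 * (l / r)) := by
  have hl0 : 0 < l := by omega
  have hl1 : (1 : ℝ) ≤ l := by exact_mod_cast hl0
  have hr0 : 0 < r := by omega
  have hr' : (0 : ℝ) < r := by exact_mod_cast hr0
  have hlr2 : 2 * (l : ℝ) ≤ r := by exact_mod_cast hr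
  have hN' : (0 : ℝ) < N := by exact_mod_cast hN
  have hN1 : (1 : ℝ) ≤ N := by exact_mod_cast hN
  have hB1 : (1 : ℝ) ≤ B := by exact_mod_cast NeZero.pos B
  have hG := h.G_nonneg
  have hL := h.L_pos
  have hβ0 : ∀ i, 0 ≤ β i := fun i => by linarith [hβ i]
  have hνs0 : 0 ≤ νs := by rw [hνs]; positivity
  have hκ0 : 0 ≤ κ := by rw [hκ]; positivity
  have hz0 : 0 ≤ z := by rw [← hz]; positivity
  have hh : 0 ≤ α * K := by positivity
  set Γ : (ℕ → Batch N B) → ℝ := fun S => accurate β ε r S with hΓ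
  set a : (ℕ → Batch N B) → EuclideanSpace ℝ (Fin d) :=
    fun S => gradient (globalObj f) (serverModel f α K x₀ S r) with ha
  set q : Fin N → (ℕ → Batch N B) → ℝ :=
    fun i S => ⟪a S, gradient (f i) (serverModel f α K x₀ S r)⟫ with hq
  set Φ : Fin N → (ℕ → Batch N B) → ℝ :=
    fun i S => α * K / B * (B / (N * β i)) * (Γ S * q i S) with hΦ
  set D : (ℕ → Batch N B) → ℝ := fun S => ∑ i, |deviation β r i S| with hD
  set η : (ℕ → Batch N B) → ℝ := fun S => κ * ((D S + (l + 1)) / r) with hη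
  have hΓ0 : ∀ S, 0 ≤ Γ S := accurate_nonneg β ε r
  have hΓ1 : ∀ S, Γ S ≤ 1 := accurate_le_one β ε r
  have hνbar : ∀ i, (B : ℝ) / (N * β i) ≤ νs := by
    intro i
    have := hβ i
    rw [hνs]
    calc (B : ℝ) / (N * β i) ≤ B / (N * bmin) := by gcongr
      _ ≤ 2 * B / (N * bmin) := by gcongr; linarith
  have hpt : ∀ S, Γ S * globalObj f (serverModel f α K x₀ S (r + l + 1)) ≤
      Γ S * globalObj f (serverModel f α K x₀ S (r + l)) - α * K * (Γ S * ‖a S‖ ^ 2)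
      - (∑ i, Φ i S * (part i (S (r + l)) - β i))
      + (17 * (α * K * νs * z) * (Γ S * (‖a S‖ + G) ^ 2)
        + α * K * (Γ S * (η S * (‖a S‖ * (‖a S‖ + G))))) := by
    intro S
    by_cases hgood : ∀ i, |deviation β r i S| ≤ ε * r
    · have hΓS : Γ S = 1 := by simp only [hΓ, accurate]; rw [if_pos hgood]
      have hstep := h.globalObj_succ_le (x₀ := x₀) (K := K) hα (S := S) (r := r) (l := l) (νs := νs)
        (η := η S) (νbar := fun i => B / (N * β i))
        (fun j hj i _ => by
          rw [hνs]; exact (nu_bounds hb hβ hβ1 hε hlr hj hr0 (hgood i)).1)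
        (fun i _ => by
          refine (nu_bounds hb hβ hβ1 hε hlr le_rfl hr0 (hgood i)).2.trans ?_
          rw [← hκ]
          have : |deviation β r i S| ≤ D S := Finset.single_le_sum
            (f := fun i => |deviation β r i S|) (fun i _ => abs_nonneg _) (Finset.mem_univ i)
          simp only [hη]
          gcongr) hz hz1
      have e1 : ∑ i ∈ clients (S (r + l)), (B : ℝ) / (N * β i) * q i S =
          ∑ i, B / (N * β i) * q i S * part i (S (r + l)) := by
        unfold part
        simp only [mul_ite, mul_one, mul_zero]
        rw [Finset.sum_ite_mem, Finset.univ_inter]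
      have e2 : ∑ i, 1 / (N : ℝ) * q i S = ‖a S‖ ^ 2 := by
        have hgr := congrArg (fun v => ⟪a S, v⟫)
          (gradient_globalObj h.differentiable (serverModel f α K x₀ S r))
        simp only [real_inner_smul_right, inner_sum] at hgr
        rw [← Finset.mul_sum, ← real_inner_self_eq_norm_sq]
        exact hgr.symm
      -- Here the bias cancels: the weight B/(Nβ_i) times the mean β_i, divided by B, is 1/N. The
      -- fluctuation of the indicators is left in Φ.
      have e3 : α * K * (1 / B * ∑ i ∈ clients (S (r + l)), (B : ℝ) / (N * β i) * q i S) =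
          α * K * (Γ S * ‖a S‖ ^ 2) + ∑ i, Φ i S * (part i (S (r + l)) - β i) := by
        rw [e1, ← e2, hΓS, one_mul, Finset.mul_sum, Finset.mul_sum, Finset.mul_sum,
          ← Finset.sum_add_distrib]
        refine Finset.sum_congr rfl fun i _ => ?_
        simp only [hΦ, hΓS]
        have hi : 0 < β i := by linarith [hβ i]
        field_simp
        ring
      have e4 : α * K * (1 / B * ∑ i ∈ clients (S (r + l)), (B : ℝ) / (N * β i) *
          ⟪gradient (globalObj f) (serverModel f α K x₀ S r),
            gradient (f i) (serverModel f α K x₀ S r)⟫) =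
          α * K * (Γ S * ‖a S‖ ^ 2) + ∑ i, Φ i S * (part i (S (r + l)) - β i) := e3
      rw [e4] at hstep
      rw [hΓS] at hstep ⊢
      simp only [ha]
      simp only [ha] at hstep
      linarith
    · have hΓS : Γ S = 0 := by simp only [hΓ, accurate]; rw [if_neg hgood]
      simp only [hΦ, hΓS]
      simp
  -- Φ i is determined before round r and the batch is drawn at round r + l ≥ r + g, so the
  -- fluctuation has mean of size δ only.
  have hmix : ∀ i, -(E fun S => Φ i S * (part i (S (r + l)) - β i)) ≤
      δ * (α * K * νs * E (fun S => Γ S * (‖a S‖ + G) ^ 2)) := by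
    intro i
    have hdep : DependsOn (Φ i) (Set.Iio r) := by
      intro S S' hS
      have e1 : serverModel f α K x₀ S r = serverModel f α K x₀ S' r := dependsOn_serverModel r hS
      have e2 : Γ S = Γ S' := dependsOn_accurate β ε r hS
      simp only [hΦ, hq, ha, e1, e2]
    refine (neg_le_abs _).trans ((hE.mix i r (r + l) (Φ i) (by omega) (by omega) hrH hdep).trans ?_)
    refine mul_le_mul_of_nonneg_left ?_ hδ0
    rw [← expect_const_mul]
    refine hE.mono _ _ fun S => ?_
    have hi : 0 < β i := by linarith [hβ i]
    have c1 : |q i S| ≤ (‖a S‖ + G) ^ 2 := by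
      refine (abs_real_inner_le_norm _ _).trans ?_
      rw [sq]
      exact mul_le_mul (by linarith) (h.norm_gradient_le i _) (norm_nonneg _) (by positivity)
    simp only [hΦ]
    rw [abs_mul, abs_mul (Γ S), abs_of_nonneg (hΓ0 S), abs_of_nonneg (by positivity)]
    calc _ ≤ α * K / 1 * νs * (Γ S * (‖a S‖ + G) ^ 2) := by
          have := hΓ0 S
          have := hνbar i
          gcongr
      _ = _ := by ring
  -- Drift and mixing errors together play the role of w in `quadratic_remainder_le`.
  have hrest : ∀ S, Γ S * ((17 * νs * z + N * νs * δ) * (‖a S‖ + G) ^ 2) +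
      Γ S * (η S * (‖a S‖ * (‖a S‖ + G))) ≤ 1 / 2 * (Γ S * ‖a S‖ ^ 2) +
        G ^ 2 * ((34 * νs * z + 2 * (N * νs * δ)) * 1 +
          4 * κ ^ 2 / r ^ 2 * (N * (∑ i, deviation β r i S ^ 2)
            + (l + 1) ^ 2 * 1)) := by
    intro S
    have hD0 : 0 ≤ D S := Finset.sum_nonneg fun i _ => abs_nonneg _
    have hη0 : 0 ≤ η S := by positivity
    have hη2 : 2 * η S ^ 2 ≤ 4 * κ ^ 2 / r ^ 2 * (N * (∑ i, deviation β r i S ^ 2)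
            + (l + 1) ^ 2 * 1) := by
      have hD2 : D S ^ 2 ≤ N * ∑ i, deviation β r i S ^ 2 := by
        have := sq_sum_le_card_mul_sum_sq (s := (Finset.univ : Finset (Fin N)))
          (f := fun i => |deviation β r i S|)
        simpa using this
      have e : 2 * η S ^ 2 = 2 * κ ^ 2 / r ^ 2 * (D S + (l + 1)) ^ 2 := by
        simp only [hη]; field_simp
      rw [e]
      have c2 : (D S + ((l : ℝ) + 1)) ^ 2 ≤ 2 * (D S ^ 2 + (l + 1) ^ 2) := by
        nlinarith [sq_nonneg (D S - (l + 1))]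
      calc _ ≤ 2 * κ ^ 2 / r ^ 2 * (2 * (N * (∑ i, deviation β r i S ^ 2) + (l + 1) ^ 2)) := by
            gcongr
            linarith
        _ = _ := by ring
    have hright : 0 ≤ G ^ 2 * ((34 * νs * z + 2 * (N * νs * δ)) * 1 + 2 * η S ^ 2) := by positivity
    have hmono : G ^ 2 * ((34 * νs * z + 2 * (N * νs * δ)) * 1 + 2 * η S ^ 2) ≤
        G ^ 2 * ((34 * νs * z + 2 * (N * νs * δ)) * 1 +
          4 * κ ^ 2 / r ^ 2 * (N * (∑ i, deviation β r i S ^ 2)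
            + (l + 1) ^ 2 * 1)) := by gcongr
    by_cases hgood : ∀ i, |deviation β r i S| ≤ ε * r
    · have hΓS : Γ S = 1 := by simp only [hΓ, accurate]; rw [if_pos hgood]
      have hηS : η S ≤ 1 / 8 := by
        refine le_trans ?_ hεκ
        simp only [hη]
        refine mul_le_mul_of_nonneg_left ?_ hκ0
        rw [div_le_iff₀ hr']
        have : D S ≤ ∑ _i : Fin N, ε * r := Finset.sum_le_sum fun i _ => hgood i
        simp at this
        linarith
      rw [hΓS]
      refine le_trans ?_ (add_le_add le_rfl hmono)
      have hw := quadratic_remainder_le (A := ‖a S‖) (G := G)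
        (show 0 ≤ 17 * νs * z + N * νs * δ by positivity) (by linarith) hηS
      linarith
    · have hΓS : Γ S = 0 := by simp only [hΓ, accurate]; rw [if_neg hgood]
      rw [hΓS]
      simp only [zero_mul, mul_zero, add_zero, zero_add]
      exact hright.trans hmono
  have h2 := hE.mono _ _ hpt
  rw [expect_add, expect_sub, expect_sub, expect_const_mul, expect_sum, expect_add,
    expect_const_mul, expect_const_mul] at h2
  have h3 := hE.mono _ _ hrest
  rw [expect_add, expect_add, expect_const_mul, expect_const_mul, expect_add, expect_const_mul,
    expect_const_mul, expect_add, expect_const_mul, expect_const_mul, expect_sum, hE.one] at h3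
  have e5 : (fun S => Γ S * ((17 * νs * z + N * νs * δ) * (‖a S‖ + G) ^ 2)) =
      fun S => (17 * νs * z + N * νs * δ) * (Γ S * (‖a S‖ + G) ^ 2) := by
    funext S; ring
  rw [e5, expect_const_mul] at h3
  have h4 : ∑ i, E (fun S => deviation β r i S ^ 2) ≤ N * (100 * (l * r)) := by
    calc _ ≤ ∑ _i : Fin N, (100 * (l * r) : ℝ) := Finset.sum_le_sum fun i _ =>
          hE.second_moment_le hβ0 hβ1 hgl hul hδ0 i hδr hr (by omega)
      _ = _ := by simp
  have h5 : 4 * κ ^ 2 / r ^ 2 * (N * (∑ i, E fun S => deviation β r i S ^ 2) + (l + 1) ^ 2 * 1) ≤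
      416 * (κ * N) ^ 2 * (l / r) := by
    have c1 : ((l : ℝ) + 1) ^ 2 * 1 ≤ 2 * (l * r) := by nlinarith
    have c2 : (1 : ℝ) ≤ N ^ 2 := by nlinarith
    have hlr0 : (0 : ℝ) < l * r := by positivity
    have c3 : N * (∑ i, E fun S => deviation β r i S ^ 2) + ((l : ℝ) + 1) ^ 2 * 1 ≤
        104 * N ^ 2 * (l * r) := by
      have := mul_le_mul_of_nonneg_left h4 hN'.le
      nlinarith
    calc _ ≤ 4 * κ ^ 2 / r ^ 2 * (104 * N ^ 2 * (l * r)) := by gcongr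
      _ = _ := by field_simp; ring
  have h6 : -(∑ i, E fun S => Φ i S * (part i (S (r + l)) - β i)) ≤
      N * (δ * (α * K * νs * E (fun S => Γ S * (‖a S‖ + G) ^ 2))) := by
    rw [← Finset.sum_neg_distrib]
    calc _ ≤ ∑ _i : Fin N, δ * (α * K * νs * E (fun S => Γ S * (‖a S‖ + G) ^ 2)) :=
          Finset.sum_le_sum fun i _ => hmix i
      _ = _ := by simp
  have h7 := mul_le_mul_of_nonneg_left h3 hh
  have h8 := mul_le_mul_of_nonneg_left h5 (show 0 ≤ α * K * G ^ 2 by positivity)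
  linarith

end ExpectedDescent

end DebiasedFedAvg

namespace DebiasedFedAvg

/-! ### The inaccurate event and the telescoping sum -/

section Telescoping

variable {N B d : ℕ}
variable {f : Fin N → EuclideanSpace ℝ (Fin d) → ℝ} {L G Δ : ℝ}
variable {α : ℝ} {K : ℕ} {x₀ : EuclideanSpace ℝ (Fin d)}

/-- A deterministic bound for the optimality gap after `t` rounds with effective step size `h`. -/
noncomputable def gapBound (B : ℕ) (h L Q Δ : ℝ) (t : ℕ) : ℝ :=
  Δ + Real.exp (2 * (h * L * (B * t * (1 + Real.log t)))) * Q

theorem gapBound_mono {h L Q Δ : ℝ} (hh : 0 ≤ h) (hL : 0 ≤ L) (hQ : 0 ≤ Q) {s t : ℕ} (hst : s ≤ t) :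
    gapBound B h L Q Δ s ≤ gapBound B h L Q Δ t := by
  have hst' : (s : ℝ) ≤ t := by exact_mod_cast hst
  have hls := Real.log_natCast_nonneg s
  have hlog : Real.log s ≤ Real.log t := by
    rcases Nat.eq_zero_or_pos s with rfl | hs
    · simpa using Real.log_natCast_nonneg t
    · exact Real.log_le_log (by exact_mod_cast hs) hst'
  unfold gapBound
  gcongr

/-- The optimality gap of the server model, measured from the lower bound `F x₀ - Δ`. -/
noncomputable def gap (f : Fin N → EuclideanSpace ℝ (Fin d) → ℝ) (Δ α : ℝ) (K : ℕ)
    (x₀ : EuclideanSpace ℝ (Fin d)) (t : ℕ) (S : ℕ → Batch N B) : ℝ :=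
  globalObj f (serverModel f α K x₀ S t) - globalObj f x₀ + Δ

namespace IsSmoothFamily

theorem gap_nonneg (hΔ : ∀ y, globalObj f x₀ - globalObj f y ≤ Δ) (t : ℕ) (S : ℕ → Batch N B) :
    0 ≤ gap f Δ α K x₀ t S := by
  have := hΔ (serverModel f α K x₀ S t)
  unfold gap; linarith

theorem norm_gradient_sq_le_gap (h : IsSmoothFamily f L G)
    (hΔ : ∀ y, globalObj f x₀ - globalObj f y ≤ Δ) (t : ℕ) (S : ℕ → Batch N B) :
    ‖gradient (globalObj f) (serverModel f α K x₀ S t)‖ ^ 2 ≤ 4 * L * gap f Δ α K x₀ t S := by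
  have := norm_gradient_sq_le (differentiable_globalObj h.differentiable) h.L_pos
    h.smooth_globalObj (m := globalObj f x₀ - Δ) (fun y => by linarith [hΔ y])
    (serverModel f α K x₀ S t)
  unfold gap
  linarith

/-- The initial gradient is controlled by the initial gap, ‖∇F(x₀)‖² ≤ 4LΔ; hence (‖∇F(x₀)‖ + G)² ≤
8LΔ + 2G². -/
theorem gap_le_gapBound [NeZero B] (h : IsSmoothFamily f L G) (hα : 0 ≤ α)
    (hΔ : ∀ y, globalObj f x₀ - globalObj f y ≤ Δ) (t : ℕ) (S : ℕ → Batch N B) :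
    gap f Δ α K x₀ t S ≤ gapBound B (α * K) L (8 * L * Δ + 2 * G ^ 2) Δ t := by
  have h1 := h.globalObj_serverModel_sub_le (K := K) (x₀ := x₀) hα S t
  have h2 : ‖gradient (globalObj f) x₀‖ ^ 2 ≤ 4 * L * Δ := by
    have := h.norm_gradient_sq_le_gap (α := α) (K := K) hΔ 0 S
    simpa [gap, serverModel] using this
  have h3 : (‖gradient (globalObj f) x₀‖ + G) ^ 2 ≤ 8 * L * Δ + 2 * G ^ 2 := by
    nlinarith [sq_nonneg (‖gradient (globalObj f) x₀‖ - G)]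
  unfold gap gapBound
  have := mul_le_mul_of_nonneg_left h3
    (Real.exp_pos (2 * (α * K * L * (B * t * (1 + Real.log t))))).le
  linarith

end IsSmoothFamily

variable {u₀ g H : ℕ} {β : Fin N → ℝ} {δ : ℝ} {E : ((ℕ → Batch N B) → ℝ) →ₗ[ℝ] ℝ}

/-- Descent in expectation, on the whole space. -/
theorem IsMixingExpectation.descent [NeZero B] (hE : IsMixingExpectation u₀ g H β δ E)
    (h : IsSmoothFamily f L G) (hα : 0 ≤ α) (hΔ : ∀ y, globalObj f x₀ - globalObj f y ≤ Δ)
    {bmin : ℝ} (hN : 0 < N) (hb : 0 < bmin) (hβ : ∀ i, bmin ≤ β i)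
    (hβ1 : ∀ i, β i ≤ 1) {l : ℕ} (hgl : g + 1 ≤ l) (hul : u₀ ≤ l) (hδ0 : 0 ≤ δ) {ε : ℝ}
    (hε0 : 0 < ε) (hε1 : ε ≤ 1) (hδε : δ ≤ ε / 8)
    (hε : 4 * ε ≤ bmin) {νs κ z : ℝ} (hνs : νs = 2 * B / (N * bmin))
    (hκ : κ = 2 * B / (N * bmin ^ 2)) (hεκ : κ * ((N + 1) * ε) ≤ 1 / 8)
    (hz : α * K * L * (B * νs * (l + 1)) = z) (hz1 : z ≤ 1) (hzν : 17 * νs * z ≤ 1 / 16)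
    (hδν : N * νs * δ ≤ 1 / 16) {r : ℕ} (hδr : δ * r ≤ 1)
    (hlr : 6 * (l : ℝ) ≤ ε * r) (hrH : r + l ≤ H) :
    E (gap f Δ α K x₀ (r + l + 1)) + α * K / 2 * E (fun S =>
        ‖gradient (globalObj f) (serverModel f α K x₀ S r)‖ ^ 2) ≤
      E (gap f Δ α K x₀ (r + l))
      + (α * K * G ^ 2 * (34 * νs * z + 2 * (N * νs * δ) + 416 * (κ * N) ^ 2 * (l / r))
      + (1 + 2 * (α * K) * L) * (gapBound B (α * K) L (8 * L * Δ + 2 * G ^ 2) Δ (r + l + 1) *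
        (2 * N * Real.exp (-(ε ^ 2 / 32) * (r / l))))) := by
  have hl0 : 0 < l := by omega
  have hl1 : (1 : ℝ) ≤ l := by exact_mod_cast hl0
  have hL := h.L_pos
  have hh : 0 ≤ α * K := by positivity
  have hr : 2 * l ≤ r := by
    have : (2 * l : ℝ) ≤ r := by nlinarith [(Nat.cast_nonneg r : (0 : ℝ) ≤ r)]
    exact_mod_cast this
  have hβ0 : ∀ i, 0 ≤ β i := fun i => by linarith [hβ i]
  have h1 := hE.accurate_descent h hα hN hb hβ hβ1 hgl hul hδ0 hε hνs hκ hεκ hz hz1 hzν hδν hδr hr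
    (by linarith) hrH (x₀ := x₀) (K := K)
  have hbad := hE.inaccurate_le hβ0 hβ1 hgl hul hε0 hε1 hδ0 hδε hlr (by omega)
  set Γ : (ℕ → Batch N B) → ℝ := fun S => accurate β ε r S with hΓ
  have hΓ0 : ∀ S, 0 ≤ Γ S := accurate_nonneg β ε r
  have hΓ1 : ∀ S, Γ S ≤ 1 := accurate_le_one β ε r
  set P := 2 * N * Real.exp (-(ε ^ 2 / 32) * (r / l)) with hP
  have hΔ0 : 0 ≤ Δ := by simpa using hΔ x₀
  have hQ : 0 ≤ 8 * L * Δ + 2 * G ^ 2 := by positivity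
  set W := gapBound B (α * K) L (8 * L * Δ + 2 * G ^ 2) Δ (r + l + 1) with hW
  have hW0 : 0 ≤ W := by rw [hW]; unfold gapBound; positivity
  have hWr : gapBound B (α * K) L (8 * L * Δ + 2 * G ^ 2) Δ r ≤ W :=
    gapBound_mono hh hL.le hQ (by omega)
  -- Off the accurate event the gap is replaced by its bound W, valid on every path; in `a2` the gap
  -- there is dropped, being nonnegative.
  have a1 : E (gap f Δ α K x₀ (r + l + 1)) ≤
      E (fun S => Γ S * globalObj f (serverModel f α K x₀ S (r + l + 1)))
      + (Δ - globalObj f x₀) * E Γ + W * E (fun S => 1 - Γ S) := by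
    rw [← expect_const_mul, ← expect_const_mul, ← expect_add, ← expect_add]
    refine hE.mono _ _ fun S => ?_
    have b1 := h.gap_le_gapBound (K := K) hα hΔ (r + l + 1) S
    have b2 := mul_le_mul_of_nonneg_left b1 (sub_nonneg.2 (hΓ1 S))
    rw [← hW] at b2
    unfold gap at b2 ⊢
    linarith
  have a2 : E (fun S => Γ S * globalObj f (serverModel f α K x₀ S (r + l)))
      + (Δ - globalObj f x₀) * E Γ ≤ E (gap f Δ α K x₀ (r + l)) := by
    rw [← expect_const_mul, ← expect_add]
    refine hE.mono _ _ fun S => ?_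
    have b1 := IsSmoothFamily.gap_nonneg (α := α) (K := K) hΔ (r + l) S
    have b2 := mul_nonneg (sub_nonneg.2 (hΓ1 S)) b1
    unfold gap at b2 ⊢
    linarith
  have a3 : E (fun S => ‖gradient (globalObj f) (serverModel f α K x₀ S r)‖ ^ 2) ≤
      E (fun S => Γ S * ‖gradient (globalObj f) (serverModel f α K x₀ S r)‖ ^ 2) +
        4 * L * W * E (fun S => 1 - Γ S) := by
    rw [← expect_const_mul, ← expect_add]
    refine hE.mono _ _ fun S => ?_
    have b1 := h.norm_gradient_sq_le_gap (α := α) (K := K) hΔ r S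
    have b2 := (h.gap_le_gapBound (K := K) hα hΔ r S).trans hWr
    have b3 : ‖gradient (globalObj f) (serverModel f α K x₀ S r)‖ ^ 2 ≤ 4 * L * W :=
      b1.trans (mul_le_mul_of_nonneg_left b2 (by positivity))
    have b4 := mul_le_mul_of_nonneg_left b3 (sub_nonneg.2 (hΓ1 S))
    linarith
  -- αK/2 times the gradient bound 4LW is the source of the factor 2αKL beside the 1 from `a1`.
  have a4 := mul_le_mul_of_nonneg_left a3 (show 0 ≤ α * K / 2 by positivity)
  have a5 : W * E (fun S => 1 - Γ S) ≤ W * P := mul_le_mul_of_nonneg_left hbad hW0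
  have a6 := mul_le_mul_of_nonneg_left a5 (show 0 ≤ 2 * (α * K) * L by positivity)
  linarith

/-- Summing the descent inequality over the rounds `s₀, ..., T - 1`. -/
theorem IsMixingExpectation.sum_descent [NeZero B] (hE : IsMixingExpectation u₀ g H β δ E)
    (h : IsSmoothFamily f L G) (hα : 0 ≤ α) (hΔ : ∀ y, globalObj f x₀ - globalObj f y ≤ Δ)
    {bmin : ℝ} (hN : 0 < N) (hb : 0 < bmin) (hβ : ∀ i, bmin ≤ β i)
    (hβ1 : ∀ i, β i ≤ 1) {l : ℕ} (hgl : g + 1 ≤ l) (hul : u₀ ≤ l) (hδ0 : 0 ≤ δ) {ε : ℝ}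
    (hε0 : 0 < ε) (hε1 : ε ≤ 1) (hδε : δ ≤ ε / 8)
    (hε : 4 * ε ≤ bmin) {νs κ z : ℝ} (hνs : νs = 2 * B / (N * bmin))
    (hκ : κ = 2 * B / (N * bmin ^ 2)) (hεκ : κ * ((N + 1) * ε) ≤ 1 / 8)
    (hz : α * K * L * (B * νs * (l + 1)) = z) (hz1 : z ≤ 1) (hzν : 17 * νs * z ≤ 1 / 16)
    (hδν : N * νs * δ ≤ 1 / 16) {s₀ T : ℕ} (hsT : s₀ ≤ T) (hδT : δ * T ≤ 1)
    (hls : 6 * (l : ℝ) ≤ ε * s₀) (hTH : T + l ≤ H) :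
    α * K / 2 * ∑ r ∈ Finset.Ico s₀ T, E (fun S =>
        ‖gradient (globalObj f) (serverModel f α K x₀ S r)‖ ^ 2) ≤
      gapBound B (α * K) L (8 * L * Δ + 2 * G ^ 2) Δ (s₀ + l)
      + ∑ r ∈ Finset.Ico s₀ T,
        (α * K * G ^ 2 * (34 * νs * z + 2 * (N * νs * δ) + 416 * (κ * N) ^ 2 * (l / r))
        + (1 + 2 * (α * K) * L) * (gapBound B (α * K) L (8 * L * Δ + 2 * G ^ 2) Δ (r + l + 1) *
        (2 * N * Real.exp (-(ε ^ 2 / 32) * (r / l))))) := by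
  set e : ℕ → ℝ := fun r =>
    (α * K * G ^ 2 * (34 * νs * z + 2 * (N * νs * δ) + 416 * (κ * N) ^ 2 * (l / r))
        + (1 + 2 * (α * K) * L) * (gapBound B (α * K) L (8 * L * Δ + 2 * G ^ 2) Δ (r + l + 1) *
        (2 * N * Real.exp (-(ε ^ 2 / 32) * (r / l)))))
  set v : ℕ → ℝ := fun r => E (fun S =>
        ‖gradient (globalObj f) (serverModel f α K x₀ S r)‖ ^ 2)
  -- The gradient at round r is paid for by the decrease of the gap from r + l to r + l + 1, so the
  -- gaps telescope with the shift l.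
  have key : ∀ T', s₀ ≤ T' → T' ≤ T → E (gap f Δ α K x₀ (T' + l)) +
      α * K / 2 * ∑ r ∈ Finset.Ico s₀ T', v r ≤
        gapBound B (α * K) L (8 * L * Δ + 2 * G ^ 2) Δ (s₀ + l) + ∑ r ∈ Finset.Ico s₀ T', e r := by
    intro T' hT'
    induction T', hT' using Nat.le_induction with
    | base =>
      intro _
      simp only [Finset.Ico_self, Finset.sum_empty, mul_zero, add_zero]
      exact hE.le_const fun S => h.gap_le_gapBound hα hΔ (s₀ + l) S
    | succ r hr ih =>
      intro hrT
      have hrT' : (r : ℝ) ≤ T := by exact_mod_cast (by omega : r ≤ T)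
      have hsr : (s₀ : ℝ) ≤ r := by exact_mod_cast hr
      have hd := hE.descent h hα hΔ hN hb hβ hβ1 hgl hul hδ0 hε0 hε1 hδε hε hνs hκ hεκ hz hz1 hzν hδν
        (r := r) ((mul_le_mul_of_nonneg_left hrT' hδ0).trans hδT)
        (hls.trans (mul_le_mul_of_nonneg_left hsr hε0.le)) (by omega) (x₀ := x₀) (K := K)
      have hd' : E (gap f Δ α K x₀ (r + l + 1)) + α * K / 2 * v r ≤
        E (gap f Δ α K x₀ (r + l)) + e r := hd
      rw [Finset.sum_Ico_succ_top hr, Finset.sum_Ico_succ_top hr, add_right_comm r 1 l]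
      have := ih (by omega)
      linarith
  have h1 := key T hsT le_rfl
  have h2 : 0 ≤ E (gap f Δ α K x₀ (T + l)) := hE.nonneg fun S => IsSmoothFamily.gap_nonneg hΔ _ S
  linarith

/-- Without any assumption on the counts, gradients are deterministically bounded. -/
theorem IsMixingExpectation.expect_norm_gradient_sq_le [NeZero B]
    (hE : IsMixingExpectation u₀ g H β δ E)
    (h : IsSmoothFamily f L G) (hα : 0 ≤ α) (hΔ : ∀ y, globalObj f x₀ - globalObj f y ≤ Δ) (r : ℕ) :
    E (fun S => ‖gradient (globalObj f) (serverModel f α K x₀ S r)‖ ^ 2) ≤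
      4 * L * gapBound B (α * K) L (8 * L * Δ + 2 * G ^ 2) Δ r := by
  have hL := h.L_pos
  exact hE.le_const fun S => (h.norm_gradient_sq_le_gap hΔ r S).trans
    (mul_le_mul_of_nonneg_left (h.gap_le_gapBound hα hΔ r S) (by positivity))

end Telescoping

end DebiasedFedAvg

namespace DebiasedFedAvg

/-! ### Logarithms and growth exponents -/

section Rate

/-- The threshold depends on C₀ alone, in particular neither on τ nor on K. -/
theorem exists_forall_mul_log_pow_le_sqrt (C₀ : ℝ) :
    ∃ T₁ : ℕ, 3 ≤ T₁ ∧ ∀ T : ℕ, T₁ ≤ T → C₀ * Real.log T ^ 3 ≤ √(T : ℝ) := by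
  have h1 := (Real.isLittleO_pow_log_id_atTop (n := 3)).def (show (0 : ℝ) < 1 / (8 * (|C₀| + 1)) by positivity)
  have hs : Filter.Tendsto (fun T : ℕ => √(T : ℝ)) Filter.atTop Filter.atTop :=
    Real.tendsto_sqrt_atTop.comp tendsto_natCast_atTop_atTop
  obtain ⟨T₁, hT₁⟩ := Filter.eventually_atTop.1 (hs.eventually h1)
  refine ⟨max T₁ 3, le_max_right _ _, fun T hT => ?_⟩
  have h2 := hT₁ T ((le_max_left _ _).trans hT)
  simp only [id, Real.norm_eq_abs] at h2
  rw [abs_of_nonneg (Real.sqrt_nonneg _), Real.log_sqrt (Nat.cast_nonneg T)] at h2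
  have hl := Real.log_natCast_nonneg T
  rw [abs_of_nonneg (by positivity), div_mul_eq_mul_div, one_mul, le_div_iff₀ (by positivity)] at h2
  have h3 : C₀ * Real.log T ^ 3 ≤ (|C₀| + 1) * Real.log T ^ 3 :=
    mul_le_mul_of_nonneg_right (by linarith [le_abs_self C₀]) (by positivity)
  nlinarith

theorem one_le_log_of_three_le {T : ℕ} (hT : 3 ≤ T) : 1 ≤ Real.log T := by
  rw [Real.le_log_iff_exp_le (by exact_mod_cast (by omega : 0 < T))]
  have : (3 : ℝ) ≤ T := by exact_mod_cast hT
  linarith [Real.exp_one_lt_d9]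

theorem log_two_add_one_le {T : ℕ} (hT : 3 ≤ T) :
    ((Nat.log 2 T + 1 : ℕ) : ℝ) ≤ 3 * Real.log T := by
  have h1 := one_le_log_of_three_le hT
  have h2 : ((2 : ℝ)) ^ (Nat.log 2 T) ≤ T := by exact_mod_cast Nat.pow_log_le_self 2 (by omega)
  have h3 := Real.log_le_log (by positivity) h2
  rw [Real.log_pow] at h3
  have h4 := Real.log_two_gt_d9
  push_cast
  nlinarith [(Nat.cast_nonneg (Nat.log 2 T) : (0 : ℝ) ≤ _)]

theorem half_pow_log_le {T : ℕ} (hT : 0 < T) : (1 / 2 : ℝ) ^ (Nat.log 2 T + 1) ≤ 1 / T := by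
  rw [one_div_pow]
  refine one_div_le_one_div_of_le (by exact_mod_cast hT) ?_
  exact_mod_cast (Nat.lt_pow_succ_log_self (by norm_num) T).le

theorem sum_Ico_inv_le (s T : ℕ) (hs : 0 < s) (hT : 3 ≤ T) :
    ∑ r ∈ Finset.Ico s T, (1 / r : ℝ) ≤ 2 * Real.log T := by
  have h1 := harmonic_le_one_add_log T
  rw [harmonic_eq_sum_Icc] at h1
  push_cast at h1
  have h2 : ∑ r ∈ Finset.Ico s T, (1 / r : ℝ) ≤ ∑ r ∈ Finset.Icc 1 T, ((r : ℝ))⁻¹ := by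
    simp only [one_div]
    refine Finset.sum_le_sum_of_subset_of_nonneg (fun r hr => ?_) fun _ _ _ => by positivity
    rw [Finset.mem_Ico] at hr
    rw [Finset.mem_Icc]; omega
  linarith [one_le_log_of_three_le hT]

variable {B : ℕ}

theorem gapBound_le {h L Q Δ : ℝ} (hQ : 0 ≤ Q) {t : ℕ}
    (hexp : 2 * (h * L * (B * t * (1 + Real.log t))) ≤ 1) :
    gapBound B h L Q Δ t ≤ Δ + 3 * Q := by
  unfold gapBound
  have : Real.exp (2 * (h * L * (B * t * (1 + Real.log t)))) ≤ 3 :=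
    (Real.exp_le_exp.2 hexp).trans (by linarith [Real.exp_one_lt_d9])
  have := mul_le_mul_of_nonneg_right this hQ
  linarith

theorem one_add_log_le {t T : ℕ} (hT : 3 ≤ T) (htT : t ≤ 2 * T) : 1 + Real.log t ≤ 3 * Real.log T := by
  have hΛ := one_le_log_of_three_le hT
  have h2 : Real.log t ≤ Real.log 2 + Real.log T := by
    rcases Nat.eq_zero_or_pos t with rfl | ht
    · have := Real.log_two_gt_d9
      simp only [CharP.cast_eq_zero, Real.log_zero]
      linarith
    · rw [← Real.log_mul (by norm_num) (by have : 0 < T := by omega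
                                           positivity)]
      exact Real.log_le_log (by exact_mod_cast ht) (by exact_mod_cast htT)
  linarith [Real.log_two_lt_d9]

/-- The growth exponent up to round `t`, for the step sizes of the theorem. -/
theorem growth_exponent_le {h L c₂ τ : ℝ} (hh : 0 ≤ h) (hL : 0 ≤ L) {t T : ℕ}
    (hT : 3 ≤ T) (htT : t ≤ 2 * T) (hc : h ≤ c₂ / (τ * √(T : ℝ))) :
    2 * (h * L * (B * t * (1 + Real.log t))) ≤
      6 * c₂ * L * B * (t / τ) * (Real.log T / √(T : ℝ)) := by
  have hl := one_add_log_le hT htT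
  have hl0 : 0 ≤ 1 + Real.log t := by linarith [Real.log_natCast_nonneg t]
  have hc₂ : 0 ≤ c₂ / (τ * √(T : ℝ)) := hh.trans hc
  calc 2 * (h * L * (B * t * (1 + Real.log t)))
      ≤ 2 * (c₂ / (τ * √(T : ℝ)) * L * (B * t * (3 * Real.log T))) := by gcongr
    _ = _ := by ring

end Rate

end DebiasedFedAvg

namespace DebiasedFedAvg

/-! ### The rate for large horizons -/

section LargeHorizon

/-- Growth e^y against probability e^{-2y}: what is left is e^{-y} ≤ 2^{-m}. -/
theorem gapBound_mul_exp_le {B : ℕ} {h L Q Δ y : ℝ} (hQ : 0 ≤ Q) (hΔ : 0 ≤ Δ) {t m : ℕ}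
    (hexp : 2 * (h * L * (B * t * (1 + Real.log t))) ≤ y) (hmy : m ≤ y) :
    gapBound B h L Q Δ t * Real.exp (-(2 * y)) ≤ (Δ + Q) * (1 / 2) ^ m := by
  have hy : (0 : ℝ) ≤ y := (Nat.cast_nonneg m).trans hmy
  have h1 : gapBound B h L Q Δ t ≤ Real.exp y * (Δ + Q) := by
    unfold gapBound
    have a1 := mul_le_mul_of_nonneg_right (Real.exp_le_exp.2 hexp) hQ
    have a2 := mul_le_mul_of_nonneg_right (Real.one_le_exp hy) hΔ
    linarith
  have h2 : Real.exp (-y) ≤ (1 / 2) ^ m := by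
    calc Real.exp (-y) ≤ Real.exp (m * (-1)) := Real.exp_le_exp.2 (by linarith)
      _ = Real.exp (-1) ^ m := Real.exp_nat_mul _ _
      _ ≤ (1 / 2) ^ m := by
          refine pow_le_pow_left₀ (Real.exp_pos _).le ?_ m
          rw [Real.exp_neg, one_div]
          exact inv_anti₀ (by norm_num) (by linarith [Real.exp_one_gt_d9])
  calc _ ≤ Real.exp y * (Δ + Q) * Real.exp (-(2 * y)) :=
        mul_le_mul_of_nonneg_right h1 (Real.exp_pos _).le
    _ = (Δ + Q) * Real.exp (-y) := by
        have : Real.exp (-(2 * y)) = Real.exp (-y) * Real.exp (-y) := by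
          rw [← Real.exp_add]; congr 1; ring
        rw [this]
        have : Real.exp y * Real.exp (-y) = 1 := by rw [← Real.exp_add]; simp
        linear_combination (Δ + Q) * Real.exp (-y) * this
    _ ≤ _ := mul_le_mul_of_nonneg_left h2 (by positivity)

set_option maxHeartbeats 4000000 in
/-- The rate when the horizon is large compared with the constants. -/
theorem exists_rate_of_large (N B M : ℕ) [NeZero B] (hN : 0 < N) (hM : 2 ≤ M)
    {bmin L G Δ c₁ c₂ : ℝ} (hb : 0 < bmin) (hL1 : 1 ≤ L) (hΔ0 : 0 ≤ Δ)
    (hc₁ : 0 < c₁) (hc₂ : c₁ ≤ c₂) :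
    ∃ C₀ C : ℝ, 0 ≤ C ∧ ∀ T : ℕ, 3 ≤ T → C₀ * Real.log T ^ 3 ≤ √(T : ℝ) →
      ∀ (d : ℕ) (f : Fin N → EuclideanSpace ℝ (Fin d) → ℝ) (x₀ : EuclideanSpace ℝ (Fin d))
        (α : ℝ) (K : ℕ) (β : Fin N → ℝ) (u₀ τ : ℕ) (E : ((ℕ → Batch N B) → ℝ) →ₗ[ℝ] ℝ),
        IsSmoothFamily f L G → 0 ≤ α → (∀ y, globalObj f x₀ - globalObj f y ≤ Δ) →
        (∀ i, bmin ≤ β i) → (∀ i, β i ≤ 1) → u₀ ≤ M → 1 ≤ τ →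
        c₁ / (τ * √(T : ℝ)) ≤ α * K → α * K ≤ c₂ / (τ * √(T : ℝ)) →
        IsMixingExpectation u₀ (τ * (Nat.log 2 T + 1)) (T + M * (τ * (Nat.log 2 T + 1))) β
          ((1 / 2) ^ (Nat.log 2 T + 1)) E →
        ∑ r ∈ Finset.range T, E (fun S =>
          ‖gradient (globalObj f) (serverModel f α K x₀ S r)‖ ^ 2) ≤
          T * (C * (τ * Real.log T ^ 2 / √(T : ℝ))) := by
  have hB : (0 : ℝ) < B := Nat.cast_pos.2 (NeZero.pos B)
  have hN' : (0 : ℝ) < N := Nat.cast_pos.2 hN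
  have hM' : (2 : ℝ) ≤ M := by exact_mod_cast hM
  have hL0 : 0 < L := by linarith
  have hc₂0 : 0 < c₂ := by linarith
  set νs : ℝ := 2 * B / (N * bmin) with hνs
  set κ : ℝ := 2 * B / (N * bmin ^ 2) with hκ
  have hνs0 : 0 < νs := by positivity
  have hκ0 : 0 < κ := by positivity
  obtain ⟨ε, hε0, hε1, hε, hεκ⟩ : ∃ ε : ℝ, 0 < ε ∧ ε ≤ 1 ∧ 4 * ε ≤ bmin ∧
      κ * ((N + 1) * ε) ≤ 1 / 8 := by
    refine ⟨min 1 (min (bmin / 4) (1 / (8 * (κ * (N + 1))))), by positivity, min_le_left _ _, ?_, ?_⟩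
    · have : min 1 (min (bmin / 4) (1 / (8 * (κ * (N + 1))))) ≤ bmin / 4 :=
        (min_le_right _ _).trans (min_le_left _ _)
      linarith
    · have : min 1 (min (bmin / 4) (1 / (8 * (κ * (N + 1))))) ≤ 1 / (8 * (κ * (N + 1))) :=
        (min_le_right _ _).trans (min_le_right _ _)
      calc _ ≤ κ * ((N + 1) * (1 / (8 * (κ * (N + 1))))) := by gcongr
        _ = 1 / 8 := by field_simp
  -- A is the length of the burn-in in units of lm. A ≥ 6/ε makes the tail bound applicable from s₀
  -- on, and A ≥ 64/ε² yields m ≤ y in `hlate`.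
  obtain ⟨A, hA⟩ := exists_nat_ge (6 / ε + 64 / ε ^ 2 + 1)
  have hA6 : 6 / ε ≤ A := by linarith [show 0 < 64 / ε ^ 2 by positivity]
  have hA64 : 64 / ε ^ 2 ≤ A := by linarith [show 0 < 6 / ε by positivity]
  have hA1 : (1 : ℝ) ≤ A := by
    linarith [show 0 < 64 / ε ^ 2 by positivity, show 0 < 6 / ε by positivity]
  set Q : ℝ := 8 * L * Δ + 2 * G ^ 2 with hQ
  have hQ0 : 0 ≤ Q := by positivity
  set W₁ : ℝ := Δ + 3 * Q with hW₁
  have hW₁0 : 0 ≤ W₁ := by positivity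
  set P₁ : ℝ := (Δ + Q) * (2 * N) with hP₁
  have hP₁0 : 0 ≤ P₁ := by positivity
  -- Thresholds for the horizon: `k1` makes z small, `k2` and `k3` make δ small, `k4` bounds the
  -- growth during the burn-in and `k5` the growth after it.
  obtain ⟨C₀, k0, k1, k2, k3, k4, k5⟩ : ∃ C₀ : ℝ, 1 ≤ C₀ ∧
      6 * c₂ * L * B * νs * M * (1 + 272 * νs) ≤ C₀ ∧ 8 / ε ≤ C₀ ∧ 16 * (N * νs) ≤ C₀ ∧
      108 * c₂ * L * B * A * M ≤ C₀ ∧ 2304 * c₂ * L * B * M / ε ^ 2 ≤ C₀ := by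
    have t1 : 0 ≤ 6 * c₂ * L * B * νs * M * (1 + 272 * νs) := by positivity
    have t2 : 0 ≤ 8 / ε := by positivity
    have t3 : 0 ≤ 16 * (N * νs) := by positivity
    have t4 : 0 ≤ 108 * c₂ * L * B * A * M := by positivity
    have t5 : 0 ≤ 2304 * c₂ * L * B * M / ε ^ 2 := by positivity
    refine ⟨6 * c₂ * L * B * νs * M * (1 + 272 * νs) + 8 / ε + 16 * (N * νs) +
      108 * c₂ * L * B * A * M + 2304 * c₂ * L * B * M / ε ^ 2 + 1, ?_, ?_, ?_, ?_, ?_, ?_⟩ <;> linarith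
  set C : ℝ := 36 * A * M * L * W₁ + 2 / c₁ * W₁ + 2 * G ^ 2 * (204 * νs * (c₂ * L * B * νs * M)
    + 2 * (N * νs) + 2496 * (κ * N) ^ 2 * M) + (2 / c₁ + 4 * L) * P₁ with hC
  refine ⟨C₀, C, by positivity, ?_⟩
  intro T hT3 hC₀ d f x₀ α K β u₀ τ E h hα hΔ hβ hβ1 hu hτ hc1 hc2 hE
  set Λ := Real.log T with hΛ
  have hΛ1 : 1 ≤ Λ := one_le_log_of_three_le hT3
  have hm3 := log_two_add_one_le hT3
  have hδT := half_pow_log_le (T := T) (by omega)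
  rw [← hΛ] at hm3
  set m : ℕ := Nat.log 2 T + 1 with hm
  have hm1 : (1 : ℝ) ≤ m := by rw [hm]; push_cast; linarith [(Nat.cast_nonneg (Nat.log 2 T) : (0 : ℝ) ≤ _)]
  set s := √(T : ℝ) with hs
  have hT1 : (1 : ℝ) ≤ T := by exact_mod_cast (by omega : 1 ≤ T)
  have hss : s * s = T := Real.mul_self_sqrt (by positivity)
  have hΛ3 : 1 ≤ Λ ^ 3 := one_le_pow₀ hΛ1
  have hΛΛ3 : Λ ≤ Λ ^ 3 := le_self_pow₀ hΛ1 (by norm_num)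
  have hΛ2Λ3 : Λ ^ 2 ≤ Λ ^ 3 := pow_le_pow_right₀ hΛ1 (by norm_num)
  have hΛΛ2 : Λ ≤ Λ ^ 2 := le_self_pow₀ hΛ1 (by norm_num)
  have hC₀0 : 0 ≤ C₀ := by linarith
  have hC1 : C₀ ≤ s := (le_mul_of_one_le_right hC₀0 hΛ3).trans hC₀
  have hCΛ : C₀ * Λ ≤ s := (mul_le_mul_of_nonneg_left hΛΛ3 hC₀0).trans hC₀
  have hCΛ2 : C₀ * Λ ^ 2 ≤ s := (mul_le_mul_of_nonneg_left hΛ2Λ3 hC₀0).trans hC₀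
  have hs1 : 1 ≤ s := k0.trans hC1
  have hs0 : 0 < s := by linarith
  have hsT : s ≤ T := by
    rw [← hss]; exact le_mul_of_one_le_left hs0.le hs1
  have hτ' : (1 : ℝ) ≤ τ := by exact_mod_cast hτ
  have hτ0 : (0 : ℝ) < τ := by linarith
  have hT0 : (0 : ℝ) < T := by linarith
  have hΛ0 : 0 < Λ := by linarith
  -- the unit of error
  set X : ℝ := τ * Λ ^ 2 / s with hX
  have hX0 : 0 < X := by positivity
  have hTX : τ * Λ ^ 2 ≤ T * X := by
    rw [hX, mul_div_assoc', le_div_iff₀ hs0]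
    rw [mul_comm]
    exact mul_le_mul_of_nonneg_right hsT (by positivity)
  have hsX : τ * s ≤ T * X := by
    have e : (T : ℝ) * X = τ * s * Λ ^ 2 := by rw [hX, ← hss]; field_simp
    rw [e]
    exact le_mul_of_one_le_right (by positivity) (one_le_pow₀ hΛ1)
  have hτX : τ ≤ T * X := le_trans (le_mul_of_one_le_right hτ0.le hs1) hsX
  have h1X : 1 ≤ T * X := hτ'.trans hτX
  have hΛX : T * (Λ / s) ≤ T * X := by
    refine mul_le_mul_of_nonneg_left ?_ hT0.le
    rw [hX]
    gcongr
    exact hΛΛ2.trans (le_mul_of_one_le_left (by positivity) hτ')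
  -- step size, lag, starting round
  set η := α * K with hη
  have hη0 : 0 ≤ η := by positivity
  have hηpos : 0 < η := lt_of_lt_of_le (by positivity) hc1
  -- M ≥ 2 gives l ≥ τm + 1, and M ≥ u₀ gives l ≥ u₀.
  set l : ℕ := M * (τ * m) with hl
  have hl' : (l : ℝ) = M * (τ * m) := by rw [hl]; push_cast; rfl
  have hlle : (l : ℝ) ≤ 3 * M * τ * Λ := by
    rw [hl']
    calc (M : ℝ) * (τ * m) ≤ M * (τ * (3 * Λ)) := by gcongr
      _ = _ := by ring
  have hτm : 1 ≤ τ * m := Nat.mul_pos hτ (by omega)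
  have hgl : τ * m + 1 ≤ l := by
    have := Nat.mul_le_mul_right (τ * m) hM
    omega
  have hul : u₀ ≤ l := hu.trans (Nat.le_mul_of_pos_right _ hτm)
  have hl1 : (1 : ℝ) ≤ l := by exact_mod_cast (by omega : 1 ≤ l)
  have hl0 : (0 : ℝ) < l := by linarith
  set δ : ℝ := (1 / 2) ^ m with hδ
  have hδ0 : 0 ≤ δ := by positivity
  have hδT1 : δ * T ≤ 1 := by rwa [le_div_iff₀ hT0] at hδT
  have hδε : δ ≤ ε / 8 := by
    refine hδT.trans ?_
    rw [div_le_div_iff₀ hT0 (by norm_num)]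
    have := k2.trans (hC1.trans hsT)
    rw [div_le_iff₀ hε0] at this
    linarith
  have hNδ : N * νs * δ * T ≤ N * νs := by
    have := mul_le_mul_of_nonneg_left hδT1 (show 0 ≤ N * νs by positivity)
    linarith
  have hδν : N * νs * δ ≤ 1 / 16 := by
    have := k3.trans (hC1.trans hsT)
    have h2 : N * νs * δ * T ≤ 1 / 16 * T := by linarith
    exact le_of_mul_le_mul_right h2 hT0
  set z := η * L * (B * νs * (l + 1)) with hz
  have hz0 : 0 ≤ z := by positivity
  have hzle : z ≤ 6 * c₂ * L * B * νs * M * (Λ / s) := by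
    calc z ≤ c₂ / (τ * s) * L * (B * νs * (2 * (3 * M * τ * Λ))) := by
          rw [hz]
          gcongr
          linarith
      _ = _ := by field_simp; ring
  have hzall : (1 + 272 * νs) * z ≤ 1 := by
    calc _ ≤ (1 + 272 * νs) * (6 * c₂ * L * B * νs * M * (Λ / s)) := by gcongr
      _ = (6 * c₂ * L * B * νs * M * (1 + 272 * νs)) * Λ / s := by ring
      _ ≤ C₀ * Λ / s := by gcongr
      _ ≤ 1 := by rw [div_le_one hs0]; exact hCΛ
  have hνz := mul_nonneg hνs0.le hz0
  have hz1 : z ≤ 1 := by linarith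
  have hzν : 17 * νs * z ≤ 1 / 16 := by linarith
  set s₀ : ℕ := A * l * m with hs₀
  have hs₀' : (s₀ : ℝ) = A * l * m := by rw [hs₀]; push_cast; rfl
  have hs₀le : (s₀ : ℝ) ≤ 9 * A * M * (τ * Λ ^ 2) := by
    rw [hs₀']
    calc (A : ℝ) * l * m ≤ A * (3 * M * τ * Λ) * (3 * Λ) := by gcongr
      _ = _ := by ring
  have hls₀ : (l : ℝ) ≤ s₀ := by
    rw [hs₀']
    calc (l : ℝ) = 1 * l * 1 := by ring
      _ ≤ A * l * m := by gcongr
  have hls₀n : l ≤ s₀ := by exact_mod_cast hls₀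
  have h6l : 6 * (l : ℝ) ≤ ε * s₀ := by
    rw [div_le_iff₀ hε0] at hA6
    rw [hs₀']
    calc 6 * (l : ℝ) ≤ A * ε * l * 1 := by
          rw [mul_one]; exact mul_le_mul_of_nonneg_right hA6 hl0.le
      _ ≤ A * ε * l * m := by gcongr
      _ = _ := by ring
  -- s₀ is of order τΛ² and the step size carries 1/τ, so the growth exponent is of order Λ³/√T,
  -- free of τ. This is where the cube of the logarithm is needed.
  have hearly : ∀ t : ℕ, t ≤ 2 * s₀ → t ≤ 2 * T → gapBound B η L Q Δ t ≤ W₁ := by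
    intro t ht htT
    refine gapBound_le hQ0 ((growth_exponent_le hη0 hL0.le hT3 htT hc2).trans ?_)
    have ht' : (t : ℝ) ≤ 2 * s₀ := by exact_mod_cast ht
    rw [← hΛ, ← hs]
    calc 6 * c₂ * L * B * (t / τ) * (Λ / s)
        ≤ 6 * c₂ * L * B * (2 * (9 * A * M * (τ * Λ ^ 2)) / τ) * (Λ / s) := by
          gcongr
          linarith
      _ = 108 * c₂ * L * B * A * M * Λ ^ 3 / s := by field_simp; ring
      _ ≤ C₀ * Λ ^ 3 / s := by gcongr
      _ ≤ 1 := by rw [div_le_one hs0]; exact hC₀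
  have hlate : ∀ r ∈ Finset.Ico s₀ T, gapBound B η L Q Δ (r + l + 1) *
      (2 * N * Real.exp (-(ε ^ 2 / 32) * (r / l))) ≤ P₁ / T := by
    intro r hr
    rw [Finset.mem_Ico] at hr
    have hsr : (s₀ : ℝ) ≤ r := by exact_mod_cast hr.1
    have hr0 : (0 : ℝ) ≤ r := Nat.cast_nonneg r
    have h6r : 6 * (l : ℝ) ≤ r := by
      calc 6 * (l : ℝ) ≤ ε * s₀ := h6l
        _ ≤ 1 * r := by gcongr
        _ = r := one_mul _
    have hlr : r + l + 1 ≤ 2 * r := by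
      have : (r : ℝ) + l + 1 ≤ 2 * r := by linarith
      exact_mod_cast this
    have hlr' : ((r + l + 1 : ℕ) : ℝ) ≤ 2 * r := by exact_mod_cast hlr
    -- Half the exponent of the tail bound. The growth exponent stays below y once Λ² is small
    -- against √T.
    set y : ℝ := ε ^ 2 / 64 * (r / l) with hy
    have hexp : 2 * (η * L * (B * ((r + l + 1 : ℕ) : ℝ) * (1 + Real.log ((r + l + 1 : ℕ) : ℝ)))) ≤ y := by
      refine (growth_exponent_le hη0 hL0.le hT3 (by omega) hc2).trans ?_
      rw [← hΛ, ← hs]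
      have c1 : 2304 * c₂ * L * B * M / ε ^ 2 * Λ ^ 2 ≤ s :=
        (mul_le_mul_of_nonneg_right k5 (by positivity)).trans hCΛ2
      calc 6 * c₂ * L * B * (((r + l + 1 : ℕ) : ℝ) / τ) * (Λ / s)
          ≤ 6 * c₂ * L * B * (2 * r / τ) * (Λ / s) := by gcongr
        _ = ε ^ 2 / 64 * (r / (3 * M * τ * Λ)) *
            (2304 * c₂ * L * B * M / ε ^ 2 * Λ ^ 2 / s) := by field_simp; ring
        _ ≤ ε ^ 2 / 64 * (r / (3 * M * τ * Λ)) * 1 := by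
            gcongr
            rwa [div_le_one hs0]
        _ ≤ y := by
            rw [mul_one, hy]
            gcongr
    have hmy : (m : ℝ) ≤ y := by
      rw [hy, mul_div_assoc', le_div_iff₀ hl0]
      rw [div_le_iff₀ (by positivity)] at hA64
      calc (m : ℝ) * l = 64 * (l * m) / 64 := by ring
        _ ≤ A * ε ^ 2 * (l * m) / 64 := by gcongr
        _ = ε ^ 2 / 64 * s₀ := by rw [hs₀']; ring
        _ ≤ ε ^ 2 / 64 * r := by gcongr
    have h1 := gapBound_mul_exp_le hQ0 hΔ0 hexp hmy
    have e1 : -(ε ^ 2 / 32) * ((r : ℝ) / l) = -(2 * y) := by rw [hy]; ring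
    rw [e1]
    calc _ = gapBound B η L Q Δ (r + l + 1) * Real.exp (-(2 * y)) * (2 * N) := by ring
      _ ≤ (Δ + Q) * δ * (2 * N) := by gcongr
      _ = P₁ * δ := by rw [hP₁]; ring
      _ ≤ P₁ * (1 / T) := by gcongr
      _ = P₁ / T := by ring
  set v : ℕ → ℝ := fun r => E (fun S =>
    ‖gradient (globalObj f) (serverModel f α K x₀ S r)‖ ^ 2) with hv
  have hburn : ∑ r ∈ Finset.range (min s₀ T), v r ≤ 36 * A * M * L * W₁ * (T * X) := by
    calc _ ≤ ∑ r ∈ Finset.range (min s₀ T), 4 * L * W₁ := by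
          refine Finset.sum_le_sum fun r hr => ?_
          have hr' := Finset.mem_range.1 hr
          refine (hE.expect_norm_gradient_sq_le h hα hΔ r).trans ?_
          exact mul_le_mul_of_nonneg_left (hearly r (by omega) (by omega)) (by positivity)
      _ = (min s₀ T : ℕ) * (4 * L * W₁) := by rw [Finset.sum_const, Finset.card_range, nsmul_eq_mul]
      _ ≤ 9 * A * M * (τ * Λ ^ 2) * (4 * L * W₁) := by
          gcongr
          exact le_trans (by exact_mod_cast min_le_left _ _) hs₀le
      _ = 36 * A * M * L * W₁ * (τ * Λ ^ 2) := by ring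
      _ ≤ _ := by gcongr
  have hrest0 : 0 ≤ (2 / c₁ * W₁ + 2 * G ^ 2 * (204 * νs * (c₂ * L * B * νs * M)
    + 2 * (N * νs) + 2496 * (κ * N) ^ 2 * M) + (2 / c₁ + 4 * L) * P₁) * (T * X) := by positivity
  have hgoal : ∑ r ∈ Finset.range T, v r ≤ C * (T * X) := by
    -- If the burn-in covers the whole horizon, nothing is left to telescope.
    rcases le_total T s₀ with hTs | hsT'
    · rw [min_eq_right hTs] at hburn
      rw [hC]
      linarith
    · rw [min_eq_left hsT'] at hburn
      rw [← Finset.sum_range_add_sum_Ico v hsT']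
      have hdesc := hE.sum_descent h hα hΔ hN hb hβ hβ1 hgl hul hδ0 hε0 hε1 hδε hε hνs hκ hεκ
        (hz.symm) hz1 hzν hδν hsT' hδT1 h6l le_rfl
      rw [← hQ, ← hη] at hdesc
      have hW := hearly (s₀ + l) (by omega) (by omega)
      have hs₀pos : 0 < s₀ := by
        have : (0 : ℝ) < s₀ := by linarith
        exact_mod_cast this
      have hcard : (((Finset.Ico s₀ T).card : ℕ) : ℝ) ≤ T := by
        rw [Nat.card_Ico]; exact_mod_cast Nat.sub_le _ _
      have he : ∑ r ∈ Finset.Ico s₀ T,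
          (η * G ^ 2 * (34 * νs * z + 2 * (N * νs * δ) + 416 * (κ * N) ^ 2 * (l / r))
          + (1 + 2 * η * L) * (gapBound B η L Q Δ (r + l + 1) *
          (2 * N * Real.exp (-(ε ^ 2 / 32) * (r / l))))) ≤
          η * G ^ 2 * (T * (34 * νs * z + 2 * (N * νs * δ)) + 416 * (κ * N) ^ 2 * (l * (2 * Λ)))
          + (1 + 2 * η * L) * P₁ := by
        calc _ ≤ ∑ r ∈ Finset.Ico s₀ T,
            ((η * G ^ 2 * (34 * νs * z + 2 * (N * νs * δ)) + (1 + 2 * η * L) * (P₁ / T)) +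
              η * G ^ 2 * (416 * (κ * N) ^ 2 * l) * (1 / r)) := by
              refine Finset.sum_le_sum fun r hr => ?_
              have := mul_le_mul_of_nonneg_left (hlate r hr)
                (show 0 ≤ 1 + 2 * η * L by positivity)
              calc _ ≤ η * G ^ 2 * (34 * νs * z + 2 * (N * νs * δ) + 416 * (κ * N) ^ 2 * (l / r))
                    + (1 + 2 * η * L) * (P₁ / T) := add_le_add le_rfl this
                _ = _ := by ring
          _ = ((Finset.Ico s₀ T).card : ℕ) * (η * G ^ 2 * (34 * νs * z + 2 * (N * νs * δ))
                + (1 + 2 * η * L) * (P₁ / T)) +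
              η * G ^ 2 * (416 * (κ * N) ^ 2 * l) * ∑ r ∈ Finset.Ico s₀ T, (1 / r : ℝ) := by
              rw [Finset.sum_add_distrib, Finset.sum_const, nsmul_eq_mul, Finset.mul_sum]
          _ ≤ T * (η * G ^ 2 * (34 * νs * z + 2 * (N * νs * δ))
                + (1 + 2 * η * L) * (P₁ / T)) +
              η * G ^ 2 * (416 * (κ * N) ^ 2 * l) * (2 * Λ) := by
              gcongr
              exact sum_Ico_inv_le s₀ T hs₀pos hT3
          _ = _ := by field_simp; ring
      have hsum := hdesc.trans (add_le_add hW he)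
      -- The lower bound on the step size is needed to divide the telescoped inequality by η.
      have hηinv : 1 / η ≤ τ * s / c₁ := by
        rw [div_le_div_iff₀ hηpos hc₁]
        rw [div_le_iff₀ (by positivity)] at hc1
        linarith
      have hηinv' : 1 / η ≤ T * X / c₁ := hηinv.trans (by gcongr)
      have hV : ∑ r ∈ Finset.Ico s₀ T, v r ≤ 2 * (1 / η) * W₁ +
          2 * G ^ 2 * (T * (34 * νs * z + 2 * (N * νs * δ)) + 416 * (κ * N) ^ 2 * (l * (2 * Λ)))
          + (2 * (1 / η) + 4 * L) * P₁ := by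
        have := mul_le_mul_of_nonneg_left hsum (show 0 ≤ 2 / η by positivity)
        calc _ = 2 / η * (η / 2 * ∑ r ∈ Finset.Ico s₀ T, v r) := by field_simp
          _ ≤ _ := this
          _ = _ := by field_simp; ring
      have b1 : T * z ≤ 6 * c₂ * L * B * νs * M * (T * X) := by
        calc T * z ≤ T * (6 * c₂ * L * B * νs * M * (Λ / s)) := by gcongr
          _ = 6 * c₂ * L * B * νs * M * (T * (Λ / s)) := by ring
          _ ≤ _ := by gcongr
      have b2 : N * νs * δ * T ≤ N * νs * (T * X) :=
        hNδ.trans (le_mul_of_one_le_right (by positivity) h1X)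
      have b3 : l * (2 * Λ) ≤ 6 * M * (T * X) := by
        calc l * (2 * Λ) ≤ 3 * M * τ * Λ * (2 * Λ) := by gcongr
          _ = 6 * M * (τ * Λ ^ 2) := by ring
          _ ≤ _ := by gcongr
      have b4 : T * (34 * νs * z + 2 * (N * νs * δ)) + 416 * (κ * N) ^ 2 * (l * (2 * Λ)) ≤
          (204 * νs * (c₂ * L * B * νs * M) + 2 * (N * νs) + 2496 * (κ * N) ^ 2 * M) * (T * X) := by
        have d1 := mul_le_mul_of_nonneg_left b1 (show 0 ≤ 34 * νs by positivity)
        have d3 := mul_le_mul_of_nonneg_left b3 (show 0 ≤ 416 * (κ * N) ^ 2 by positivity)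
        linarith
      have b5 := mul_le_mul_of_nonneg_left b4 (show 0 ≤ 2 * G ^ 2 by positivity)
      have b6 := mul_le_mul_of_nonneg_right hηinv' (show 0 ≤ 2 * W₁ by positivity)
      have b7 := mul_le_mul_of_nonneg_right hηinv' (show 0 ≤ 2 * P₁ by positivity)
      have b8 : 4 * L * P₁ ≤ 4 * L * P₁ * (T * X) := le_mul_of_one_le_right (by positivity) h1X
      have e6 : T * X / c₁ * (2 * W₁) = 2 / c₁ * W₁ * (T * X) := by ring
      have e7 : T * X / c₁ * (2 * P₁) = 2 / c₁ * P₁ * (T * X) := by ring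
      rw [e6] at b6
      rw [e7] at b7
      rw [hC]
      linarith
  calc _ ≤ C * (T * X) := hgoal
    _ = _ := by ring

end LargeHorizon

end DebiasedFedAvg

namespace DebiasedFedAvg

/-! ### The uniformly drawn output -/

section Output

variable {N B : ℕ} {Ω : Type*} [MeasurableSpace Ω] {μ : Measure Ω}

/-- Averaging over a uniformly distributed round, independent of the trajectory. -/
theorem integral_uniform_round [IsProbabilityMeasure μ] {X : ℕ → Ω → Batch N B}
    (hX : ∀ t, Measurable (X t)) {T H : ℕ} (hTH : T ≤ H) {ι : Ω → Fin T} (hι : Measurable ι)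
    (hunif : μ.map ι = uniformOn (Set.univ : Set (Fin T)))
    (hind : IndepFun ι (fun ω t => X t ω) μ) (φ : ℕ → (ℕ → Batch N B) → ℝ)
    (hφ : ∀ r, DependsOn (φ r) (Set.Iio r)) :
    Integrable (fun ω => φ (ι ω) (fun t => X t ω)) μ ∧
      ∫ ω, φ (ι ω) (fun t => X t ω) ∂μ =
        1 / (T : ℝ) * ∑ r ∈ Finset.range T, pathExpectation μ hX H (φ r) := by
  classical
  -- Freezing after round H makes each φ r measurable, and changes nothing, because φ r reads only
  -- rounds before r < T ≤ H.
  set ψ : ℕ → (ℕ → Batch N B) → ℝ := fun r S => φ r fun s => S (min s H) with hψ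
  have hψm : ∀ r, Measurable (ψ r) := by
    intro r
    have h1 : Measurable fun S : ℕ → Batch N B => (fun s : Fin (H + 1) => S s) :=
      measurable_pi_lambda _ fun s => measurable_pi_apply _
    exact (measurable_of_finite fun j : Fin (H + 1) → Batch N B =>
      φ r fun s => j ⟨min s H, by omega⟩).comp h1
  have hsum : ∀ ω, φ (ι ω) (fun t => X t ω) =
      ∑ r : Fin T, (if ι ω = r then (1 : ℝ) else 0) * ψ r (fun t => X t ω) := by
    intro ω
    simp only [ite_mul, one_mul, zero_mul, Finset.sum_ite_eq, Finset.mem_univ, if_true]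
    refine hφ _ fun s hs => ?_
    have h1 : s < ι ω := hs
    have h2 := (ι ω).2
    rw [min_eq_left (by omega)]
  have hind' : ∀ r : Fin T, IndepFun (fun ω => if ι ω = r then (1 : ℝ) else 0)
      (fun ω => ψ r (fun t => X t ω)) μ := fun r =>
    hind.comp (φ := fun x : Fin T => if x = r then (1 : ℝ) else 0) (measurable_of_finite _) (hψm r)
  have hi1 : ∀ r : Fin T, Integrable (fun ω => if ι ω = r then (1 : ℝ) else 0) μ := fun r =>
    (Integrable.of_finite (μ := μ.map ι) (f := fun x => if x = r then (1 : ℝ) else 0)).comp_measurable hι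
  have hi2 : ∀ r : Fin T, Integrable (fun ω => ψ r (fun t => X t ω)) μ := fun r =>
    integrable_frozenPath hX H (φ r)
  have hprod : ∀ r : Fin T, Integrable (fun ω => (if ι ω = r then (1 : ℝ) else 0) *
      ψ r (fun t => X t ω)) μ := fun r => (hind' r).integrable_mul (hi1 r) (hi2 r)
  have hprob : ∀ r : Fin T, ∫ ω, (if ι ω = r then (1 : ℝ) else 0) ∂μ = 1 / T := by
    intro r
    rw [← integral_map (φ := ι) (f := fun x => if x = r then (1 : ℝ) else 0) hι.aemeasurable
      (measurable_of_finite _).aestronglyMeasurable, hunif]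
    have : (fun x : Fin T => if x = r then (1 : ℝ) else 0) = Set.indicator {r} 1 := by
      funext x; simp [Set.indicator_apply]
    rw [this, integral_indicator_one (MeasurableSet.singleton r), measureReal_def, uniformOn_univ]
    simp
  simp only [hsum]
  refine ⟨integrable_finsetSum _ fun r _ => hprod r, ?_⟩
  rw [integral_finsetSum _ fun r _ => hprod r, Finset.mul_sum,
    Finset.sum_range (fun r => 1 / (T : ℝ) * pathExpectation μ hX H (φ r))]
  refine Finset.sum_congr rfl fun r _ => ?_
  rw [(hind' r).integral_fun_mul_eq_mul_integral (hi1 r).aestronglyMeasurable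
    (hi2 r).aestronglyMeasurable, hprob]
  rfl

end Output

end DebiasedFedAvg

theorem theorem3 :
    ∃ k : ℕ, ∀ (M B : ℕ) [NeZero B] (πmin L G Δ c₁ c₂ : ℝ),
      0 ≤ L → 0 < G → 0 < c₁ → c₁ ≤ c₂ →
      ∃ cdag C : ℝ, 0 < cdag ∧ 0 < C ∧
      ∀ (R : ℕ) (p : Fin (M * B) → ℝ),
        R + 1 < M → (∀ i, 0 < p i) → ∑ i, p i = 1 →
        (⨅ i, clientStationary (M * B) B R p i) = πmin →
      ∀ (d : ℕ) (f : Fin (M * B) → EuclideanSpace ℝ (Fin d) → ℝ)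
        (x₀ : EuclideanSpace ℝ (Fin d)),
        (∀ i, Differentiable ℝ (f i)) →
        (∀ i x, ‖gradient (f i) x - gradient (globalObj f) x‖ ^ 2 ≤ G ^ 2) →
        (∀ i x y, ‖gradient (f i) x - gradient (f i) y‖ ≤ L * ‖x - y‖) →
        (∀ y, globalObj f x₀ - globalObj f y ≤ Δ) →
      ∀ (K T : ℕ) (α : ℝ), 0 < K → 0 < T →
        cdag * (tauMix (M * B) B R p : ℝ) * Real.log (tauMix (M * B) B R p : ℝ) < (T : ℝ) →
        c₁ / ((tauMix (M * B) B R p : ℝ) * (K : ℝ) * √(T : ℝ)) ≤ α →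
        α ≤ c₂ / ((tauMix (M * B) B R p : ℝ) * (K : ℝ) * √(T : ℝ)) →
      ∀ (Ω : Type*) [MeasurableSpace Ω] (μ : Measure Ω) [IsProbabilityMeasure μ]
        (X : ℕ → Ω → Batch (M * B) B) (ι : Ω → Fin T),
        IsParticipationProcess μ R p X →
        Measurable ι → μ.map ι = uniformOn (Set.univ : Set (Fin T)) →
        IndepFun ι (fun ω t => X t ω) μ →
        Integrable (fun ω => ‖gradient (globalObj f)
          (serverModel f α K x₀ (fun t => X t ω) (ι ω))‖ ^ 2) μ ∧
        ∫ ω, ‖gradient (globalObj f)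
          (serverModel f α K x₀ (fun t => X t ω) (ι ω))‖ ^ 2 ∂μ ≤
          C * ((tauMix (M * B) B R p : ℝ) * Real.log (T : ℝ) ^ k / √(T : ℝ)) + C / (T : ℝ) := by
  -- The exponent 2 covers the burn-in and the sum of l/r, both of order τ log²T.
  refine ⟨2, fun M B _ πmin L G Δ c₁ c₂ hL hG hc₁ hc₁₂ => ?_⟩
  have hB : 0 < B := NeZero.pos B
  by_cases hpos : 2 ≤ M ∧ 0 < πmin ∧ 0 ≤ Δ
  swap
  · refine ⟨1, 1, one_pos, one_pos, fun R p hR hp _ hπ d f x₀ _ _ _ hΔ => absurd ?_ hpos⟩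
    have hN : (R + 1) * B < M * B := Nat.mul_lt_mul_of_pos_right hR hB
    have : Nonempty (Fin (M * B)) := ⟨⟨0, by omega⟩⟩
    refine ⟨by omega, ?_, by simpa using hΔ x₀⟩
    obtain ⟨i, hi⟩ := exists_eq_ciInf_of_finite (f := fun i => clientStationary (M * B) B R p i)
    rw [← hπ, ← hi]
    exact clientStationary_pos hp hN i
  obtain ⟨hM, hπ0, hΔ0⟩ := hpos
  have hMB : 0 < M * B := Nat.mul_pos (by omega) hB
  have hB' : (0 : ℝ) < B := Nat.cast_pos.2 hB
  obtain ⟨C₀, C₁, hC₁, hlarge⟩ := exists_rate_of_large (M * B) B M hMB hM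
    (bmin := B * πmin) (L := L + 1) (G := G) (mul_pos hB' hπ0) (by linarith) hΔ0 hc₁ hc₁₂
  obtain ⟨T₁, hT₁3, hT₁⟩ := exists_forall_mul_log_pow_le_sqrt C₀
  -- For T < T₁ one has αK ≤ c₂ and r ≤ T₁, so W bounds the gap on every path; the summand 4(L +
  -- 1)WT₁ of C puts these horizons into C/T.
  set W := gapBound B c₂ (L + 1) (8 * (L + 1) * Δ + 2 * G ^ 2) Δ T₁ with hW
  have hQ : 0 ≤ 8 * (L + 1) * Δ + 2 * G ^ 2 := by positivity
  have hW0 : 0 ≤ W := by rw [hW]; unfold gapBound; positivity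
  refine ⟨1, C₁ + 4 * (L + 1) * W * T₁ + 1, one_pos, by positivity, ?_⟩
  intro R p hR hp _ hπ d f x₀ hdiff hhet hsm hΔ K T α hK hT _ hα1 hα2 Ω _ μ _ X ι hX hι hunif hind
  have hN : (R + 1) * B < M * B := Nat.mul_lt_mul_of_pos_right hR hB
  have hτ1 := (tauMix_spec (R := R) hp hN).1
  set τ := tauMix (M * B) B R p with hτ
  have hτ' : (1 : ℝ) ≤ τ := by exact_mod_cast hτ1
  have hK' : (0 : ℝ) < K := by exact_mod_cast hK
  have hT' : (1 : ℝ) ≤ T := by exact_mod_cast hT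
  have hs1 : 1 ≤ √(T : ℝ) := Real.one_le_sqrt.2 hT'
  have hs0 : 0 < √(T : ℝ) := by linarith
  have hα : 0 ≤ α := le_trans (by positivity) hα1
  have hη1 : c₁ / (τ * √(T : ℝ)) ≤ α * K := by
    rw [← div_le_iff₀ hK']
    refine le_trans (le_of_eq ?_) hα1
    rw [div_div]; ring
  have hη2 : α * K ≤ c₂ / (τ * √(T : ℝ)) := by
    rw [← le_div_iff₀ hK']
    refine hα2.trans (le_of_eq ?_)
    rw [div_div]; ring
  have hfam : IsSmoothFamily f (L + 1) G :=
    { one_le := by linarith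
      G_nonneg := hG.le
      differentiable := hdiff
      heterogeneity := fun i x => (sq_le_sq₀ (norm_nonneg _) hG.le).1 (hhet i x)
      smooth := fun i x y => (hsm i x y).trans
        (mul_le_mul_of_nonneg_right (by linarith) (norm_nonneg _)) }
  set H := T + M * (τ * (Nat.log 2 T + 1)) with hH
  have hE := (isParticipationExpectation_pathExpectation hX H).isMixingExpectation hp hN
    (Nat.log 2 T + 1)
  obtain ⟨hint, heq⟩ := integral_uniform_round hX.measurable (show T ≤ H by omega) hι hunif hind
    (fun r S => ‖gradient (globalObj f) (serverModel f α K x₀ S r)‖ ^ 2) (fun r S S' h => by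
      have e : serverModel f α K x₀ S r = serverModel f α K x₀ S' r := dependsOn_serverModel r h
      simp only [e])
  refine ⟨hint, heq.trans_le ?_⟩
  have hX0 : 0 ≤ (τ : ℝ) * Real.log T ^ 2 / √(T : ℝ) := by positivity
  have hT0 : (0 : ℝ) < T := by linarith
  rw [one_div, inv_mul_le_iff₀ hT0]
  by_cases hTT : T₁ ≤ T
  · have hβ : ∀ i, B * πmin ≤ B * clientStationary (M * B) B R p i := by
      intro i
      rw [← hπ]
      exact mul_le_mul_of_nonneg_left (ciInf_le (Set.finite_range _).bddBelow i) hB'.le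
    refine (hlarge T (hT₁3.trans hTT) (hT₁ T hTT) d f x₀ α K _ R τ _ hfam hα hΔ hβ
      (fun i => mul_clientStationary_le_one hp hN.le i) (by omega) hτ1 hη1 hη2 hE).trans ?_
    refine mul_le_mul_of_nonneg_left ?_ hT0.le
    have h1 : C₁ * (τ * Real.log T ^ 2 / √(T : ℝ)) ≤
        (C₁ + 4 * (L + 1) * W * T₁ + 1) * (τ * Real.log T ^ 2 / √(T : ℝ)) := by
      refine mul_le_mul_of_nonneg_right ?_ hX0
      linarith [show 0 ≤ 4 * (L + 1) * W * T₁ by positivity]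
    have h2 : 0 ≤ (C₁ + 4 * (L + 1) * W * T₁ + 1) / T := by positivity
    linarith
  · have hTT' : T ≤ T₁ := by omega
    have hTT1 : (T : ℝ) ≤ T₁ := by exact_mod_cast hTT'
    have hηc : α * K ≤ c₂ := hη2.trans (div_le_self (by linarith) (by nlinarith))
    have hη0 : 0 ≤ α * K := by positivity
    have hterm : ∀ r ∈ Finset.range T, pathExpectation μ hX.measurable H
        (fun S => ‖gradient (globalObj f) (serverModel f α K x₀ S r)‖ ^ 2) ≤ 4 * (L + 1) * W := by
      intro r hr
      refine (hE.expect_norm_gradient_sq_le hfam hα hΔ r).trans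
        (mul_le_mul_of_nonneg_left ?_ (by linarith))
      refine (gapBound_mono hη0 (by linarith) hQ
        (show r ≤ T₁ from (Finset.mem_range.1 hr).le.trans hTT')).trans ?_
      rw [hW]
      unfold gapBound
      have := Real.log_natCast_nonneg T₁
      gcongr
    calc _ ≤ ∑ _r ∈ Finset.range T, 4 * (L + 1) * W := Finset.sum_le_sum hterm
      _ = T * (4 * (L + 1) * W * 1) := by simp
      _ ≤ T * (4 * (L + 1) * W * (T₁ / T)) := by
          gcongr
          rwa [one_le_div hT0]
      _ ≤ _ := by
          refine mul_le_mul_of_nonneg_left ?_ hT0.le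
          have h1 : 0 ≤ (C₁ + 4 * (L + 1) * W * T₁ + 1) * (τ * Real.log T ^ 2 / √(T : ℝ)) := by
            positivity
          have h2 : 4 * (L + 1) * W * (T₁ / T) ≤ (C₁ + 4 * (L + 1) * W * T₁ + 1) / T := by
            rw [mul_div_assoc']
            refine div_le_div_of_nonneg_right ?_ hT0.le
            linarith
          linarith
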